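/- Let $\Sigma$ be a finite ranked alphabet. A macro tree transducer (mtt) $\mathcal T=(P,P_0,\Pi)$ over $\Sigma$ has finitely many procedures $p^{(k)}$, each with a number $k$ of accumulating parameters (initial procedures $p\in P_0$ have none), and finitely many rules $p(a(x_1,\dots,x_n),y_1,\dots,y_k)\to e$, where $e::=b(e_1,\dots,e_m)\mid p'(x_h,e_1,\dots,e_l)\mid y_j$. The copy numbers $b[p]$ are the least solution in $\{1<2<\dots<\infty\}$ of the constraints $b[p]\ge b_i[e]$ (for all rules as above and $1\le i\le n$), where $b_i[y_j]=0$, $b_i[a(e_1,\dots,e_m)]=\sum_j b_i[e_j]$ and $b_i[p'(x_h,e_1,\dots,e_l)]=(b[p']\text{ if }h=i\text{, else }0)+\sum_j b_i[e_j]$. The mtt is syntactically $b$-bounded copying if $b[p]\le b$ for all $p\in P_0$. Given an mtt $\mathcal T$, a bottom-up tree automaton $\mathcal M_{\rm in}$ and a complete deterministic bottom-up tree automaton $\mathcal M_{\rm out}$, all over $\Sigma$, let $\mathcal M=(Q,Q_F,\Delta)$ be the complement of $\mathcal M_{\rm out}$ (final states exchanged with non-final ones). The typechecking algorithm 1. computes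 the alternating tree automaton $\mathcal A$ with states $\langle p^{(k)},q,\vec q\rangle$ ($q\in Q$, $\vec q\in Q^k$), initial states $\langle p_0,q\rangle$ ($p_0\in P_0$, $q\in Q_F$) and $\Phi(\langle p,q,\vec q\rangle,a)=\bigvee_{p(a(\vec x),\vec y)\to e}\mathrm{Inf}(e,q,\vec q)$, where $\mathrm{Inf}(b(\vec e),q,\vec q)=\bigvee_{(q\leftarrow b(\vec{q'}))\in\Delta}\bigwedge_j\mathrm{Inf}(e_j,q'_j,\vec q)$, $\mathrm{Inf}(p'(x_h,e_1,\dots,e_l),q,\vec q)=\bigvee_{\vec{q'}\in Q^l}\bigl(\downarrow_h\langle p',q,\vec{q'}\rangle\wedge\bigwedge_j\mathrm{Inf}(e_j,q'_j,\vec q)\bigr)$, and $\mathrm{Inf}(y_j,q,\vec q)$ is $\top$ if $q=q_j$ and $\bot$ otherwise, equal subformulas $\mathrm{Inf}(e',q,\vec q)$ of a rule body being shared (computed once); 2. forms the alternating automaton $\mathcal A'$ of the intersection of $\mathcal M_{\rm in}$ and $\mathcal A$, by adding a single initial state that requires acceptance by both; 3. checks emptiness of $\mathcal A'$: top-down, starting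 from the singleton of the initial state, it collects, for each set $\overline X$ of states that it meets, the implications $\overline X\Leftarrow\overline X_1\wedge\dots\wedge\overline X_n$ with $(\overline X_1,\dots,\overline X_n)$ in the disjunctive normal form of $\bigwedge_{X\in\overline X}\Phi(X,a^{(n)})$, $a\in\Sigma$, and then tests whether the variable $\{X_0\}$, $X_0$ the initial state, is derivable from them; it answers "empty" (well-typed) iff it is not. Then for all fixed $b$ and $k$ there is a polynomial $P_{b,k}$ such that, for all $\Sigma$, $\mathcal M_{\rm in}$, $\mathcal M_{\rm out}$ and all syntactically $b$-bounded copying mtts $\mathcal T$ whose procedures have at most $k$ parameters, the algorithm halts after at most $P_{b,k}(N)$ elementary steps, where $N$ is the total size of $\Sigma$, $\mathcal T$, $\mathcal M_{\rm in}$ and $\mathcal M_{\rm out}$; and its answer is "empty" iff the system of all implications of $\mathcal A'$ does not derive $\{X_0\}$. -/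

import Mathlib

namespace MttTypecheck

/-! ### Ranked alphabets, macro tree transducers, tree automata

All finite sets are initial segments of the natural numbers and all indices start at `0`.
A ranked alphabet is the list `rank` of the arities of its symbols: the symbols are the numbers
`a < rank.length`, and `a` has arity `rank[a]`. -/

/-- Right-hand sides of transducer rules: `var j` is the accumulating parameter `y_j`,
`cons b [e_1, …, e_m]` is `b(e_1, …, e_m)`, and `call p h [e_1, …, e_l]` is
`p(x_h, e_1, …, e_l)`. -/
inductive Expr : Type
  | var (j : ℕ) : Expr
  | cons (b : ℕ) (es : List Expr) : Expr
  | call (p h : ℕ) (es : List Expr) : Expr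

/-- The rule `proc(symbol(x_1, …, x_n), y_1, …, y_k) → body`. -/
structure MttRule : Type where
  proc : ℕ
  symbol : ℕ
  body : Expr

/-- A macro tree transducer. The procedures are the numbers `p < arity.length`, and `p` has
`arity[p]` accumulating parameters; `initial` lists the initial procedures. -/
structure Mtt : Type where
  arity : List ℕ
  initial : List ℕ
  rules : List MttRule

/-- The bottom-up transition `target ← symbol(args)`. -/
structure BtaRule : Type where
  target : ℕ
  symbol : ℕ
  args : List ℕ

/-- A bottom-up tree automaton with states `q < states`. -/
structure Bta : Type where
  states : ℕ
  final : List ℕ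
  rules : List BtaRule

/-- An instance of the typechecking problem: a ranked alphabet, a transducer, an input type and
an output type. -/
structure Instance : Type where
  rank : List ℕ
  mtt : Mtt
  inp : Bta
  out : Bta

mutual
/-- `e.WF rank arity n k`: `e` is an `(n, k)`-expression. -/
def Expr.WF (rank arity : List ℕ) (n k : ℕ) : Expr → Prop
  | .var j => j < k
  | .cons b es => rank[b]? = some es.length ∧ Expr.AllWF rank arity n k es
  | .call p h es => h < n ∧ arity[p]? = some es.length ∧ Expr.AllWF rank arity n k es
def Expr.AllWF (rank arity : List ℕ) (n k : ℕ) : List Expr → Prop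
  | [] => True
  | e :: es => Expr.WF rank arity n k e ∧ Expr.AllWF rank arity n k es
end

/-- `T` is a macro tree transducer over the alphabet `rank`; initial procedures have no
parameters. -/
def Mtt.WF (rank : List ℕ) (T : Mtt) : Prop :=
  (∀ p ∈ T.initial, T.arity[p]? = some 0) ∧
  ∀ r ∈ T.rules, ∃ n k, rank[r.symbol]? = some n ∧ T.arity[r.proc]? = some k ∧
    r.body.WF rank T.arity n k

/-- `M` is a bottom-up tree automaton over the alphabet `rank`. -/
def Bta.WF (rank : List ℕ) (M : Bta) : Prop :=
  (∀ q ∈ M.final, q < M.states) ∧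
  ∀ r ∈ M.rules, r.target < M.states ∧ rank[r.symbol]? = some r.args.length ∧
    ∀ q ∈ r.args, q < M.states

/-- `M` is complete and deterministic: for each symbol `a` of arity `n` and each `n`-tuple `qs`
of states, there is exactly one transition of the form `q ← a(qs)`. -/
def Bta.CompleteDeterministic (rank : List ℕ) (M : Bta) : Prop :=
  ∀ a n, rank[a]? = some n → ∀ qs : List ℕ, qs.length = n → (∀ q ∈ qs, q < M.states) →
    M.rules.countP (fun r => decide (r.symbol = a ∧ r.args = qs)) = 1

/-- A well-formed instance: the output type is a complete deterministic automaton, the input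
type is an arbitrary one. -/
def Instance.WF (I : Instance) : Prop :=
  I.mtt.WF I.rank ∧ I.inp.WF I.rank ∧ I.out.WF I.rank ∧ I.out.CompleteDeterministic I.rank

/-! ### Size of an instance -/

mutual
/-- The number of nodes of an expression. -/
def Expr.size : Expr → ℕ
  | .var _ => 1
  | .cons _ es => 1 + Expr.sizeAll es
  | .call _ _ es => 1 + Expr.sizeAll es
def Expr.sizeAll : List Expr → ℕ
  | [] => 0
  | e :: es => e.size + Expr.sizeAll es
end

def Mtt.size (T : Mtt) : ℕ :=
  (T.arity.map (· + 1)).sum + T.initial.length + (T.rules.map fun r => 2 + r.body.size).sum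

def Bta.size (M : Bta) : ℕ :=
  M.states + M.final.length + (M.rules.map fun r => 2 + r.args.length).sum

def Instance.size (I : Instance) : ℕ :=
  (I.rank.map (· + 1)).sum + I.mtt.size + I.inp.size + I.out.size

/-! ### Syntactically bounded copying -/

mutual
/-- `e.copies c i` is the copy number `b_i[e]` of the `i`-th input subtree in `e`, where `c p` is
the copy number of the procedure `p`. -/
def Expr.copies (c : ℕ → ℕ∞) (i : ℕ) : Expr → ℕ∞
  | .var _ => 0
  | .cons _ es => Expr.copiesAll c i es
  | .call p h es => (if h = i then c p else 0) + Expr.copiesAll c i es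
def Expr.copiesAll (c : ℕ → ℕ∞) (i : ℕ) : List Expr → ℕ∞
  | [] => 0
  | e :: es => Expr.copies c i e + Expr.copiesAll c i es
end

/-- `c` takes values in `{1 < 2 < … < ∞}` and satisfies the constraints `c p ≥ b_i[e]`, for all
rules `p(a(x_1, …, x_n), …) → e` and all `i` among the `n` input positions. -/
def Mtt.CopySolution (rank : List ℕ) (T : Mtt) (c : ℕ → ℕ∞) : Prop :=
  (∀ p, 1 ≤ c p) ∧
  ∀ r ∈ T.rules, ∀ n, rank[r.symbol]? = some n → ∀ i < n, r.body.copies c i ≤ c r.proc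

/-- The maximal copy number of `p`: its value in the least solution of the constraints. -/
noncomputable def Mtt.copyNumber (rank : List ℕ) (T : Mtt) (p : ℕ) : ℕ∞ :=
  ⨅ c : {c : ℕ → ℕ∞ // T.CopySolution rank c}, c.1 p

/-- `T` is syntactically `b`-bounded copying. -/
def Mtt.BoundedCopying (rank : List ℕ) (T : Mtt) (b : ℕ) : Prop :=
  ∀ p ∈ T.initial, T.copyNumber rank p ≤ b

/-! ### Alternating tree automata and the system of implications -/

/-- Formulas of alternating tree automata; `atom h X` is `↓_h X`. -/
inductive Formula (S : Type) : Type
  | atom (h : ℕ) (X : S) : Formula S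
  | or (φ ψ : Formula S) : Formula S
  | and (φ ψ : Formula S) : Formula S
  | top : Formula S
  | bot : Formula S

def Formula.bigOr {S : Type} (l : List (Formula S)) : Formula S := l.foldr .or .bot

def Formula.bigAnd {S : Type} (l : List (Formula S)) : Formula S := l.foldr .and .top

/-- Disjunctive normal form, as a set of tuples of sets of states. The tuples for a symbol of
arity `n` are functions on `ℕ` of which only the first `n` values matter. -/
def Formula.dnf {S : Type} [DecidableEq S] : Formula S → Set (ℕ → Finset S)
  | .atom h X => {fun i => if i = h then {X} else ∅}
  | .or φ ψ => φ.dnf ∪ ψ.dnf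
  | .and φ ψ => {Z | ∃ U ∈ φ.dnf, ∃ V ∈ ψ.dnf, Z = fun i => U i ∪ V i}
  | .top => {fun _ => ∅}
  | .bot => ∅

/-- An alternating tree automaton with state space `S`. -/
structure Ata (S : Type) : Type where
  initial : Set S
  Φ : S → ℕ → Formula S

/-- `A.Derives rank X`: the propositional variable `X`, a finite set of states, is derivable from
the implications `X ⇐ X_1 ∧ … ∧ X_n`, where `(X_1, …, X_n)` belongs to the disjunctive normal form
of `⋀_{Y ∈ X} Φ(Y, a)` for some symbol `a` of arity `n`. -/
inductive Ata.Derives {S : Type} [DecidableEq S] (rank : List ℕ) (A : Ata S) : Finset S → Prop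
  | intro (X : Finset S) (a n : ℕ) (ha : rank[a]? = some n) (Z : ℕ → Finset S)
      (hZ : Z ∈ (Formula.bigAnd (X.toList.map fun Y => A.Φ Y a)).dnf)
      (h : ∀ i < n, Ata.Derives rank A (Z i)) : Ata.Derives rank A X

/-! ### The automaton of the typechecking problem -/

/-- States: `call p q qs` is the state `⟨p, q, qs⟩` of the automaton inferred for the preimage,
`inp q` is a state of the input type, and `start` is the initial state of the intersection. -/
inductive State : Type
  | start : State
  | inp (q : ℕ) : State
  | call (p q : ℕ) (qs : List ℕ) : State
  deriving DecidableEq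

/-- All `l`-tuples of numbers smaller than `n`. -/
def tuples (n : ℕ) : ℕ → List (List ℕ)
  | 0 => [[]]
  | l + 1 => (List.range n).flatMap fun q => (tuples n l).map fun qs => q :: qs

mutual
/-- Backward inference: the formula `Inf(e, q, qs)`, for an output automaton `M`. -/
def inf (M : Bta) (qs : List ℕ) : Expr → ℕ → Formula State
  | .var j, q => if qs[j]? = some q then .top else .bot
  | .cons b es, q =>
      .bigOr ((M.rules.filter fun r => r.target = q ∧ r.symbol = b).map fun r =>
        infAll M qs es r.args)
  | .call p h es, q =>
      .bigOr ((tuples M.states es.length).map fun qs' =>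
        .and (.atom h (.call p q qs')) (infAll M qs es qs'))
/-- The conjunction of the formulas `Inf(e_j, q'_j, qs)`. -/
def infAll (M : Bta) (qs : List ℕ) : List Expr → List ℕ → Formula State
  | e :: es, q :: qs' => .and (inf M qs e q) (infAll M qs es qs')
  | _, _ => .top
end

/-- The final states of the complement of the output type. -/
def Instance.coFinal (I : Instance) : List ℕ :=
  (List.range I.out.states).filter fun q => q ∉ I.out.final

/-- `Φ(⟨p, q, qs⟩, a)`, the disjunction of `Inf(e, q, qs)` over the rules
`p(a(x_1, …, x_n), y_1, …, y_k) → e`. -/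
def Instance.phiCall (I : Instance) (p q : ℕ) (qs : List ℕ) (a : ℕ) : Formula State :=
  .bigOr ((I.mtt.rules.filter fun r => r.proc = p ∧ r.symbol = a).map fun r =>
    inf I.out qs r.body q)

/-- The input type, read as an alternating automaton. -/
def Instance.phiInp (I : Instance) (q a : ℕ) : Formula State :=
  .bigOr ((I.inp.rules.filter fun r => r.target = q ∧ r.symbol = a).map fun r =>
    .bigAnd (r.args.zipIdx.map fun x => .atom x.2 (.inp x.1)))

/-- The alternating tree automaton for the intersection of the input type with the preimage of
the complement of the output type. Its states `call p q qs` with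
their formulas form the automaton of the preimage, whose initial states are `call p q []` with `p`
an initial procedure and `q` a final state of the complement of the output type. -/
def Instance.ata (I : Instance) : Ata State where
  initial := {State.start}
  Φ := fun X a =>
    match X with
    | .call p q qs => I.phiCall p q qs a
    | .inp q => I.phiInp q a
    | .start =>
        .and (.bigOr (I.mtt.initial.flatMap fun p => I.coFinal.map fun q => I.phiCall p q [] a))
          (.bigOr (I.inp.final.map fun q => I.phiInp q a))

/-! ### Step counting

A value of type `Timed α` is a value of type `α` together with the number of steps spent to
compute it. In the program below, each call of a function, hence each round of each
recursion, costs one step (`tick`); only list and pair constructors, pattern matching, Boolean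
connectives and one comparison or increment of numbers are done within such a step. -/

structure Timed (α : Type) : Type where
  val : α
  time : ℕ

instance : Monad Timed where
  pure a := ⟨a, 0⟩
  bind x f := ⟨(f x.val).val, x.time + (f x.val).time⟩

def tick : Timed Unit := ⟨(), 1⟩

section lists

variable {α β : Type}

def appendT : List α → List α → Timed (List α)
  | [], ys => do tick; pure ys
  | x :: xs, ys => do
      tick
      let r ← appendT xs ys
      pure (x :: r)

def lengthT : List α → Timed ℕ
  | [] => do tick; pure 0
  | _ :: xs => do
      tick
      let n ← lengthT xs
      pure (n + 1)

def mapT (f : α → Timed β) : List α → Timed (List β)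
  | [] => do tick; pure []
  | x :: xs => do
      tick
      let y ← f x
      let ys ← mapT f xs
      pure (y :: ys)

def flatMapT (f : α → Timed (List β)) : List α → Timed (List β)
  | [] => do tick; pure []
  | x :: xs => do
      tick
      let y ← f x
      let ys ← flatMapT f xs
      appendT y ys

def filterT (f : α → Timed Bool) : List α → Timed (List α)
  | [] => do tick; pure []
  | x :: xs => do
      tick
      let b ← f x
      let ys ← filterT f xs
      pure (if b then x :: ys else ys)

def allT (f : α → Timed Bool) : List α → Timed Bool
  | [] => do tick; pure true
  | x :: xs => do
      tick
      let b ← f x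
      if b then allT f xs else pure false

/-- Membership with respect to the equality test `eq`. -/
def memT (eq : α → α → Timed Bool) (x : α) : List α → Timed Bool
  | [] => do tick; pure false
  | y :: ys => do
      tick
      let b ← eq x y
      if b then pure true else memT eq x ys

/-- The `i`-th entry of a list, or `d` if there is none. -/
def getT (d : α) : List α → ℕ → Timed α
  | [], _ => do tick; pure d
  | x :: _, 0 => do tick; pure x
  | _ :: xs, i + 1 => do
      tick
      getT d xs i

end lists

def natEqT (m n : ℕ) : Timed Bool := do
  tick
  pure (decide (m = n))

def natListEqT : List ℕ → List ℕ → Timed Bool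
  | [], [] => do tick; pure true
  | x :: xs, y :: ys => do
      tick
      let b ← natEqT x y
      if b then natListEqT xs ys else pure false
  | _, _ => do tick; pure false

def stateEqT : State → State → Timed Bool
  | .start, .start => do tick; pure true
  | .inp q, .inp q' => do
      tick
      natEqT q q'
  | .call p q qs, .call p' q' qs' => do
      tick
      let b ← natEqT p p'
      let c ← natEqT q q'
      let d ← natListEqT qs qs'
      pure (b && c && d)
  | _, _ => do tick; pure false

/-- The list `[s, s + 1, …, s + n - 1]`. -/
def rangeT : ℕ → ℕ → Timed (List ℕ)
  | _, 0 => do tick; pure []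
  | s, n + 1 => do
      tick
      let r ← rangeT (s + 1) n
      pure (s :: r)

/-- All tuples of length `l` with entries from `Q`. -/
def tuplesT (Q : List ℕ) : ℕ → Timed (List (List ℕ))
  | 0 => do tick; pure [[]]
  | l + 1 => do
      tick
      let ts ← tuplesT Q l
      flatMapT (fun q => mapT (fun t => do tick; pure (q :: t)) ts) Q

/-! ### The algorithm, first phase: backward inference -/

/-- Families of formulas, with shared subformulas. The `q`-th member of `node rows children` is
the disjunction, over the pairs `(atoms, sel)` in the `q`-th row, of the conjunction of the atoms
`↓_h X`, `(h, X) ∈ atoms`, and of the `sel[j]`-th members of the `j`-th children. -/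
inductive Shared : Type
  | node (rows : List (List (List (ℕ × State) × List ℕ))) (children : List Shared) : Shared

/-- A disjunction of members of families. -/
abbrev Disj : Type := List (Shared × ℕ)

/-- A conjunction of disjunctions of members of families. -/
abbrev Conj : Type := List Disj

mutual
/-- The family of the formulas `Inf(e, q, qs)`, `q ∈ Q`. -/
def inferT (M : Bta) (Q qs : List ℕ) : Expr → Timed Shared
  | .var j => do
      tick
      let qs' ← mapT (fun q => do tick; pure (some q)) qs
      let y ← getT none qs' j
      let rows ← mapT (fun q =>
        match y with
        | none => do tick; pure []
        | some q' => do
            let b ← natEqT q' q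
            pure (if b then [([], [])] else [])) Q
      pure (.node rows [])
  | .cons b es => do
      tick
      let cs ← inferAllT M Q qs es
      let rows ← mapT (fun q => do
        let rs ← filterT (fun r : BtaRule => do
          let t ← natEqT r.target q
          let s ← natEqT r.symbol b
          pure (t && s)) M.rules
        mapT (fun r : BtaRule => do tick; pure ([], r.args)) rs) Q
      pure (.node rows cs)
  | .call p h es => do
      tick
      let cs ← inferAllT M Q qs es
      let l ← lengthT es
      let ts ← tuplesT Q l
      let rows ← mapT (fun q => mapT (fun t => do tick; pure ([(h, State.call p q t)], t)) ts) Q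
      pure (.node rows cs)
def inferAllT (M : Bta) (Q qs : List ℕ) : List Expr → Timed (List Shared)
  | [] => do tick; pure []
  | e :: es => do
      tick
      let c ← inferT M Q qs e
      let cs ← inferAllT M Q qs es
      pure (c :: cs)
end

/-- The table of the automaton of the preimage: for each state `⟨p, q, qs⟩`, the list of its
formulas for all symbols. -/
def backwardT (I : Instance) (syms Q : List ℕ) : Timed (List (State × List Disj)) := do
  tick
  let np ← lengthT I.mtt.arity
  let ps ← rangeT 0 np
  flatMapT (fun p => do
    let k ← getT 0 I.mtt.arity p
    let ts ← tuplesT Q k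
    flatMapT (fun qs => do
      let fams ← mapT (fun a => do
        let rs ← filterT (fun r : MttRule => do
          let b ← natEqT r.proc p
          let c ← natEqT r.symbol a
          pure (b && c)) I.mtt.rules
        mapT (fun r : MttRule => inferT I.out Q qs r.body) rs) syms
      mapT (fun q => do
        let row ← mapT (fun fs => mapT (fun f => do tick; pure (f, q)) fs) fams
        pure (State.call p q qs, row)) Q) ts) ps

def atomsT : ℕ → List ℕ → Timed (List (ℕ × State))
  | _, [] => do tick; pure []
  | i, q :: qs => do
      tick
      let r ← atomsT (i + 1) qs
      pure ((i, State.inp q) :: r)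

/-- The table of the input type, read as an alternating automaton. -/
def inputT (I : Instance) (syms : List ℕ) : Timed (List (State × List Disj)) := do
  tick
  let Q ← rangeT 0 I.inp.states
  mapT (fun q => do
    let row ← mapT (fun a => do
      let rs ← filterT (fun r : BtaRule => do
        let t ← natEqT r.target q
        let s ← natEqT r.symbol a
        pure (t && s)) I.inp.rules
      let ds ← mapT (fun r : BtaRule => do
        let ats ← atomsT 0 r.args
        pure (ats, [])) rs
      pure [(Shared.node [ds] [], 0)]) syms
    pure (State.inp q, row)) Q

/-- The row of a state in a table. -/
def lookupT {α : Type} (X : State) : List (State × List α) → Timed (List α)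
  | [] => do tick; pure []
  | (Y, row) :: rest => do
      tick
      let b ← stateEqT X Y
      if b then pure row else lookupT X rest

/-- The table of the automaton `I.ata` of the intersection. -/
def ataT (I : Instance) : Timed (List (State × List Conj)) := do
  tick
  let ns ← lengthT I.rank
  let syms ← rangeT 0 ns
  let Q ← rangeT 0 I.out.states
  let co ← filterT (fun q => do
    let b ← memT natEqT q I.out.final
    pure (!b)) Q
  let A ← backwardT I syms Q
  let B ← inputT I syms
  let As ← flatMapT (fun p => mapT (fun q => do tick; pure (State.call p q [])) co) I.mtt.initial
  let Bs ← mapT (fun q => do tick; pure (State.inp q)) I.inp.final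
  let startRow ← mapT (fun a => do
    let d ← flatMapT (fun X => do
      let row ← lookupT X A
      getT [] row a) As
    let e ← flatMapT (fun X => do
      let row ← lookupT X B
      getT [] row a) Bs
    pure [d, e]) syms
  let AB ← appendT A B
  let rest ← mapT (fun x : State × List Disj => do
    let row ← mapT (fun d => do tick; pure [d]) x.2
    pure (x.1, row)) AB
  pure ((State.start, startRow) :: rest)

/-! ### The algorithm, second phase: emptiness check

Sets of states are represented by lists, and tuples of such sets by lists of lists. -/

def unionT : List State → List State → Timed (List State)
  | [], Y => do tick; pure Y
  | x :: X, Y => do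
      tick
      let Z ← unionT X Y
      let b ← memT stateEqT x Z
      pure (if b then Z else x :: Z)

def subsetT (X Y : List State) : Timed Bool := do
  tick
  allT (fun x => memT stateEqT x Y) X

def setEqT (X Y : List State) : Timed Bool := do
  tick
  let b ← subsetT X Y
  if b then subsetT Y X else pure false

/-- Componentwise union of two tuples. -/
def tupleUnionT : List (List State) → List (List State) → Timed (List (List State))
  | X :: U, Y :: V => do
      tick
      let Z ← unionT X Y
      let W ← tupleUnionT U V
      pure (Z :: W)
  | _, _ => do tick; pure []

/-- Normal form of a conjunction, from those of the conjuncts. -/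
def prodT (D E : List (List (List State))) : Timed (List (List (List State))) := do
  tick
  flatMapT (fun U => mapT (fun V => tupleUnionT U V) E) D

/-- The `n`-tuple of empty sets. -/
def emptyTupleT : ℕ → Timed (List (List State))
  | 0 => do tick; pure []
  | n + 1 => do
      tick
      let r ← emptyTupleT n
      pure ([] :: r)

/-- The `n`-tuple with `{X}` as its `h`-th entry and empty sets elsewhere. -/
def singleTupleT (X : State) : ℕ → ℕ → Timed (List (List State))
  | 0, _ => do tick; pure []
  | n + 1, 0 => do
      tick
      let r ← emptyTupleT n
      pure ([X] :: r)
  | n + 1, h + 1 => do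
      tick
      let r ← singleTupleT X n h
      pure ([] :: r)

/-- The tuple for a conjunction of atoms. -/
def atomsTupleT (n : ℕ) : List (ℕ × State) → Timed (List (List State))
  | [] => do
      tick
      emptyTupleT n
  | (h, X) :: ats => do
      tick
      let U ← singleTupleT X n h
      let V ← atomsTupleT n ats
      tupleUnionT U V

/-- Multiplies `D` with the `sel[j]`-th entries of the `j`-th tables. -/
def selectT : List (List (List (List (List State)))) → List ℕ → List (List (List State)) →
    Timed (List (List (List State)))
  | tab :: tabs, s :: sel, D => do
      tick
      let E ← getT [] tab s
      let D' ← prodT D E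
      selectT tabs sel D'
  | _, _, D => do tick; pure D

mutual
/-- The table of the normal forms of all members of a family. -/
def dnfT (n : ℕ) : Shared → Timed (List (List (List (List State))))
  | .node rows children => do
      tick
      let tabs ← dnfAllT n children
      mapT (fun row => flatMapT (fun d : List (ℕ × State) × List ℕ => do
        let U ← atomsTupleT n d.1
        selectT tabs d.2 [U]) row) rows
def dnfAllT (n : ℕ) : List Shared → Timed (List (List (List (List (List State)))))
  | [] => do tick; pure []
  | f :: fs => do
      tick
      let t ← dnfT n f
      let ts ← dnfAllT n fs
      pure (t :: ts)
end

/-- The normal form of a conjunction of disjunctions. -/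
def conjDnfT (n : ℕ) : Conj → Timed (List (List (List State)))
  | [] => do
      tick
      let U ← emptyTupleT n
      pure [U]
  | d :: ds => do
      tick
      let D ← flatMapT (fun f : Shared × ℕ => do
        let tab ← dnfT n f.1
        getT [] tab f.2) d
      let E ← conjDnfT n ds
      prodT D E

/-- An implication `head ⇐ body_1 ∧ … ∧ body_n`. -/
structure Clause : Type where
  head : List State
  body : List (List State)

/-- All implications with head `X`. -/
def clausesT (rank : List ℕ) (table : List (State × List Conj)) (X : List State) :
    Timed (List Clause) := do
  tick
  let ns ← lengthT rank
  let syms ← rangeT 0 ns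
  flatMapT (fun a => do
    let n ← getT 0 rank a
    let c ← flatMapT (fun Y => do
      let row ← lookupT Y table
      getT [] row a) X
    let D ← conjDnfT n c
    mapT (fun U => do tick; pure (Clause.mk X U)) D) syms

/-- The memory of the top-down exploration: the sets of states still to be visited, those already
visited, and the implications collected so far. -/
structure Config : Type where
  todo : List (List State)
  seen : List (List State)
  clauses : List Clause

/-- One round of the exploration: visits the set `X`, unless it has been visited before. -/
def visitT (rank : List ℕ) (table : List (State × List Conj)) (X : List State) (c : Config) :
    Timed Config := do
  tick
  let old ← memT setEqT X c.seen
  if old then pure c else do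
    let cls ← clausesT rank table X
    let subs ← flatMapT (fun d : Clause => do tick; pure d.body) cls
    let todo ← appendT subs c.todo
    let clauses ← appendT cls c.clauses
    pure ⟨todo, X :: c.seen, clauses⟩

/-- `Explore rank table c out t`: the exploration loop, started in the configuration `c`, halts
after `t` steps, having collected the implications `out`. -/
inductive Explore (rank : List ℕ) (table : List (State × List Conj)) :
    Config → List Clause → ℕ → Prop
  | done (seen : List (List State)) (cls : List Clause) :
      Explore rank table ⟨[], seen, cls⟩ cls 1
  | visit (X : List State) (todo seen : List (List State)) (cls out : List Clause) (t : ℕ)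
      (h : Explore rank table (visitT rank table X ⟨todo, seen, cls⟩).val out t) :
      Explore rank table ⟨X :: todo, seen, cls⟩ out
        ((visitT rank table X ⟨todo, seen, cls⟩).time + t)

/-- One pass over the implications, extending the list of the derived variables. -/
def passT : List Clause → List (List State) → Timed (List (List State))
  | [], derived => do tick; pure derived
  | c :: cs, derived => do
      tick
      let ok ← allT (fun Y => memT setEqT Y derived) c.body
      let old ← memT setEqT c.head derived
      passT cs (if ok && !old then c.head :: derived else derived)

/-- As many passes over the implications `cls` as the first argument is long. -/
def passesT (cls : List Clause) : List Clause → List (List State) → Timed (List (List State))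
  | [], derived => do tick; pure derived
  | _ :: rest, derived => do
      tick
      let d ← passT cls derived
      passesT cls rest d

/-- Whether the variable `{start}` is derivable from the implications `cls`. -/
def solveT (cls : List Clause) : Timed Bool := do
  tick
  let d ← passesT cls cls []
  memT setEqT [State.start] d

/-- `I.Run ans t`: on the instance `I`, the typechecking algorithm halts after `t` steps with the
answer `ans`, where `true` means that the automaton of the intersection was found to be empty. -/
def Instance.Run (I : Instance) (ans : Bool) (t : ℕ) : Prop :=
  ∃ (cls : List Clause) (t' : ℕ),
    Explore I.rank (ataT I).val ⟨[[State.start]], [], []⟩ cls t' ∧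
    ans = !(solveT cls).val ∧ t = (ataT I).time + t' + (solveT cls).time

end MttTypecheck

-- The running time is polynomial because of a weight that never grows. Let the state ⟨p, q, qs⟩
-- weigh b[p], a state of the input type 1, and the initial state b + 1. The clauses defining b_i[e]
-- are the rules by which weights add up in the normal form of Inf(e, q, qs): a call p'(x_h, …) puts
-- a state of weight b[p'] at position h, a conjunction takes unions and so at most adds weights, a
-- disjunction only offers alternatives. Since b[p] ≥ b_i[e], every component of the normal form of
-- Φ(X, a) weighs at most as much as X (`inferT_represents`, `disj_represents`, `conj_represents`),
-- and by subadditivity the same holds for sets of states (`ConjRepresents.flatMap`). So every set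
-- met from the singleton of the initial state weighs at most b + 1, and has at most b + 1 elements
-- because every state weighs at least 1. With at most k parameters there are polynomially many
-- states, hence polynomially many such sets.
--
-- It remains to bound the implications with one head. Put m = max(|Q|, 1). Summed over all q, the
-- normal forms of Inf(e, q, qs) have at most m^c elements, where c is the number of calls in e
-- (`totalLength_inferT_le`). This rests on determinism of the output type: at a constructor, each
-- tuple of states has a single transition, so the sum over q and over transitions is a sum over
-- tuples, which factors into one sum per argument. A parameter fits at most one q, and only a call
-- costs a factor m. Further, c ≤ Σ_i b_i[e] ≤ n (b + 1) for an input symbol of arity n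
-- (`Expr.calls_le_sum_copies`), and completeness gives |Q|^n ≤ number of transitions
-- (`pow_le_length_rules`). Hence m^c ≤ (N + 1)^(b + 1) although n is not fixed. A set of at most b
-- + 1 states yields at most 2(b + 1) conjuncts, so the product of their normal forms is still
-- polynomial. Sharing makes the cost of all tables additive over the nodes of an expression.
-- Procedures with a large or infinite copy number may exist, but no set that is met contains their
-- states; only their unexpanded families are written down.
--
-- For correctness, the exploration collects all implications whose heads are reachable, and a
-- derivation of a reachable set uses no others (`solveT_val_iff`). The passes reach a fixed point,
-- since a pass that changes anything derives a new head (`passesT_closed`).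

namespace MttTypecheck

/-! ### Values and running times of the basic functions -/

namespace Timed

variable {α β : Type}

@[simp] theorem val_pure (a : α) : (pure a : Timed α).val = a := rfl
@[simp] theorem time_pure (a : α) : (pure a : Timed α).time = 0 := rfl
@[simp] theorem val_bind (x : Timed α) (f : α → Timed β) : (x >>= f).val = (f x.val).val := rfl
@[simp] theorem time_bind (x : Timed α) (f : α → Timed β) :
    (x >>= f).time = x.time + (f x.val).time := rfl
@[simp] theorem time_tick : tick.time = 1 := rfl

theorem val_ite (c : Prop) [Decidable c] (x y : Timed α) :
    (if c then x else y).val = if c then x.val else y.val := by split <;> rfl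
theorem time_ite (c : Prop) [Decidable c] (x y : Timed α) :
    (if c then x else y).time = if c then x.time else y.time := by split <;> rfl

end Timed

section lists

variable {α β : Type}

@[simp] theorem appendT_val (xs ys : List α) : (appendT xs ys).val = xs ++ ys := by
  induction xs with
  | nil => rfl
  | cons x xs ih => simp [appendT, ih]

@[simp] theorem appendT_time (xs ys : List α) : (appendT xs ys).time = xs.length + 1 := by
  induction xs with
  | nil => rfl
  | cons x xs ih => simp [appendT, ih]; omega

@[simp] theorem lengthT_val (xs : List α) : (lengthT xs).val = xs.length := by
  induction xs with
  | nil => rfl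
  | cons x xs ih => simp [lengthT, ih]

@[simp] theorem lengthT_time (xs : List α) : (lengthT xs).time = xs.length + 1 := by
  induction xs with
  | nil => rfl
  | cons x xs ih => simp [lengthT, ih]; omega

@[simp] theorem mapT_val (f : α → Timed β) (xs : List α) :
    (mapT f xs).val = xs.map fun x => (f x).val := by
  induction xs with
  | nil => rfl
  | cons x xs ih => simp [mapT, ih]

theorem mapT_time_le (f : α → Timed β) (xs : List α) (c : ℕ) (h : ∀ x ∈ xs, (f x).time ≤ c) :
    (mapT f xs).time ≤ 1 + xs.length * (1 + c) := by
  induction xs with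
  | nil => simp [mapT]
  | cons x xs ih =>
    have h1 := h x (by simp)
    have h2 := ih fun y hy => h y (by simp [hy])
    simp only [mapT, Timed.time_bind, Timed.time_tick, Timed.time_pure, List.length_cons]
    rw [add_mul]; omega

@[simp] theorem flatMapT_val (f : α → Timed (List β)) (xs : List α) :
    (flatMapT f xs).val = xs.flatMap fun x => (f x).val := by
  induction xs with
  | nil => rfl
  | cons x xs ih => simp [flatMapT, ih]

/-- Besides the tick and the call of `f`, each round appends the result of `f`, which costs one step
more than its length; hence the separate bound `d` and the constant 2. -/
theorem flatMapT_time_le (f : α → Timed (List β)) (xs : List α) (c d : ℕ)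
    (h : ∀ x ∈ xs, (f x).time ≤ c) (hd : ∀ x ∈ xs, (f x).val.length ≤ d) :
    (flatMapT f xs).time ≤ 1 + xs.length * (2 + c + d) := by
  induction xs with
  | nil => simp [flatMapT]
  | cons x xs ih =>
    have h1 := h x (by simp)
    have h3 := hd x (by simp)
    have h2 := ih (fun y hy => h y (by simp [hy])) fun y hy => hd y (by simp [hy])
    simp only [flatMapT, Timed.time_bind, Timed.time_tick, appendT_time, List.length_cons]
    rw [add_mul]; omega

theorem length_flatMap_le (f : α → List β) (xs : List α) (d : ℕ)
    (h : ∀ x ∈ xs, (f x).length ≤ d) : (xs.flatMap f).length ≤ xs.length * d := by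
  induction xs with
  | nil => simp
  | cons x xs ih =>
    have h1 := h x (by simp)
    have h2 := ih fun y hy => h y (by simp [hy])
    simp only [List.flatMap_cons, List.length_append, List.length_cons]
    rw [add_mul]; omega

@[simp] theorem filterT_val (f : α → Timed Bool) (xs : List α) :
    (filterT f xs).val = xs.filter fun x => (f x).val := by
  induction xs with
  | nil => rfl
  | cons x xs ih =>
    simp only [filterT, Timed.val_bind, Timed.val_pure, ih, List.filter_cons]

theorem filterT_time_le (f : α → Timed Bool) (xs : List α) (c : ℕ)
    (h : ∀ x ∈ xs, (f x).time ≤ c) : (filterT f xs).time ≤ 1 + xs.length * (1 + c) := by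
  induction xs with
  | nil => simp [filterT]
  | cons x xs ih =>
    have h1 := h x (by simp)
    have h2 := ih fun y hy => h y (by simp [hy])
    simp only [filterT, Timed.time_bind, Timed.time_tick, Timed.time_pure, List.length_cons]
    rw [add_mul]; omega

@[simp] theorem allT_val (f : α → Timed Bool) (xs : List α) :
    (allT f xs).val = xs.all fun x => (f x).val := by
  induction xs with
  | nil => rfl
  | cons x xs ih =>
    simp only [allT, Timed.val_bind, Timed.val_ite, ih, List.all_cons, Timed.val_pure]
    cases (f x).val <;> simp

theorem allT_time_le (f : α → Timed Bool) (xs : List α) (c : ℕ)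
    (h : ∀ x ∈ xs, (f x).time ≤ c) : (allT f xs).time ≤ 1 + xs.length * (1 + c) := by
  induction xs with
  | nil => simp [allT]
  | cons x xs ih =>
    have h1 := h x (by simp)
    have h2 := ih fun y hy => h y (by simp [hy])
    simp only [allT, Timed.time_bind, Timed.time_tick, Timed.time_ite, Timed.time_pure,
      List.length_cons]
    rw [add_mul]; split <;> omega

@[simp] theorem memT_val (eq : α → α → Timed Bool) (x : α) (ys : List α) :
    (memT eq x ys).val = ys.any fun y => (eq x y).val := by
  induction ys with
  | nil => rfl
  | cons y ys ih =>
    simp only [memT, Timed.val_bind, Timed.val_ite, ih, List.any_cons, Timed.val_pure]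
    cases (eq x y).val <;> simp

theorem memT_time_le (eq : α → α → Timed Bool) (x : α) (ys : List α) (c : ℕ)
    (h : ∀ y ∈ ys, (eq x y).time ≤ c) : (memT eq x ys).time ≤ 1 + ys.length * (1 + c) := by
  induction ys with
  | nil => simp [memT]
  | cons y ys ih =>
    have h1 := h y (by simp)
    have h2 := ih fun y hy => h y (by simp [hy])
    simp only [memT, Timed.time_bind, Timed.time_tick, Timed.time_ite, Timed.time_pure,
      List.length_cons]
    rw [add_mul]; split <;> omega

@[simp] theorem getT_val (d : α) (xs : List α) (i : ℕ) : (getT d xs i).val = xs.getD i d := by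
  induction xs generalizing i with
  | nil => simp [getT]
  | cons x xs ih => cases i <;> simp [getT, ih]

theorem getT_time_le (d : α) (xs : List α) (i : ℕ) : (getT d xs i).time ≤ 1 + xs.length := by
  induction xs generalizing i with
  | nil => simp [getT]
  | cons x xs ih =>
    cases i with
    | zero => simp [getT]
    | succ i => have := ih i; simp [getT]; omega

end lists

@[simp] theorem natEqT_val (m n : ℕ) : (natEqT m n).val = decide (m = n) := rfl
@[simp] theorem natEqT_time (m n : ℕ) : (natEqT m n).time = 1 := rfl

@[simp] theorem natListEqT_val (xs ys : List ℕ) : (natListEqT xs ys).val = decide (xs = ys) := by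
  induction xs generalizing ys with
  | nil => cases ys <;> simp [natListEqT]
  | cons x xs ih =>
    cases ys with
    | nil => simp [natListEqT]
    | cons y ys => by_cases h : x = y <;> simp [natListEqT, ih, h]

theorem natListEqT_time_le (xs ys : List ℕ) : (natListEqT xs ys).time ≤ 1 + 2 * xs.length := by
  induction xs generalizing ys with
  | nil => cases ys <;> simp [natListEqT]
  | cons x xs ih =>
    cases ys with
    | nil => simp [natListEqT]
    | cons y ys =>
      have := ih ys
      simp only [natListEqT, Timed.time_bind, Timed.time_tick, Timed.time_ite, Timed.time_pure,
        List.length_cons, natEqT_time]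
      split <;> omega

/-- The number of parameters in a state. -/
def State.width : State → ℕ
  | .call _ _ qs => qs.length
  | _ => 0

@[simp] theorem stateEqT_val (X Y : State) : (stateEqT X Y).val = decide (X = Y) := by
  cases X <;> cases Y <;> simp [stateEqT, Bool.and_assoc]

/-- Only the width of the first argument enters, so the cost of searching for `X` in a list requires
nothing of the entries of the list. -/
theorem stateEqT_time_le (X Y : State) : (stateEqT X Y).time ≤ 4 + 2 * X.width := by
  have := natListEqT_time_le
  rcases X with _ | _ | ⟨p, q, qs⟩ <;> rcases Y with _ | _ | ⟨p', q', qs'⟩ <;>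
    simp only [stateEqT, State.width, Timed.time_bind, Timed.time_tick, Timed.time_pure,
      natEqT_time, add_zero, mul_zero] <;>
    try omega
  have := this qs qs'
  omega

@[simp] theorem rangeT_val (s n : ℕ) : (rangeT s n).val = List.range' s n := by
  induction n generalizing s with
  | zero => rfl
  | succ n ih => simp [rangeT, ih, List.range'_succ]

@[simp] theorem rangeT_time (s n : ℕ) : (rangeT s n).time = n + 1 := by
  induction n generalizing s with
  | zero => rfl
  | succ n ih => simp [rangeT, ih]; omega

/-! ### Tuples -/

@[simp] theorem tuplesT_val (n l : ℕ) : (tuplesT (List.range n) l).val = tuples n l := by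
  induction l with
  | zero => rfl
  | succ l ih => simp [tuplesT, tuples, ih]

theorem length_tuples (n l : ℕ) : (tuples n l).length = n ^ l := by
  induction l with
  | zero => rfl
  | succ l ih => simp [tuples, ih, pow_succ, mul_comm]

theorem mem_tuples {n l : ℕ} {t : List ℕ} :
    t ∈ tuples n l ↔ t.length = l ∧ ∀ q ∈ t, q < n := by
  induction l generalizing t with
  | zero =>
    simp only [tuples, List.mem_singleton]
    constructor
    · rintro rfl; simp
    · intro h; exact List.length_eq_zero_iff.1 h.1
  | succ l ih =>
    simp only [tuples, List.mem_flatMap, List.mem_range, List.mem_map]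
    constructor
    · rintro ⟨q, hq, t, ht, rfl⟩
      have := ih.1 ht
      simp_all
    · rintro ⟨h1, h2⟩
      cases t with
      | nil => simp at h1
      | cons q t => exact ⟨q, h2 q (by simp), t, ih.2 ⟨by simpa using h1,
          fun q' hq' => h2 q' (by simp [hq'])⟩, rfl⟩

theorem nodup_tuples (n l : ℕ) : (tuples n l).Nodup := by
  induction l with
  | zero => simp [tuples]
  | succ l ih =>
    rw [tuples, List.nodup_flatMap]
    refine ⟨fun q _ => ih.map fun a b h => by simpa using h, ?_⟩
    refine List.Pairwise.imp ?_ (List.nodup_range (n := n))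
    intro a b hab
    simp only [Function.onFun, List.disjoint_left, List.mem_map]
    rintro _ ⟨t, _, rfl⟩ ⟨t', _, h⟩
    simp at h; exact hab h.1.symm

/-- The recursion builds the tuples of every shorter length. The intermediate powers are bounded
separately because `n ^ j` is not monotone in `j` when `n = 0`. -/
theorem tuplesT_time_le {n l K : ℕ} (hn : n ≤ K) (h : ∀ j ≤ l, n ^ j ≤ K) :
    (tuplesT (List.range n) l).time ≤ 1 + l * (2 + K * (3 + 3 * K)) := by
  induction l with
  | zero => simp [tuplesT]
  | succ l ih =>
    have ih := ih fun j hj => h j (by omega)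
    have hl := h l (by omega)
    simp only [tuplesT, Timed.time_bind, Timed.time_tick, tuplesT_val]
    have h1 := flatMapT_time_le (fun q => mapT (fun t => do tick; pure (q :: t)) (tuples n l))
      (List.range n) (1 + K * (1 + 1)) K
      (fun q _ => (mapT_time_le _ _ 1 (by simp)).trans
        (by rw [length_tuples]; gcongr)) (fun q _ => by simpa [length_tuples])
    rw [List.length_range] at h1
    have h2 : n * (2 + (1 + K * (1 + 1)) + K) ≤ K * (3 + 3 * K) := by
      calc _ ≤ K * (2 + (1 + K * (1 + 1)) + K) := by gcongr
        _ = _ := by ring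
    rw [add_mul]; omega

/-! ### Sets of states represented by lists -/

@[simp] theorem unionT_val (X Y : List State) : (unionT X Y).val = X ∪ Y := by
  induction X with
  | nil => simp [unionT]
  | cons x X ih =>
    rw [List.cons_union]
    simp only [unionT, Timed.val_bind, Timed.val_pure, ih, memT_val, stateEqT_val]
    rw [List.insert]
    congr 1
    simp [List.any_eq_true]

theorem length_union_le (X Y : List State) : (X ∪ Y).length ≤ X.length + Y.length := by
  induction X with
  | nil => simp
  | cons x X ih =>
    rw [List.cons_union]
    have : (List.insert x (X ∪ Y)).length ≤ (X ∪ Y).length + 1 := by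
      rw [List.insert]; split <;> simp
    simp only [List.length_cons]; omega

/-- A bound for the cost of operations on sets of at most `L` states, where comparing two states
costs at most `c`. -/
def unionBound (c L : ℕ) : ℕ := 1 + L * (2 + (L + L) * (1 + c))

theorem unionT_time_le {X Y : List State} {c L : ℕ} (hX : X.length ≤ L) (hY : Y.length ≤ L)
    (h : ∀ x ∈ X, 4 + 2 * x.width ≤ c) : (unionT X Y).time ≤ unionBound c L := by
  -- `L` stays fixed as the bound for each membership test, while the number of rounds follows the
  -- shrinking list.
  suffices h' : ∀ X' : List State, X'.length ≤ L → (∀ x ∈ X', 4 + 2 * x.width ≤ c) →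
      (unionT X' Y).time ≤ 1 + X'.length * (2 + (L + L) * (1 + c)) by
    exact (h' X hX h).trans (by unfold unionBound; gcongr)
  intro X' hL hc
  induction X' with
  | nil => simp [unionT]
  | cons x X' ih =>
    simp only [List.length_cons] at hL
    have h1 := ih (by omega) fun y hy => hc y (by simp [hy])
    have h2 := memT_time_le stateEqT x (X' ∪ Y) c
      fun y _ => (stateEqT_time_le x y).trans (hc x (by simp))
    have h3 := length_union_le X' Y
    have h4 : (X' ∪ Y).length * (1 + c) ≤ (L + L) * (1 + c) := by gcongr; omega
    simp only [unionT, Timed.time_bind, Timed.time_tick, Timed.time_pure, List.length_cons,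
      unionT_val]
    rw [add_mul]; omega

@[simp] theorem setEqT_val (X Y : List State) :
    (setEqT X Y).val = decide (X.toFinset = Y.toFinset) := by
  rw [Bool.eq_iff_iff]
  simp [setEqT, subsetT, Timed.val_ite, Finset.ext_iff, List.all_eq_true, List.any_eq_true]
  constructor
  · rintro ⟨h1, h2⟩ a; exact ⟨h1 a, h2 a⟩
  · intro h; exact ⟨fun a => (h a).1, fun a => (h a).2⟩

theorem setEqT_time_le {X Y : List State} {c L : ℕ} (hX : X.length ≤ L) (hY : Y.length ≤ L)
    (h : ∀ x ∈ X, 4 + 2 * x.width ≤ c) (h' : ∀ x ∈ Y, 4 + 2 * x.width ≤ c) :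
    (setEqT X Y).time ≤ 5 + 2 * (L * (2 + L * (1 + c))) := by
  have key : ∀ X Y : List State, X.length ≤ L → Y.length ≤ L →
      (∀ x ∈ X, 4 + 2 * x.width ≤ c) → (subsetT X Y).time ≤ 2 + L * (2 + L * (1 + c)) := by
    intro X Y hX hY h
    have h1 := allT_time_le (fun x => memT stateEqT x Y) X (1 + Y.length * (1 + c))
      fun x hx => memT_time_le _ _ _ c fun y _ => (stateEqT_time_le x y).trans (h x hx)
    have h2 : X.length * (1 + (1 + Y.length * (1 + c))) ≤ L * (2 + L * (1 + c)) := by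
      calc _ ≤ L * (1 + (1 + L * (1 + c))) := by gcongr
        _ = _ := by ring
    simp only [subsetT, Timed.time_bind, Timed.time_tick]
    omega
  have h1 := key X Y hX hY h
  have h2 := key Y X hY hX h'
  simp only [setEqT, Timed.time_bind, Timed.time_tick, Timed.time_ite, Timed.time_pure]
  split <;> omega

/-! ### Normal forms represented by lists of tuples -/

@[simp] theorem tupleUnionT_val (U V : List (List State)) :
    (tupleUnionT U V).val = List.zipWith (· ∪ ·) U V := by
  induction U generalizing V with
  | nil => cases V <;> simp [tupleUnionT]
  | cons X U ih => cases V <;> simp [tupleUnionT, ih]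

@[simp] theorem prodT_val (D E : List (List (List State))) :
    (prodT D E).val = D.flatMap fun U => E.map fun V => List.zipWith (· ∪ ·) U V := by
  simp [prodT]

@[simp] theorem emptyTupleT_val (n : ℕ) : (emptyTupleT n).val = List.replicate n [] := by
  induction n with
  | zero => rfl
  | succ n ih => simp [emptyTupleT, ih, List.replicate_succ]

@[simp] theorem emptyTupleT_time (n : ℕ) : (emptyTupleT n).time = n + 1 := by
  induction n with
  | zero => rfl
  | succ n ih => simp [emptyTupleT, ih]; omega

theorem length_singleTupleT (X : State) (n h : ℕ) : (singleTupleT X n h).val.length = n := by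
  induction n generalizing h with
  | zero => rfl
  | succ n ih => cases h <;> simp [singleTupleT, ih]

theorem getD_singleTupleT (X : State) (n h i : ℕ) (hi : i < n) :
    (singleTupleT X n h).val.getD i [] = if i = h then [X] else [] := by
  induction n generalizing h i with
  | zero => omega
  | succ n ih =>
    cases h with
    | zero =>
      cases i with
      | zero => simp [singleTupleT]
      | succ i => simp [singleTupleT, List.getElem?_replicate]; split <;> rfl
    | succ h =>
      cases i with
      | zero => simp [singleTupleT]
      | succ i => simpa [singleTupleT] using ih h i (by omega)

theorem singleTupleT_time_le (X : State) (n h : ℕ) : (singleTupleT X n h).time ≤ 1 + n := by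
  induction n generalizing h with
  | zero => simp [singleTupleT]
  | succ n ih =>
    cases h with
    | zero => simp [singleTupleT]
    | succ h => have := ih h; simp [singleTupleT]; omega

/-- The total weight of a list of states. -/
def weight (w : State → ℕ∞) (X : List State) : ℕ∞ := (X.map w).sum

theorem weight_union_le (w : State → ℕ∞) (X Y : List State) :
    weight w (X ∪ Y) ≤ weight w X + weight w Y := by
  induction X with
  | nil => simp [weight]
  | cons x X ih =>
    rw [List.cons_union, List.insert]
    split
    · refine ih.trans ?_
      gcongr
      simp [weight]
    · simp only [weight, List.map_cons, List.sum_cons, add_assoc] at ih ⊢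
      gcongr

/-- `U` is an `n`-tuple of lists without duplicates of elements of `univ`, and its `i`-th entry
has weight at most `ω i`. -/
def ValidTuple (univ : List State) (w : State → ℕ∞) (n : ℕ) (ω : ℕ → ℕ∞)
    (U : List (List State)) : Prop :=
  U.length = n ∧ ∀ i < n, (U.getD i []).Nodup ∧ (∀ X ∈ U.getD i [], X ∈ univ) ∧
    weight w (U.getD i []) ≤ ω i

/-- `D` lists, up to components beyond `n`, the disjunctive normal form of `φ`, and consists of
valid tuples. -/
structure Represents (univ : List State) (w : State → ℕ∞) (n : ℕ) (ω : ℕ → ℕ∞)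
    (D : List (List (List State))) (φ : Formula State) : Prop where
  valid : ∀ U ∈ D, ValidTuple univ w n ω U
  sound : ∀ U ∈ D, ∃ Z ∈ φ.dnf, ∀ i < n, (U.getD i []).toFinset = Z i
  complete : ∀ Z ∈ φ.dnf, ∃ U ∈ D, ∀ i < n, (U.getD i []).toFinset = Z i

-- Operations on represented normal forms

section

variable {univ : List State} {w : State → ℕ∞} {n : ℕ} {ω ω' : ℕ → ℕ∞}
  {D E : List (List (List State))} {φ ψ : Formula State}

theorem getD_zipWith_union {U V : List (List State)} {i : ℕ} (hU : i < U.length)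
    (hV : i < V.length) :
    (List.zipWith (· ∪ ·) U V).getD i [] = U.getD i [] ∪ V.getD i [] := by
  simp [hU, hV]

theorem ValidTuple.zipWith {U V : List (List State)} (hU : ValidTuple univ w n ω U)
    (hV : ValidTuple univ w n ω' V) :
    ValidTuple univ w n (fun i => ω i + ω' i) (List.zipWith (· ∪ ·) U V) := by
  refine ⟨by simp [hU.1, hV.1], fun i hi => ?_⟩
  rw [getD_zipWith_union (by rw [hU.1]; exact hi) (by rw [hV.1]; exact hi)]
  obtain ⟨h1, h2, h3⟩ := hU.2 i hi
  obtain ⟨h4, h5, h6⟩ := hV.2 i hi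
  refine ⟨h4.union _, fun X hX => ?_, (weight_union_le _ _ _).trans (add_le_add h3 h6)⟩
  rcases List.mem_union_iff.1 hX with h | h
  · exact h2 X h
  · exact h5 X h

theorem ValidTuple.mono {U : List (List State)} (hU : ValidTuple univ w n ω U)
    (h : ∀ i < n, ω i ≤ ω' i) : ValidTuple univ w n ω' U :=
  ⟨hU.1, fun i hi => ⟨(hU.2 i hi).1, (hU.2 i hi).2.1, (hU.2 i hi).2.2.trans (h i hi)⟩⟩

theorem Represents.mono (hD : Represents univ w n ω D φ) (h : ∀ i < n, ω i ≤ ω' i) :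
    Represents univ w n ω' D φ :=
  ⟨fun U hU => (hD.valid U hU).mono h, hD.sound, hD.complete⟩

theorem Represents.congr (hD : Represents univ w n ω D φ) (h : φ.dnf = ψ.dnf) :
    Represents univ w n ω D ψ :=
  ⟨hD.valid, h ▸ hD.sound, h ▸ hD.complete⟩

/-- The tuples of a conjunction are componentwise unions, and the weight of a union is at most the
sum of the weights. -/
theorem Represents.prod (hD : Represents univ w n ω D φ) (hE : Represents univ w n ω' E ψ) :
    Represents univ w n (fun i => ω i + ω' i) (prodT D E).val (φ.and ψ) := by
  have key : ∀ U ∈ D, ∀ V ∈ E, ∀ i < n, ((List.zipWith (· ∪ ·) U V).getD i []).toFinset =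
      (U.getD i []).toFinset ∪ (V.getD i []).toFinset := by
    intro U hU V hV i hi
    rw [getD_zipWith_union (by rw [(hD.valid U hU).1]; exact hi)
      (by rw [(hE.valid V hV).1]; exact hi), List.toFinset_union]
  simp only [prodT_val]
  refine ⟨?_, ?_, ?_⟩
  · intro W hW
    simp only [List.mem_flatMap, List.mem_map] at hW
    obtain ⟨U, hU, V, hV, rfl⟩ := hW
    exact (hD.valid U hU).zipWith (hE.valid V hV)
  · intro W hW
    simp only [List.mem_flatMap, List.mem_map] at hW
    obtain ⟨U, hU, V, hV, rfl⟩ := hW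
    obtain ⟨Z, hZ, h1⟩ := hD.sound U hU
    obtain ⟨Z', hZ', h2⟩ := hE.sound V hV
    refine ⟨fun i => Z i ∪ Z' i, ⟨Z, hZ, Z', hZ', rfl⟩, fun i hi => ?_⟩
    rw [key U hU V hV i hi, h1 i hi, h2 i hi]
  · rintro _ ⟨Z, hZ, Z', hZ', rfl⟩
    obtain ⟨U, hU, h1⟩ := hD.complete Z hZ
    obtain ⟨V, hV, h2⟩ := hE.complete Z' hZ'
    refine ⟨_, List.mem_flatMap.2 ⟨U, hU, List.mem_map.2 ⟨V, hV, rfl⟩⟩, fun i hi => ?_⟩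
    rw [key U hU V hV i hi, h1 i hi, h2 i hi]

theorem Represents.bot : Represents univ w n ω [] .bot :=
  ⟨by simp, by simp, by simp [Formula.dnf]⟩

/-- Alternatives share one bound `ω`: disjunction takes the maximum of weights where conjunction
takes the sum, just as a copy number dominates each rule separately but adds up over the arguments
of an expression. -/
theorem Represents.or (hD : Represents univ w n ω D φ) (hE : Represents univ w n ω E ψ) :
    Represents univ w n ω (D ++ E) (φ.or ψ) := by
  refine ⟨?_, ?_, ?_⟩
  · intro U hU
    rcases List.mem_append.1 hU with h | h
    · exact hD.valid U h
    · exact hE.valid U h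
  · intro U hU
    rcases List.mem_append.1 hU with h | h
    · obtain ⟨Z, hZ, h⟩ := hD.sound U h
      exact ⟨Z, Or.inl hZ, h⟩
    · obtain ⟨Z, hZ, h⟩ := hE.sound U h
      exact ⟨Z, Or.inr hZ, h⟩
  · rintro Z (hZ | hZ)
    · obtain ⟨U, hU, h⟩ := hD.complete Z hZ
      exact ⟨U, List.mem_append_left _ hU, h⟩
    · obtain ⟨U, hU, h⟩ := hE.complete Z hZ
      exact ⟨U, List.mem_append_right _ hU, h⟩

theorem Represents.bigOr {α : Type} (l : List α) (F : α → List (List (List State)))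
    (φ : α → Formula State) (h : ∀ x ∈ l, Represents univ w n ω (F x) (φ x)) :
    Represents univ w n ω (l.flatMap F) (.bigOr (l.map φ)) := by
  induction l with
  | nil => exact .bot
  | cons x l ih => exact (h x (by simp)).or (ih fun y hy => h y (by simp [hy]))

theorem weight_nil : weight w [] = 0 := rfl

theorem Represents.top : Represents univ w n ω [List.replicate n []] .top := by
  have h : ∀ i, (List.replicate n ([] : List State)).getD i [] = [] := by
    intro i
    simp [List.getElem?_replicate]; split <;> rfl
  refine ⟨?_, ?_, ?_⟩
  · simp only [List.mem_singleton, forall_eq]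
    refine ⟨by simp, fun i _ => ?_⟩
    rw [h]; simp [weight_nil]
  · simp only [List.mem_singleton, forall_eq]
    refine ⟨_, rfl, fun i _ => ?_⟩
    rw [h]; rfl
  · rintro Z rfl
    refine ⟨_, List.mem_singleton.2 rfl, fun i _ => ?_⟩
    rw [h]; rfl

/-- The weight function is the contribution of a call on `x_h` to the copy number `b_i`. -/
theorem Represents.atom {X : State} {h : ℕ} (hX : X ∈ univ) :
    Represents univ w n (fun i => if h = i then w X else 0) [(singleTupleT X n h).val]
      (.atom h X) := by
  have key : ∀ i < n, ((singleTupleT X n h).val.getD i []).toFinset =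
      if i = h then {X} else ∅ := by
    intro i hi
    rw [getD_singleTupleT _ _ _ _ hi]; split <;> rfl
  refine ⟨?_, ?_, ?_⟩
  · simp only [List.mem_singleton, forall_eq]
    refine ⟨length_singleTupleT _ _ _, fun i hi => ?_⟩
    rw [getD_singleTupleT _ _ _ _ hi]
    by_cases hh : i = h
    · subst hh; simp [hX, weight]
    · simp [hh, weight]
  · simp only [List.mem_singleton, forall_eq]
    exact ⟨_, rfl, key⟩
  · rintro Z rfl
    exact ⟨_, by simp, key⟩

/-- Union is associative, so this is an equality of sets of functions on all of `ℕ`. With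
commutativity it removes any dependence on the bracketing chosen by the algorithm. -/
theorem dnf_and_assoc (φ ψ χ : Formula State) :
    ((φ.and ψ).and χ).dnf = (φ.and (ψ.and χ)).dnf := by
  ext Z
  constructor
  · rintro ⟨_, ⟨U, hU, V, hV, rfl⟩, W, hW, rfl⟩
    exact ⟨U, hU, _, ⟨V, hV, W, hW, rfl⟩, by simp [Finset.union_assoc]⟩
  · rintro ⟨U, hU, _, ⟨V, hV, W, hW, rfl⟩, rfl⟩
    exact ⟨_, ⟨U, hU, V, hV, rfl⟩, W, hW, by simp [Finset.union_assoc]⟩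

theorem dnf_and_comm (φ ψ : Formula State) : (φ.and ψ).dnf = (ψ.and φ).dnf := by
  ext Z
  constructor <;>
  · rintro ⟨U, hU, V, hV, rfl⟩
    exact ⟨V, hV, U, hU, by simp [Finset.union_comm]⟩

theorem dnf_and_top (φ : Formula State) : (φ.and .top).dnf = φ.dnf := by
  ext Z
  constructor
  · rintro ⟨U, hU, V, rfl, rfl⟩
    simpa using hU
  · intro h
    exact ⟨Z, h, _, rfl, by simp⟩

theorem dnf_top_and (φ : Formula State) : (Formula.top.and φ).dnf = φ.dnf := by
  rw [dnf_and_comm, dnf_and_top]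

theorem dnf_and_congr {φ φ' ψ ψ' : Formula State} (h : φ.dnf = φ'.dnf) (h' : ψ.dnf = ψ'.dnf) :
    (φ.and ψ).dnf = (φ'.and ψ').dnf := by
  simp [Formula.dnf, h, h']

/-- `Ata.Derives` lists a finite set in an unspecified order, the algorithm in the order of its own
list. -/
theorem dnf_bigAnd_perm {l l' : List (Formula State)} (h : l.Perm l') :
    (Formula.bigAnd l).dnf = (Formula.bigAnd l').dnf := by
  induction h with
  | nil => rfl
  | cons x _ ih => exact dnf_and_congr rfl ih
  | swap x y l =>
    simp only [Formula.bigAnd, List.foldr_cons]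
    rw [← dnf_and_assoc, ← dnf_and_assoc]
    exact dnf_and_congr (dnf_and_comm _ _) rfl
  | trans _ _ ih ih' => exact ih.trans ih'

theorem prodT_singleton (U V : List (List State)) :
    (prodT [U] [V]).val = [List.zipWith (· ∪ ·) U V] := by simp

/-- The weight at position `i` of a conjunction of atoms. -/
def atomsWeight (w : State → ℕ∞) (ats : List (ℕ × State)) (i : ℕ) : ℕ∞ :=
  (ats.map fun x => if x.1 = i then w x.2 else 0).sum

theorem Represents.atoms (ats : List (ℕ × State)) (h : ∀ x ∈ ats, x.2 ∈ univ) :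
    Represents univ w n (atomsWeight w ats) [(atomsTupleT n ats).val]
      (.bigAnd (ats.map fun x => .atom x.1 x.2)) := by
  induction ats with
  | nil => simpa [atomsTupleT, Formula.bigAnd] using Represents.top (ω := atomsWeight w [])
  | cons x ats ih =>
    have h1 := (Represents.atom (w := w) (n := n) (h := x.1) (h x (by simp))).prod
      (ih fun y hy => h y (by simp [hy]))
    rw [prodT_singleton] at h1
    have h2 : atomsWeight w (x :: ats) =
        fun i => (if x.1 = i then w x.2 else 0) + atomsWeight w ats i := by
      funext i; simp [atomsWeight]
    rw [h2]
    simpa [atomsTupleT, Formula.bigAnd] using h1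

/-- The normal form of a member of a family. -/
def memberDnf (n : ℕ) (f : Shared) (q : ℕ) : List (List (List State)) :=
  (dnfT n f).val.getD q []

/-- The normal form of a disjunction of members of families. -/
def disjDnf (n : ℕ) (d : Disj) : List (List (List State)) :=
  d.flatMap fun f => memberDnf n f.1 f.2

theorem conjDnfT_nil_val (n : ℕ) : (conjDnfT n []).val = [List.replicate n []] := by
  simp [conjDnfT]

theorem conjDnfT_cons_val (n : ℕ) (d : Disj) (ds : Conj) :
    (conjDnfT n (d :: ds)).val = (prodT (disjDnf n d) (conjDnfT n ds).val).val := by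
  simp [conjDnfT, disjDnf, memberDnf]

/-- Prepending the conjunction `c` amounts to a conjunction with `φ`. -/
def ConjRepresents (univ : List State) (w : State → ℕ∞) (n : ℕ) (ω : ℕ∞) (c : Conj)
    (φ : Formula State) : Prop :=
  ∀ c' ψ ω', Represents univ w n ω' (conjDnfT n c').val ψ →
    Represents univ w n (fun i => ω + ω' i) (conjDnfT n (c ++ c')).val (φ.and ψ)

theorem ConjRepresents.single {ω : ℕ∞} {d : Disj}
    (h : Represents univ w n (fun _ => ω) (disjDnf n d) φ) : ConjRepresents univ w n ω [d] φ := by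
  intro c' ψ ω' h'
  rw [List.singleton_append, conjDnfT_cons_val]
  exact h.prod h'

/-- `conjDnfT` folds one concatenated list from the right. Since `ConjRepresents` quantifies over
all continuations, concatenating conjunctions amounts to composing two instances. -/
theorem ConjRepresents.append {ω ω' : ℕ∞} {c c' : Conj} (h : ConjRepresents univ w n ω c φ)
    (h' : ConjRepresents univ w n ω' c' ψ) :
    ConjRepresents univ w n (ω + ω') (c ++ c') (φ.and ψ) := by
  intro c'' χ ω'' h''
  have h1 := h _ _ _ (h' _ _ _ h'')
  rw [List.append_assoc]
  refine (h1.congr (dnf_and_assoc _ _ _).symm).mono fun i _ => ?_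
  rw [add_assoc]

/-- The invariant of the exploration: if the formula of each `Y` only produces components of weight
at most `w Y`, then the bodies of implications with head `X` are made of sets no heavier than `X`.
-/
theorem ConjRepresents.flatMap (X : List State) (c : State → Conj) (Φ : State → Formula State)
    (h : ∀ Y ∈ X, ConjRepresents univ w n (w Y) (c Y) (Φ Y)) :
    Represents univ w n (fun _ => weight w X) (conjDnfT n (X.flatMap c)).val
      (.bigAnd (X.map Φ)) := by
  induction X with
  | nil => simpa [conjDnfT, weight, Formula.bigAnd] using Represents.top (ω := fun _ => 0)
  | cons Y X ih =>
    simpa [weight, Formula.bigAnd] using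
      h Y (by simp) _ _ _ (ih fun Z hZ => h Z (by simp [hZ]))

end

/-! ### Expressions -/

/-- The recursor of the nested type, with "all members satisfy `P`" as the motive for argument
lists. -/
theorem Expr.induct {P : Expr → Prop} (var : ∀ j, P (.var j))
    (cons : ∀ b es, (∀ e ∈ es, P e) → P (.cons b es))
    (call : ∀ p h es, (∀ e ∈ es, P e) → P (.call p h es)) (e : Expr) : P e :=
  Expr.rec (motive_1 := P) (motive_2 := fun es => ∀ e ∈ es, P e) var cons call (by simp)
    (fun e es he hes e' h => by
      rcases List.mem_cons.1 h with rfl | h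
      · exact he
      · exact hes e' h) e

theorem Expr.allWF_iff {rank arity : List ℕ} {n k : ℕ} {es : List Expr} :
    Expr.AllWF rank arity n k es ↔ ∀ e ∈ es, e.WF rank arity n k := by
  induction es with
  | nil => simp [Expr.AllWF]
  | cons e es ih => simp [Expr.AllWF, ih]

theorem Expr.copiesAll_eq (c : ℕ → ℕ∞) (i : ℕ) (es : List Expr) :
    Expr.copiesAll c i es = (es.map (Expr.copies c i)).sum := by
  induction es with
  | nil => simp [Expr.copiesAll]
  | cons e es ih => simp [Expr.copiesAll, ih]

theorem Expr.sizeAll_eq (es : List Expr) : Expr.sizeAll es = (es.map Expr.size).sum := by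
  induction es with
  | nil => simp [Expr.sizeAll]
  | cons e es ih => simp [Expr.sizeAll, ih]

mutual
/-- The number of calls in an expression. -/
def Expr.calls : Expr → ℕ
  | .var _ => 0
  | .cons _ es => Expr.callsAll es
  | .call _ _ es => 1 + Expr.callsAll es
def Expr.callsAll : List Expr → ℕ
  | [] => 0
  | e :: es => e.calls + Expr.callsAll es
end

theorem Expr.callsAll_eq (es : List Expr) : Expr.callsAll es = (es.map Expr.calls).sum := by
  induction es with
  | nil => simp [Expr.callsAll]
  | cons e es ih => simp [Expr.callsAll, ih]

/-- Each call on `x_h` adds the copy number of its procedure, which is at least 1, to the summand `i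
= h`; well-formedness ensures `h < n`. -/
theorem Expr.calls_le_sum_copies {rank arity : List ℕ} {n k : ℕ} {c : ℕ → ℕ∞}
    (hc : ∀ p, 1 ≤ c p) (e : Expr) (he : e.WF rank arity n k) :
    (e.calls : ℕ∞) ≤ ∑ i ∈ Finset.range n, e.copies c i := by
  have all : ∀ es : List Expr, (∀ e ∈ es, (e.calls : ℕ∞) ≤ ∑ i ∈ Finset.range n, e.copies c i) →
      (Expr.callsAll es : ℕ∞) ≤ ∑ i ∈ Finset.range n, Expr.copiesAll c i es := by
    intro es h
    induction es with
    | nil => simp [Expr.callsAll]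
    | cons e es ih =>
      simp only [Expr.callsAll, Expr.copiesAll, Finset.sum_add_distrib, Nat.cast_add]
      exact add_le_add (h e (by simp)) (ih fun e he => h e (by simp [he]))
  induction e using Expr.induct with
  | var j => simp [Expr.calls]
  | cons b es ih =>
    simp only [Expr.WF, Expr.allWF_iff] at he
    simpa [Expr.calls, Expr.copies] using all es fun e h => ih e h (he.2 e h)
  | call p h es ih =>
    simp only [Expr.WF, Expr.allWF_iff] at he
    have h1 := all es fun e h => ih e h (he.2.2 e h)
    simp only [Expr.calls, Expr.copies, Finset.sum_add_distrib, Nat.cast_add, Nat.cast_one]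
    refine add_le_add ?_ h1
    simp [he.1, hc p]

theorem Expr.one_le_size (e : Expr) : 1 ≤ e.size := by
  cases e <;> simp [Expr.size]

theorem Expr.length_le_sizeAll (es : List Expr) : es.length ≤ Expr.sizeAll es := by
  induction es with
  | nil => simp
  | cons e es ih => have := e.one_le_size; simp [Expr.sizeAll]; omega

theorem Expr.le_sum_of_mem (f : Expr → ℕ) {es : List Expr} {e : Expr} (h : e ∈ es) :
    f e ≤ (es.map f).sum :=
  List.single_le_sum (by simp) _ (List.mem_map_of_mem h)

/-! ### Values of the families -/

@[simp] theorem inferAllT_val (M : Bta) (Q qs : List ℕ) (es : List Expr) :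
    (inferAllT M Q qs es).val = es.map fun e => (inferT M Q qs e).val := by
  induction es with
  | nil => simp [inferAllT]
  | cons e es ih => simp [inferAllT, ih]

@[simp] theorem dnfAllT_val (n : ℕ) (fs : List Shared) :
    (dnfAllT n fs).val = fs.map fun f => (dnfT n f).val := by
  induction fs with
  | nil => simp [dnfAllT]
  | cons f fs ih => simp [dnfAllT, ih]

theorem inferT_var_val (M : Bta) (Q qs : List ℕ) (j : ℕ) :
    (inferT M Q qs (.var j)).val =
      .node (Q.map fun q => if qs[j]? = some q then [([], [])] else []) [] := by
  simp only [inferT, Timed.val_bind, mapT_val, Timed.val_pure, getT_val]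
  congr 1
  refine List.map_congr_left fun q _ => ?_
  cases h : qs[j]? <;> simp [h]

theorem inferT_cons_val (M : Bta) (Q qs : List ℕ) (b : ℕ) (es : List Expr) :
    (inferT M Q qs (.cons b es)).val =
      .node (Q.map fun q =>
          (M.rules.filter fun r => r.target = q ∧ r.symbol = b).map fun r => ([], r.args))
        (es.map fun e => (inferT M Q qs e).val) := by
  simp [inferT, Bool.decide_and]

theorem inferT_call_val (M : Bta) (s : ℕ) (qs : List ℕ) (p h : ℕ) (es : List Expr) :
    (inferT M (List.range s) qs (.call p h es)).val =
      .node ((List.range s).map fun q =>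
          (tuples s es.length).map fun t => ([(h, State.call p q t)], t))
        (es.map fun e => (inferT M (List.range s) qs e).val) := by
  simp [inferT]

/-- The normal form contributed by the pair `d` of a family with children `fs`. -/
def pairDnf (n : ℕ) (fs : List Shared) (d : List (ℕ × State) × List ℕ) :
    List (List (List State)) :=
  (selectT (fs.map fun f => (dnfT n f).val) d.2 [(atomsTupleT n d.1).val]).val

theorem dnfT_node_val (n : ℕ) (rows : List (List (List (ℕ × State) × List ℕ)))
    (fs : List Shared) :
    (dnfT n (.node rows fs)).val = rows.map fun row => row.flatMap (pairDnf n fs) := by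
  simp only [dnfT, Timed.val_bind, dnfAllT_val, mapT_val, flatMapT_val]
  rfl

theorem memberDnf_node {n s q : ℕ} (hq : q < s) (g : ℕ → List (List (ℕ × State) × List ℕ))
    (fs : List Shared) :
    memberDnf n (.node ((List.range s).map g) fs) q = (g q).flatMap (pairDnf n fs) := by
  simp [memberDnf, dnfT_node_val, hq]

theorem selectT_cons_val (tab : List (List (List (List State))))
    (tabs : List (List (List (List (List State))))) (q : ℕ) (sel : List ℕ)
    (D : List (List (List State))) :
    (selectT (tab :: tabs) (q :: sel) D).val =
      (selectT tabs sel (prodT D (tab.getD q [])).val).val := by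
  simp [selectT]

theorem selectT_nil_val (tabs : List (List (List (List (List State)))))
    (D : List (List (List State))) : (selectT tabs [] D).val = D := by
  cases tabs <;> simp [selectT]

/-- The accumulator is multiplied from the left while `infAll` nests to the right, so the induction
generalizes over `D`, `φ` and `ω` and rebrackets by associativity. -/
theorem selectT_represents {univ : List State} {w : State → ℕ∞} {n s : ℕ} {ω : ℕ → ℕ∞}
    {D : List (List (List State))} {φ : Formula State} {M : Bta} {Q qs : List ℕ} {c : ℕ → ℕ∞}
    {es : List Expr} {sel : List ℕ} (hlen : sel.length = es.length) (hsel : ∀ q ∈ sel, q < s)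
    (hes : ∀ e ∈ es, ∀ q < s, Represents univ w n (fun i => e.copies c i)
      (memberDnf n (inferT M Q qs e).val q) (inf M qs e q))
    (hD : Represents univ w n ω D φ) :
    Represents univ w n (fun i => ω i + Expr.copiesAll c i es)
      (selectT ((es.map fun e => (inferT M Q qs e).val).map fun f => (dnfT n f).val) sel D).val
      (φ.and (infAll M qs es sel)) := by
  induction es generalizing sel D φ ω with
  | nil =>
    obtain rfl := List.length_eq_zero_iff.1 hlen
    rw [selectT_nil_val]
    simpa [Expr.copiesAll, infAll] using hD.congr (dnf_and_top φ).symm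
  | cons e es ih =>
    cases sel with
    | nil => simp at hlen
    | cons q sel =>
      have h1 := ih (by simpa using hlen) (fun q hq => hsel q (by simp [hq]))
        (fun e he => hes e (by simp [he])) (hD.prod (hes e (by simp) q (hsel q (by simp))))
      rw [List.map_cons, List.map_cons, selectT_cons_val]
      refine (h1.congr ?_).mono fun i _ => ?_
      · rw [infAll]; exact dnf_and_assoc _ _ _
      · simp [Expr.copiesAll, add_assoc]

/-- The states of `I.ata`. -/
def Instance.states (I : Instance) : List State :=
  .start :: (((List.range I.mtt.arity.length).flatMap fun p =>
      (tuples I.out.states (I.mtt.arity.getD p 0)).flatMap fun qs =>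
        (List.range I.out.states).map fun q => .call p q qs) ++
    (List.range I.inp.states).map .inp)

theorem Instance.start_mem_states (I : Instance) : State.start ∈ I.states := by
  simp [Instance.states]

theorem Instance.inp_mem_states {I : Instance} {q : ℕ} :
    State.inp q ∈ I.states ↔ q < I.inp.states := by
  simp [Instance.states]

theorem Instance.call_mem_states {I : Instance} {p q : ℕ} {qs : List ℕ} :
    State.call p q qs ∈ I.states ↔
      I.mtt.arity[p]? = some qs.length ∧ q < I.out.states ∧ ∀ q' ∈ qs, q' < I.out.states := by
  simp only [Instance.states, List.mem_cons, reduceCtorEq, List.mem_append, List.mem_flatMap,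
    List.mem_range, List.mem_map, mem_tuples, false_or, and_false, exists_false, or_false,
    State.call.injEq]
  constructor
  · rintro ⟨p, hp, qs, ⟨h1, h2⟩, q, hq, rfl, rfl, rfl⟩
    exact ⟨by simp [h1, hp], hq, h2⟩
  · rintro ⟨h1, h2, h3⟩
    obtain ⟨hp, hp'⟩ := List.getElem?_eq_some_iff.1 h1
    exact ⟨p, hp, qs, ⟨by simp [h1], h3⟩, q, h2, rfl, rfl, rfl⟩

/-- The weight of a state: its number of copies, and `b + 1` for the initial state. -/
noncomputable def Instance.weight (I : Instance) (b : ℕ) : State → ℕ∞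
  | .start => b + 1
  | .inp _ => 1
  | .call p _ _ => I.mtt.copyNumber I.rank p

/-- Weights propagate through Inf by the very recursion that defines `copies`: a constructor sums
over its arguments, and a call adds the weight of its own state at position `h`. -/
theorem inferT_represents {I : Instance} (hI : I.WF) (b n n' k : ℕ) (qs : List ℕ) (e : Expr)
    (he : e.WF I.rank I.mtt.arity n' k) {q : ℕ} (hq : q < I.out.states) :
    Represents I.states (I.weight b) n (fun i => e.copies (I.mtt.copyNumber I.rank) i)
      (memberDnf n (inferT I.out (List.range I.out.states) qs e).val q) (inf I.out qs e q) := by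
  induction e using Expr.induct generalizing q with
  | var j =>
    rw [inferT_var_val, memberDnf_node hq, inf]
    split
    · have := Represents.top (univ := I.states) (w := I.weight b) (n := n)
        (ω := fun i => (Expr.var j).copies (I.mtt.copyNumber I.rank) i)
      simpa [pairDnf, selectT_nil_val, atomsTupleT] using this
    · exact .bot
  | cons a es ih =>
    simp only [Expr.WF, Expr.allWF_iff] at he
    rw [inferT_cons_val, memberDnf_node hq, inf, List.flatMap_map]
    refine .bigOr _ _ _ fun r hr => ?_
    simp only [List.mem_filter, decide_eq_true_eq] at hr
    -- Well-formedness of the output type: the transition has exactly one argument state per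
    -- argument of the expression.
    obtain ⟨-, h1, h2⟩ := hI.2.2.1.2 r hr.1
    rw [hr.2.2, he.1, Option.some.injEq] at h1
    have := selectT_represents h1.symm h2 (fun e h q hq => ih e h (he.2 e h) hq)
      (Represents.atoms (n := n) (w := I.weight b) (univ := I.states) [] (by simp))
    refine (this.congr (dnf_top_and _)).mono fun i _ => ?_
    simp [atomsWeight, Expr.copies]
  | call p h es ih =>
    simp only [Expr.WF, Expr.allWF_iff] at he
    rw [inferT_call_val, memberDnf_node hq, inf, List.flatMap_map]
    refine .bigOr _ _ _ fun t ht => ?_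
    obtain ⟨h1, h2⟩ := mem_tuples.1 ht
    have hmem : State.call p q t ∈ I.states :=
      Instance.call_mem_states.2 ⟨by rw [h1]; exact he.2.1, hq, h2⟩
    have := selectT_represents h1 h2 (fun e h q hq => ih e h (he.2.2 e h) hq)
      (Represents.atoms (n := n) (w := I.weight b) (univ := I.states) [(h, State.call p q t)]
        (by simpa using hmem))
    refine (this.congr ?_).mono fun i _ => ?_
    · exact dnf_and_congr (dnf_and_top _) rfl
    · simp [atomsWeight, Expr.copies, Instance.weight]

/-! ### Sizes of the normal forms -/

theorem length_prodT (D E : List (List (List State))) :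
    (prodT D E).val.length = D.length * E.length := by
  simp [List.length_flatMap]

/-- The product of the lengths of the selected entries. -/
def selProd : List (List (List (List (List State)))) → List ℕ → ℕ
  | tab :: tabs, q :: sel => (tab.getD q []).length * selProd tabs sel
  | _, _ => 1

theorem length_selectT (tabs : List (List (List (List (List State))))) (sel : List ℕ)
    (D : List (List (List State))) :
    (selectT tabs sel D).val.length = D.length * selProd tabs sel := by
  induction tabs generalizing sel D with
  | nil => simp [selectT, selProd]
  | cons tab tabs ih =>
    cases sel with
    | nil => simp [selectT, selProd]
    | cons q sel => rw [selectT_cons_val, ih, length_prodT, selProd, mul_assoc]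

theorem length_pairDnf (n : ℕ) (fs : List Shared) (d : List (ℕ × State) × List ℕ) :
    (pairDnf n fs d).length = selProd (fs.map fun f => (dnfT n f).val) d.2 := by
  rw [pairDnf, length_selectT]; simp

/-- Distributivity: a sum over all tuples of a product over coordinates is the product of the
coordinate sums. -/
theorem sum_selProd (s : ℕ) (tabs : List (List (List (List (List State))))) :
    ((tuples s tabs.length).map (selProd tabs)).sum =
      (tabs.map fun tab => ((List.range s).map fun q => (tab.getD q []).length).sum).prod := by
  induction tabs with
  | nil => simp [tuples, selProd]
  | cons tab tabs ih =>
    rw [List.map_cons, List.prod_cons, ← ih, List.length_cons, tuples]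
    -- The induction runs over the first coordinate only; the tuples of the other coordinates keep
    -- the full range.
    generalize List.range s = Q
    induction Q with
    | nil => simp
    | cons q Q ihQ =>
      rw [List.flatMap_cons, List.map_append, List.sum_append, ihQ, List.map_cons, List.sum_cons,
        add_mul, List.map_map]
      congr 1
      rw [← List.sum_map_mul_left]
      rfl

/-- The total length of the normal forms of the first `s` members of a family. -/
def totalLength (n s : ℕ) (f : Shared) : ℕ :=
  ((List.range s).map fun q => (memberDnf n f q).length).sum

theorem length_memberDnf_le {n s q : ℕ} (hq : q < s) (f : Shared) :
    (memberDnf n f q).length ≤ totalLength n s f :=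
  List.single_le_sum (by simp) _ (List.mem_map.2 ⟨q, by simpa using hq, rfl⟩)

theorem totalLength_node (n s : ℕ) (g : ℕ → List (List (ℕ × State) × List ℕ))
    (fs : List Shared) :
    totalLength n s (.node ((List.range s).map g) fs) = ((List.range s).map fun q =>
      ((g q).map fun d => selProd (fs.map fun f => (dnfT n f).val) d.2).sum).sum := by
  unfold totalLength
  congr 1
  refine List.map_congr_left fun q hq => ?_
  rw [memberDnf_node (by simpa using hq), List.length_flatMap]
  simp only [length_pairDnf]

theorem sum_range_ite_le (s a v : ℕ) :
    ((List.range s).map fun q => if q = a then v else 0).sum ≤ v := by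
  suffices h : ((List.range s).map fun q => if q = a then v else 0).sum =
      if a < s then v else 0 by rw [h]; split <;> simp
  induction s with
  | zero => simp
  | succ s ih =>
    simp only [List.range_succ, List.map_append, List.sum_append, ih, List.map_singleton,
      List.sum_singleton]
    split_ifs <;> omega

/-- A transition has one target, so it is counted for at most one `q`. -/
theorem sum_filter_target_le (rules : List BtaRule) (s b : ℕ) (g : BtaRule → ℕ) :
    ((List.range s).map fun q =>
      ((rules.filter fun r => r.target = q ∧ r.symbol = b).map g).sum).sum ≤
      ((rules.filter fun r => r.symbol = b).map g).sum := by
  induction rules with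
  | nil => simp
  | cons r rules ih =>
    have h1 : ∀ q, (((r :: rules).filter fun r => r.target = q ∧ r.symbol = b).map g).sum =
        (if q = r.target then (if r.symbol = b then g r else 0) else 0) +
          ((rules.filter fun r => r.target = q ∧ r.symbol = b).map g).sum := by
      intro q
      by_cases h : q = r.target
      · subst h
        by_cases h' : r.symbol = b <;> simp [h']
      · simp [Ne.symm h, h]
    simp only [h1, List.sum_map_add]
    have h2 : (((r :: rules).filter fun r => r.symbol = b).map g).sum =
        (if r.symbol = b then g r else 0) +
          ((rules.filter fun r => r.symbol = b).map g).sum := by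
      by_cases h' : r.symbol = b <;> simp [h']
    rw [h2]
    exact add_le_add (sum_range_ite_le _ _ _) ih

/-- Determinism: different transitions for `b` have different argument tuples, so a sum over the
transitions is part of the sum over all tuples. -/
theorem sum_filter_symbol_le {rank : List ℕ} {M : Bta} (hM : M.WF rank)
    (hd : M.CompleteDeterministic rank) {b n : ℕ} (hb : rank[b]? = some n) (g : List ℕ → ℕ) :
    ((M.rules.filter fun r => r.symbol = b).map fun r => g r.args).sum ≤
      ((tuples M.states n).map g).sum := by
  have hargs : ∀ r ∈ M.rules, r.symbol = b → r.args.length = n ∧ ∀ q ∈ r.args, q < M.states := by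
    intro r hr h
    obtain ⟨-, h1, h2⟩ := hM.2 r hr
    rw [h, hb, Option.some.injEq] at h1
    exact ⟨h1.symm, h2⟩
  have hnd : ((M.rules.filter fun r => r.symbol = b).map BtaRule.args).Nodup := by
    rw [List.nodup_iff_count_le_one]
    intro t
    rw [List.count_eq_countP, List.countP_map, List.countP_filter]
    by_cases ht : t.length = n ∧ ∀ q ∈ t, q < M.states
    · refine le_of_eq ?_
      rw [← hd b n hb t ht.1 ht.2]
      congr 1; funext r
      rw [Bool.eq_iff_iff]
      simp [and_comm]
    -- The automaton property says nothing about tuples of wrong length or with foreign entries; by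
    -- well-formedness they occur in no transition for `b`.
    · refine le_of_eq_of_le (List.countP_eq_zero.2 ?_) zero_le_one
      intro r hr
      simp only [Function.comp, beq_iff_eq, Bool.and_eq_true, decide_eq_true_eq, not_and]
      rintro rfl h
      exact ht (hargs r hr h)
  have hsub : ((M.rules.filter fun r => r.symbol = b).map BtaRule.args).Subperm
      (tuples M.states n) := by
    refine hnd.subperm fun t ht => ?_
    simp only [List.mem_map, List.mem_filter, decide_eq_true_eq] at ht
    obtain ⟨r, ⟨hr, hr'⟩, rfl⟩ := ht
    exact mem_tuples.2 (hargs r hr hr')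
  have h1 : ((M.rules.filter fun r => r.symbol = b).map fun r => g r.args) =
      ((M.rules.filter fun r => r.symbol = b).map BtaRule.args).map g := by simp
  rw [h1]
  obtain ⟨l, hl, hl'⟩ := hsub
  rw [← (hl.map g).sum_eq]
  exact (hl'.map g).sum_le_sum (by simp)

/-- Completeness: every tuple is the argument list of some transition. Thus `states ^ n` is bounded
by the size of the instance, although the arity `n` is not bounded by a constant. -/
theorem pow_le_length_rules {rank : List ℕ} {M : Bta} (hd : M.CompleteDeterministic rank)
    {b n : ℕ} (hb : rank[b]? = some n) : M.states ^ n ≤ M.rules.length := by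
  have h : (tuples M.states n).Subperm (M.rules.map BtaRule.args) := by
    refine (nodup_tuples _ _).subperm fun t ht => ?_
    obtain ⟨h1, h2⟩ := mem_tuples.1 ht
    have h3 := hd b n hb t h1 h2
    have h4 : 0 < M.rules.countP (fun r => decide (r.symbol = b ∧ r.args = t)) := by omega
    obtain ⟨r, hr, h5⟩ := List.countP_pos_iff.1 h4
    exact List.mem_map.2 ⟨r, hr, (by simpa using h5 : _ ∧ _).2⟩
  simpa [length_tuples] using h.length_le

theorem prod_totalLength_le {n s m : ℕ} {es : List Expr} (F : Expr → Shared)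
    (h : ∀ e ∈ es, totalLength n s (F e) ≤ m ^ e.calls) :
    ((es.map fun e => totalLength n s (F e)).prod) ≤ m ^ Expr.callsAll es := by
  induction es with
  | nil => simp [Expr.callsAll]
  | cons e es ih =>
    rw [List.map_cons, List.prod_cons, Expr.callsAll, pow_add]
    exact Nat.mul_le_mul (h e (by simp)) (ih fun e he => h e (by simp [he]))

/-- The central count. Summing over all `q` makes the bound multiplicative: the sums for the
arguments multiply at a constructor without any loss, a parameter fits at most one state, and each
call contributes one factor. The maximum with 1 keeps powers monotone in the exponent when there are
no states. -/
theorem totalLength_inferT_le {rank arity : List ℕ} {M : Bta} (hM : M.WF rank)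
    (hd : M.CompleteDeterministic rank) (n n' k : ℕ) (qs : List ℕ) (e : Expr)
    (he : e.WF rank arity n' k) :
    totalLength n M.states (inferT M (List.range M.states) qs e).val ≤
      max M.states 1 ^ e.calls := by
  have children : ∀ es : List Expr,
      (∀ e ∈ es, totalLength n M.states (inferT M (List.range M.states) qs e).val ≤
        max M.states 1 ^ e.calls) →
      ((tuples M.states es.length).map (selProd ((es.map fun e =>
        (inferT M (List.range M.states) qs e).val).map fun f => (dnfT n f).val))).sum ≤
      max M.states 1 ^ Expr.callsAll es := by
    intro es hes
    have h1 := sum_selProd M.states ((es.map fun e =>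
        (inferT M (List.range M.states) qs e).val).map fun f => (dnfT n f).val)
    simp only [List.length_map] at h1
    rw [h1, List.map_map, List.map_map]
    exact prod_totalLength_le (fun e => (inferT M (List.range M.states) qs e).val) hes
  induction e using Expr.induct with
  | var j =>
    rw [inferT_var_val, totalLength_node, Expr.calls, pow_zero]
    have h1 : ∀ q, (((if qs[j]? = some q then [([], [])] else [] :
        List (List (ℕ × State) × List ℕ))).map fun d => selProd (([] : List Shared).map fun f =>
          (dnfT n f).val) d.2).sum = if some q = qs[j]? then 1 else 0 := by
      intro q
      by_cases h : qs[j]? = some q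
      · simp [h, selProd]
      · simp [h, Ne.symm h]
    simp only [h1]
    cases qs[j]? with
    | none => simp
    | some q' =>
      simp only [Option.some.injEq]
      exact sum_range_ite_le _ _ _
  | cons b es ih =>
    simp only [Expr.WF, Expr.allWF_iff] at he
    rw [inferT_cons_val, totalLength_node]
    simp only [List.map_map]
    -- Each transition is charged to its target; determinism then turns the sum over transitions
    -- into one over argument tuples.
    refine (sum_filter_target_le _ _ _ _).trans ?_
    refine (sum_filter_symbol_le hM hd he.1 _).trans ?_
    simpa [Expr.calls] using children es fun e h => ih e h (he.2 e h)
  | call p h es ih =>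
    simp only [Expr.WF, Expr.allWF_iff] at he
    rw [inferT_call_val, totalLength_node]
    have h1 := children es fun e h => ih e h (he.2.2 e h)
    simp only [List.map_map, Function.comp_def, List.map_const', List.sum_replicate,
      List.length_range, smul_eq_mul] at h1 ⊢
    -- The row of a call has the same length for each `q`, whence the extra factor `M.states`.
    rw [Expr.calls, pow_add, pow_one]
    exact Nat.mul_le_mul (le_max_left _ _) h1

/-! ### Running time of the computation of normal forms -/

/-- A list of at most `K` states, each of which can be compared in `K` steps. -/
def Small (K : ℕ) (X : List State) : Prop := X.length ≤ K ∧ ∀ x ∈ X, 4 + 2 * x.width ≤ K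

/-- `U` is an `n`-tuple of lists without duplicates of elements of `univ`. -/
def PlainTuple (univ : List State) (n : ℕ) (U : List (List State)) : Prop :=
  ValidTuple univ (fun _ => 0) n (fun _ => 0) U

-- Costs of the operations on tuples and tables

section

variable {univ : List State} {n K : ℕ} {U V : List (List State)}
  {D E : List (List (List State))}

theorem ValidTuple.plain {w : State → ℕ∞} {ω : ℕ → ℕ∞} (h : ValidTuple univ w n ω U) :
    PlainTuple univ n U :=
  ⟨h.1, fun i hi => ⟨(h.2 i hi).1, (h.2 i hi).2.1, by simp [weight]⟩⟩

theorem PlainTuple.zipWith (hU : PlainTuple univ n U) (hV : PlainTuple univ n V) :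
    PlainTuple univ n (List.zipWith (· ∪ ·) U V) :=
  (ValidTuple.zipWith hU hV).plain

theorem Represents.plain {w : State → ℕ∞} {ω : ℕ → ℕ∞} {φ : Formula State}
    (h : Represents univ w n ω D φ) : ∀ U ∈ D, PlainTuple univ n U :=
  fun U hU => (h.valid U hU).plain

/-- A duplicate-free list of elements of `univ` is no longer than `univ`. This crude bound suffices
for the cost of set operations; weights are needed only for counting sets and implications. -/
theorem PlainTuple.small (hu : univ.length ≤ K) (hw : ∀ X ∈ univ, 4 + 2 * X.width ≤ K)
    (hU : PlainTuple univ n U) : ∀ X ∈ U, Small K X := by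
  intro X hX
  obtain ⟨i, hi, rfl⟩ := List.mem_iff_getElem.1 hX
  obtain ⟨h1, h2, -⟩ := hU.2 i (by rw [← hU.1]; exact hi)
  simp only [List.getD_eq_getElem?_getD, List.getElem?_eq_getElem hi, Option.getD_some] at h1 h2
  exact ⟨(h1.subperm h2).length_le.trans hu, fun x hx => hw x (h2 x hx)⟩

/-- Bound for the union of two tuples. -/
def tupleUnionBound (K : ℕ) : ℕ := 1 + K * (1 + unionBound K K)

theorem tupleUnionT_time_le (hn : U.length ≤ K) (hU : ∀ X ∈ U, Small K X)
    (hV : ∀ X ∈ V, Small K X) : (tupleUnionT U V).time ≤ tupleUnionBound K := by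
  suffices h : (tupleUnionT U V).time ≤ 1 + U.length * (1 + unionBound K K) from
    h.trans (by unfold tupleUnionBound; gcongr)
  clear hn
  induction U generalizing V with
  | nil => simp [tupleUnionT]
  | cons X U ih =>
    cases V with
    | nil => simp [tupleUnionT]
    | cons Y V =>
      have h1 := ih (fun Z hZ => hU Z (by simp [hZ])) (V := V) fun Z hZ => hV Z (by simp [hZ])
      have h2 := unionT_time_le (hU X (by simp)).1 (hV Y (by simp)).1 (hU X (by simp)).2
      simp only [tupleUnionT, Timed.time_bind, Timed.time_tick, Timed.time_pure,
        List.length_cons]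
      rw [add_mul]; omega

/-- Bound for the product of two normal forms with at most `L` elements. -/
def prodBound (K L : ℕ) : ℕ := 2 + L * (3 + L * (1 + tupleUnionBound K) + L)

/-- The tuples with entries in `univ` have at most `K` components, of at most `K` states. -/
structure SmallUniv (univ : List State) (n K : ℕ) : Prop where
  arity_le : n ≤ K
  length_le : univ.length ≤ K
  width_le : ∀ X ∈ univ, 4 + 2 * X.width ≤ K

theorem SmallUniv.tupleUnionT_time_le (h : SmallUniv univ n K) (hU : PlainTuple univ n U)
    (hV : PlainTuple univ n V) : (tupleUnionT U V).time ≤ tupleUnionBound K :=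
  MttTypecheck.tupleUnionT_time_le (hU.1.trans_le h.arity_le) (hU.small h.2 h.3)
    (hV.small h.2 h.3)

theorem SmallUniv.prodT_time_le (h : SmallUniv univ n K) {L : ℕ} (hD : ∀ U ∈ D, PlainTuple univ n U)
    (hE : ∀ U ∈ E, PlainTuple univ n U) (hD' : D.length ≤ L) (hE' : E.length ≤ L) :
    (prodT D E).time ≤ prodBound K L := by
  have h1 := flatMapT_time_le (fun U => mapT (fun V => tupleUnionT U V) E) D
    (1 + L * (1 + tupleUnionBound K)) L
    (fun U hU => (mapT_time_le _ _ _ fun V hV => h.tupleUnionT_time_le (hD U hU) (hE V hV)).trans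
      (by gcongr)) (by simpa using fun _ _ => hE')
  have h2 : D.length * (2 + (1 + L * (1 + tupleUnionBound K)) + L) ≤
      L * (3 + L * (1 + tupleUnionBound K) + L) := by
    rw [← add_assoc 2]; gcongr
  simp only [prodT, Timed.time_bind, Timed.time_tick, prodBound]
  omega

theorem plain_prodT (hD : ∀ U ∈ D, PlainTuple univ n U) (hE : ∀ U ∈ E, PlainTuple univ n U) :
    ∀ U ∈ (prodT D E).val, PlainTuple univ n U := by
  intro W hW
  simp only [prodT_val, List.mem_flatMap, List.mem_map] at hW
  obtain ⟨U, hU, V, hV, rfl⟩ := hW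
  exact (hD U hU).zipWith (hE V hV)

/-- Bound for multiplying with at most `K` entries of tables. -/
def selectBound (K : ℕ) : ℕ := 1 + K * (2 + K + prodBound K K)

/-- The length of the accumulator times the caps still to come never increases, as each step moves
one cap from the second factor into the first. Since caps are at least 1, every intermediate product
therefore has at most `K` elements. -/
theorem SmallUniv.selectT_time_le (h : SmallUniv univ n K) {es : List Expr}
    (F : Expr → List (List (List (List State)))) (cap : Expr → ℕ) {sel : List ℕ}
    (hes : es.length ≤ K)
    (hF : ∀ e ∈ es, (F e).length ≤ K ∧ ∀ q, ((F e).getD q []).length ≤ cap e ∧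
      ∀ U ∈ (F e).getD q [], PlainTuple univ n U)
    (hcap : ∀ e ∈ es, 1 ≤ cap e) (hprod : (es.map cap).prod ≤ K)
    (hD : ∀ U ∈ D, PlainTuple univ n U) (hDK : D.length * (es.map cap).prod ≤ K) :
    (selectT (es.map F) sel D).time ≤ selectBound K := by
  suffices h' : (selectT (es.map F) sel D).time ≤ 1 + es.length * (2 + K + prodBound K K) from
    h'.trans (by unfold selectBound; gcongr)
  clear hes
  induction es generalizing D sel with
  | nil => simp [selectT]
  | cons e es ih =>
    cases sel with
    | nil => simp [selectT]
    | cons q sel =>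
      obtain ⟨h1, h2⟩ := hF e (by simp)
      obtain ⟨h2, h3⟩ := h2 q
      -- Positive remaining caps can be dropped from the products, which bounds the current factors
      -- by `K`.
      have hpos : 1 ≤ (es.map cap).prod := Nat.one_le_iff_ne_zero.2 (by
        intro h0
        rw [List.prod_eq_zero_iff, List.mem_map] at h0
        obtain ⟨e', h5, h6⟩ := h0
        have := hcap e' (by simp [h5]); omega)
      have hcape := hcap e (by simp)
      rw [List.map_cons, List.prod_cons] at hprod hDK
      have h4 := ih (D := (prodT D ((F e).getD q [])).val) (sel := sel)
        (fun e he => hF e (by simp [he])) (fun e he => hcap e (by simp [he]))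
        ((Nat.le_mul_of_pos_left _ hcape).trans hprod) (plain_prodT hD h3)
        (by rw [length_prodT, mul_assoc]
            exact (Nat.mul_le_mul_left _ (Nat.mul_le_mul_right _ h2)).trans hDK)
      have h5 := h.prodT_time_le (L := K) hD h3
        ((Nat.le_mul_of_pos_right _ (Nat.mul_pos hcape hpos)).trans hDK)
        ((h2.trans (Nat.le_mul_of_pos_right _ hpos)).trans hprod)
      have h6 := getT_time_le [] (F e) q
      simp only [List.map_cons, selectT, Timed.time_bind, Timed.time_tick, getT_val,
        List.length_cons]
      rw [add_mul]; omega

/-- Bound for the tuple of a conjunction of at most `K` atoms. -/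
def atomsBound (K : ℕ) : ℕ := 2 + K + K * (2 + K + tupleUnionBound K)

theorem SmallUniv.atomsTupleT_time_le (h : SmallUniv univ n K) {ats : List (ℕ × State)}
    (hK : ats.length ≤ K) (hats : ∀ x ∈ ats, x.2 ∈ univ) :
    (atomsTupleT n ats).time ≤ atomsBound K := by
  suffices h' : (atomsTupleT n ats).time ≤
      2 + K + ats.length * (2 + K + tupleUnionBound K) from
    h'.trans (by unfold atomsBound; gcongr)
  clear hK
  have hn := h.arity_le
  induction ats with
  | nil => simp [atomsTupleT]; omega
  | cons x ats ih =>
    have h1 := ih fun y hy => hats y (by simp [hy])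
    have h2 := h.tupleUnionT_time_le
      ((Represents.atom (w := fun _ => 0) (h := x.1) (hats x (by simp))).plain
        (singleTupleT x.2 n x.1).val (by simp))
      ((Represents.atoms (w := fun _ => 0) ats fun y hy => hats y (by simp [hy])).plain
        (atomsTupleT n ats).val (by simp))
    have h3 := singleTupleT_time_le x.2 n x.1
    simp only [atomsTupleT, Timed.time_bind, Timed.time_tick, List.length_cons]
    rw [add_mul]; omega

/-- Bound for one node of a family, not counting its children. -/
def nodeBound (K : ℕ) : ℕ := 4 + K * (2 + K * (2 + (atomsBound K + selectBound K) + K))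

theorem dnfAllT_time (n : ℕ) (fs : List Shared) :
    (dnfAllT n fs).time = 1 + (fs.map fun f => (dnfT n f).time + 1).sum := by
  induction fs with
  | nil => simp [dnfAllT]
  | cons f fs ih => simp [dnfAllT, ih]; omega

/-- Each child is tabulated once for all selections, so the times of the children add up instead of
multiplying. The `+ 1` is the tick that `dnfAllT` spends on a child. -/
theorem SmallUniv.dnfT_time_le (h : SmallUniv univ n K) {es : List Expr} (F : Expr → Shared)
    (cap : Expr → ℕ) {rows : List (List (List (ℕ × State) × List ℕ))} (hes : es.length ≤ K)
    (hF : ∀ e ∈ es, (dnfT n (F e)).val.length ≤ K ∧ ∀ q, (memberDnf n (F e) q).length ≤ cap e ∧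
      ∀ U ∈ memberDnf n (F e) q, PlainTuple univ n U)
    (hcap : ∀ e ∈ es, 1 ≤ cap e) (hprod : (es.map cap).prod ≤ K) (hrows : rows.length ≤ K)
    (hrow : ∀ row ∈ rows, row.length ≤ K)
    (hpair : ∀ row ∈ rows, ∀ d ∈ row, d.1.length ≤ K ∧ (∀ x ∈ d.1, x.2 ∈ univ) ∧
      (pairDnf n (es.map F) d).length ≤ K) :
    (dnfT n (.node rows (es.map F))).time + 1 ≤
      nodeBound K + (es.map fun e => (dnfT n (F e)).time + 1).sum := by
  have h1 : ∀ row ∈ rows, (flatMapT (fun d : List (ℕ × State) × List ℕ => do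
        let U ← atomsTupleT n d.1
        selectT (dnfAllT n (es.map F)).val d.2 [U]) row).time ≤
      1 + K * (2 + (atomsBound K + selectBound K) + K) := by
    intro row hr
    refine (flatMapT_time_le _ _ (atomsBound K + selectBound K) K ?_ ?_).trans
      (by have := hrow row hr; gcongr)
    · intro d hd
      obtain ⟨h1, h2, h3⟩ := hpair row hr d hd
      have h4 := h.atomsTupleT_time_le h1 h2
      have h5 := h.selectT_time_le (D := [(atomsTupleT n d.1).val]) (sel := d.2)
        (fun e => (dnfT n (F e)).val) cap hes hF hcap hprod
        (Represents.atoms (w := fun _ => 0) d.1 h2).plain (by simpa using hprod)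
      simp only [Timed.time_bind, dnfAllT_val, List.map_map, Function.comp_def]
      omega
    · intro d hd
      have := (hpair row hr d hd).2.2
      simpa [pairDnf] using this
  have h2 := mapT_time_le (fun row => flatMapT (fun d : List (ℕ × State) × List ℕ => do
        let U ← atomsTupleT n d.1
        selectT (dnfAllT n (es.map F)).val d.2 [U]) row) rows _ h1
  have h3 : rows.length * (1 + (1 + K * (2 + (atomsBound K + selectBound K) + K))) ≤
      K * (2 + K * (2 + (atomsBound K + selectBound K) + K)) := by
    rw [← add_assoc 1]; gcongr
  have h4 := dnfAllT_time n (es.map F)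
  rw [List.map_map] at h4
  simp only [dnfT, Timed.time_bind, Timed.time_tick, h4, nodeBound]
  simp only [Function.comp_def] at h4 ⊢
  omega

end

/-- The numerical parameters of an instance are bounded by `K`. -/
structure Bounds (I : Instance) (b k K : ℕ) : Prop where
  wf : I.WF
  arity_le : ∀ m ∈ I.mtt.arity, m ≤ k
  size_le : I.size ≤ K
  pow_le : ∀ l ≤ k, I.out.states ^ l ≤ K
  states_le : I.states.length ≤ K
  width_le : 4 + 2 * k ≤ K
  calls_le : ∀ n ∈ I.rank, max I.out.states 1 ^ (n * (b + 1)) ≤ K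

-- Uniform bounds for an instance and the normal forms of inferred families

section

variable {I : Instance} {b k K : ℕ}

theorem Instance.width_le (hk : ∀ m ∈ I.mtt.arity, m ≤ k) : ∀ X ∈ I.states, X.width ≤ k := by
  intro X hX
  match X with
  | .start => simp [State.width]
  | .inp q => simp [State.width]
  | .call p q qs =>
    exact hk _ (List.mem_of_getElem? (Instance.call_mem_states.1 hX).1)

theorem le_sum_of_mem {α : Type} (f : α → ℕ) {l : List α} {x : α} (h : x ∈ l) :
    f x ≤ (l.map f).sum :=
  List.single_le_sum (by simp) _ (List.mem_map_of_mem h)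

theorem length_le_sum {α : Type} (f : α → ℕ) (hf : ∀ x, 1 ≤ f x) (l : List α) :
    l.length ≤ (l.map f).sum := by
  induction l with
  | nil => simp
  | cons x l ih => have := hf x; simp; omega

theorem Bta.bounds (M : Bta) : M.states ≤ M.size ∧ M.final.length ≤ M.size ∧
    M.rules.length ≤ M.size ∧ ∀ r ∈ M.rules, r.args.length ≤ M.size := by
  have h1 := length_le_sum (fun r : BtaRule => 2 + r.args.length) (by intro; omega) M.rules
  refine ⟨by unfold Bta.size; omega, by unfold Bta.size; omega, by unfold Bta.size; omega, ?_⟩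
  intro r hr
  have h2 := le_sum_of_mem (fun r : BtaRule => 2 + r.args.length) hr
  unfold Bta.size
  omega

theorem Mtt.bounds (T : Mtt) : T.arity.length ≤ T.size ∧ T.initial.length ≤ T.size ∧
    T.rules.length ≤ T.size ∧ ∀ r ∈ T.rules, r.body.size ≤ T.size := by
  have h1 := length_le_sum (fun r : MttRule => 2 + r.body.size) (by intro; omega) T.rules
  have h0 := length_le_sum (fun r : ℕ => r + 1) (by intro; omega) T.arity
  refine ⟨by unfold Mtt.size; omega, by unfold Mtt.size; omega, by unfold Mtt.size; omega, ?_⟩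
  intro r hr
  have h2 := le_sum_of_mem (fun r : MttRule => 2 + r.body.size) hr
  unfold Mtt.size
  omega

theorem Bounds.smallUniv (h : Bounds I b k K) {n : ℕ} (hn : n ∈ I.rank) :
    SmallUniv I.states n K := by
  refine ⟨?_, h.states_le, fun X hX => ?_⟩
  · have h1 := le_sum_of_mem (fun r : ℕ => r + 1) hn
    have h2 := h.size_le
    unfold Instance.size at h2
    omega
  · have := Instance.width_le h.arity_le X hX
    have := h.width_le
    omega

theorem Bounds.out_size_le (h : Bounds I b k K) : I.out.size ≤ K := by
  have := h.size_le; unfold Instance.size at this; omega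

theorem Bounds.inp_size_le (h : Bounds I b k K) : I.inp.size ≤ K := by
  have := h.size_le; unfold Instance.size at this; omega

theorem Bounds.mtt_size_le (h : Bounds I b k K) : I.mtt.size ≤ K := by
  have := h.size_le; unfold Instance.size at this; omega

theorem Bounds.rank_length_le (h : Bounds I b k K) : I.rank.length ≤ K := by
  have := h.size_le
  have h0 := length_le_sum (fun r : ℕ => r + 1) (by intro; omega) I.rank
  unfold Instance.size at this; omega

theorem length_dnfT_inferT (M : Bta) (n s : ℕ) (qs : List ℕ) (e : Expr) :
    (dnfT n (inferT M (List.range s) qs e).val).val.length = s := by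
  cases e with
  | var j => simp [inferT_var_val, dnfT_node_val]
  | cons b es => simp [inferT_cons_val, dnfT_node_val]
  | call p h es => simp [inferT_call_val, dnfT_node_val]

/-- An index outside the range of states yields the default entry `[]`, so the bound holds for all
`q`, as required of the tables in `SmallUniv.selectT_time_le`. -/
theorem length_memberDnf_inferT_le (h : Bounds I b k K) (n n' k' : ℕ) (qs : List ℕ) (e : Expr)
    (he : e.WF I.rank I.mtt.arity n' k') (q : ℕ) :
    (memberDnf n (inferT I.out (List.range I.out.states) qs e).val q).length ≤
      max I.out.states 1 ^ e.calls := by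
  by_cases hq : q < I.out.states
  · exact (length_memberDnf_le hq _).trans
      (totalLength_inferT_le h.wf.2.2.1 h.wf.2.2.2 n n' k' qs e he)
  · rw [memberDnf, List.getD_eq_default]
    · simp
    · rw [length_dnfT_inferT]; omega

theorem memberDnf_inferT_plain (h : Bounds I b k K) (n n' k' : ℕ) (qs : List ℕ) (e : Expr)
    (he : e.WF I.rank I.mtt.arity n' k') (q : ℕ) :
    ∀ U ∈ memberDnf n (inferT I.out (List.range I.out.states) qs e).val q,
      PlainTuple I.states n U := by
  by_cases hq : q < I.out.states
  · exact (inferT_represents h.wf b n n' k' qs e he hq).plain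
  · rw [memberDnf, List.getD_eq_default]
    · simp
    · rw [length_dnfT_inferT]; omega

theorem prod_map_pow_calls (m : ℕ) (es : List Expr) :
    (es.map fun e => m ^ e.calls).prod = m ^ Expr.callsAll es := by
  induction es with
  | nil => simp [Expr.callsAll]
  | cons e es ih => simp [Expr.callsAll, pow_add, ih]

theorem length_pairDnf_le_memberDnf {n s q : ℕ} (hq : q < s)
    (g : ℕ → List (List (ℕ × State) × List ℕ)) (fs : List Shared) {d} (hd : d ∈ g q) :
    (pairDnf n fs d).length ≤ (memberDnf n (.node ((List.range s).map g) fs) q).length := by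
  rw [memberDnf_node hq, List.length_flatMap]
  exact le_sum_of_mem (fun d => (pairDnf n fs d).length) hd

/-- The caps are `m ^ calls` with `m = max states 1`; their product over the arguments is `m ^
callsAll`, which the bound at the root keeps below `K`. The nodes then cost `nodeBound K` each. -/
theorem dnfT_inferT_time_le (h : Bounds I b k K) {n n' k' : ℕ} (hn : n ∈ I.rank) (qs : List ℕ)
    (e : Expr) (he : e.WF I.rank I.mtt.arity n' k') (hsize : e.size ≤ K)
    (hcalls : max I.out.states 1 ^ e.calls ≤ K) :
    (dnfT n (inferT I.out (List.range I.out.states) qs e).val).time + 1 ≤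
      e.size * nodeBound K := by
  have hu := h.smallUniv hn
  have hout := I.out.bounds
  have hK := h.out_size_le
  have hm : 1 ≤ max I.out.states 1 := le_max_right _ _
  induction e using Expr.induct with
  | var j =>
    have h1 := length_memberDnf_inferT_le h n n' k' qs _ he
    rw [inferT_var_val] at h1 ⊢
    -- A parameter has no children, so the family and the cap are placeholders.
    have h2 := hu.dnfT_time_le (es := []) (fun e => .node [] []) (fun _ => 1)
      (rows := (List.range I.out.states).map fun q =>
        if qs[j]? = some q then [([], [])] else []) (by simp) (by simp) (by simp)
      (by simp; have := h.width_le; omega) (by simp; omega)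
      (by simp; intro q hq; split <;> simp; have := h.width_le; omega) (by
        simp only [List.mem_map, List.mem_range]
        rintro _ ⟨q, hq, rfl⟩ d hd
        refine ⟨?_, ?_, ((length_pairDnf_le_memberDnf hq _ _ hd).trans (h1 q)).trans hcalls⟩
        · split at hd <;> simp_all
        · split at hd <;> simp_all)
    simpa [Expr.size] using h2
  | cons a es ih =>
    have h1 := length_memberDnf_inferT_le h n n' k' qs _ he
    simp only [Expr.WF, Expr.allWF_iff] at he
    rw [Expr.calls] at hcalls
    rw [Expr.size, Expr.sizeAll_eq] at hsize
    have hes : es.length ≤ K := by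
      have := Expr.length_le_sizeAll es; rw [Expr.sizeAll_eq] at this; omega
    rw [inferT_cons_val] at h1 ⊢
    have h2 := hu.dnfT_time_le (es := es)
      (fun e => (inferT I.out (List.range I.out.states) qs e).val)
      (fun e => max I.out.states 1 ^ e.calls)
      (rows := (List.range I.out.states).map fun q =>
          (I.out.rules.filter fun r => r.target = q ∧ r.symbol = a).map fun r => ([], r.args))
      hes (fun e h' => ⟨by rw [length_dnfT_inferT]; omega, fun q =>
        ⟨length_memberDnf_inferT_le h n n' k' qs e (he.2 e h') q,
          memberDnf_inferT_plain h n n' k' qs e (he.2 e h') q⟩⟩)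
      (fun e _ => Nat.one_le_pow _ _ hm) (by rwa [prod_map_pow_calls]) (by simp; omega)
      (by simp only [List.mem_map, List.mem_range]
          rintro _ ⟨q, hq, rfl⟩
          rw [List.length_map]
          exact (List.length_filter_le _ _).trans (by omega)) (by
        simp only [List.mem_map, List.mem_range]
        rintro _ ⟨q, hq, rfl⟩ d hd
        refine ⟨?_, ?_, ((length_pairDnf_le_memberDnf hq
          (fun q => (I.out.rules.filter fun r => r.target = q ∧ r.symbol = a).map
            fun r => ([], r.args)) _ hd).trans (h1 q)).trans hcalls⟩
        · obtain ⟨r, -, rfl⟩ := List.mem_map.1 hd; simp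
        · obtain ⟨r, -, rfl⟩ := List.mem_map.1 hd; simp)
    refine h2.trans ?_
    rw [Expr.size, add_mul, one_mul, Expr.sizeAll_eq, ← List.sum_map_mul_right]
    gcongr
    refine List.sum_le_sum fun e h' => ?_
    have h3 := Expr.le_sum_of_mem Expr.size h'
    have h4 := Expr.le_sum_of_mem Expr.calls h'
    rw [← Expr.callsAll_eq] at h4
    exact ih e h' (he.2 e h') (by omega) ((Nat.pow_le_pow_right hm h4).trans hcalls)
  | call p x es ih =>
    have h1 := length_memberDnf_inferT_le h n n' k' qs _ he
    simp only [Expr.WF, Expr.allWF_iff] at he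
    rw [Expr.calls] at hcalls
    have hcalls' : max I.out.states 1 ^ Expr.callsAll es ≤ K :=
      (Nat.pow_le_pow_right hm (by omega)).trans hcalls
    rw [Expr.size, Expr.sizeAll_eq] at hsize
    have hes : es.length ≤ K := by
      have := Expr.length_le_sizeAll es; rw [Expr.sizeAll_eq] at this; omega
    rw [inferT_call_val] at h1 ⊢
    have hl : es.length ≤ k := h.arity_le _ (List.mem_of_getElem? he.2.1)
    have h2 := hu.dnfT_time_le (es := es)
      (fun e => (inferT I.out (List.range I.out.states) qs e).val)
      (fun e => max I.out.states 1 ^ e.calls)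
      (rows := (List.range I.out.states).map fun q =>
          (tuples I.out.states es.length).map fun t => ([(x, State.call p q t)], t))
      hes (fun e h' => ⟨by rw [length_dnfT_inferT]; omega, fun q =>
        ⟨length_memberDnf_inferT_le h n n' k' qs e (he.2.2 e h') q,
          memberDnf_inferT_plain h n n' k' qs e (he.2.2 e h') q⟩⟩)
      (fun e _ => Nat.one_le_pow _ _ hm) (by rwa [prod_map_pow_calls]) (by simp; omega)
      (by simp only [List.mem_map, List.mem_range]
          rintro _ ⟨q, hq, rfl⟩
          rw [List.length_map, length_tuples]
          exact h.pow_le _ hl) (by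
        simp only [List.mem_map, List.mem_range]
        rintro _ ⟨q, hq, rfl⟩ d hd
        refine ⟨?_, ?_, ((length_pairDnf_le_memberDnf hq
          (fun q => (tuples I.out.states es.length).map fun t => ([(x, State.call p q t)], t))
            _ hd).trans (h1 q)).trans (by rwa [Expr.calls])⟩
        · obtain ⟨r, -, rfl⟩ := List.mem_map.1 hd
          simp; have := h.width_le; omega
        · obtain ⟨t, ht, rfl⟩ := List.mem_map.1 hd
          obtain ⟨h5, h6⟩ := mem_tuples.1 ht
          simp only [List.mem_singleton, forall_eq]
          exact Instance.call_mem_states.2 ⟨by rw [h5]; exact he.2.1, hq, h6⟩)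
    refine h2.trans ?_
    rw [Expr.size, add_mul, one_mul, Expr.sizeAll_eq, ← List.sum_map_mul_right]
    gcongr
    refine List.sum_le_sum fun e h' => ?_
    have h3 := Expr.le_sum_of_mem Expr.size h'
    have h4 := Expr.le_sum_of_mem Expr.calls h'
    rw [← Expr.callsAll_eq] at h4
    exact ih e h' (he.2.2 e h') (by omega) ((Nat.pow_le_pow_right hm h4).trans hcalls')

/-! ### Running time of the inference -/

theorem inferAllT_time (M : Bta) (Q qs : List ℕ) (es : List Expr) :
    (inferAllT M Q qs es).time = 1 + (es.map fun e => (inferT M Q qs e).time + 1).sum := by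
  induction es with
  | nil => simp [inferAllT]
  | cons e es ih => simp [inferAllT, ih]; omega

/-- Bound for the inference at one node of an expression. -/
def inferBound (K : ℕ) : ℕ :=
  10 + 4 * K + K * (2 + K * (3 + 3 * K)) + K * (10 + 8 * K)

/-- No normal form is expanded here: each node stores one table and refers to its children. Hence no
bound on copying is needed, and procedures of infinite copy number are covered as well. -/
theorem inferT_time_le (h : Bounds I b k K) {n' k' : ℕ} (qs : List ℕ) (hqs : qs.length ≤ K)
    (e : Expr) (he : e.WF I.rank I.mtt.arity n' k') (hsize : e.size ≤ K) :
    (inferT I.out (List.range I.out.states) qs e).time + 1 ≤ e.size * inferBound K := by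
  have hout := I.out.bounds
  have hK := h.out_size_le
  have hs : I.out.states ≤ K := by omega
  have hr : I.out.rules.length ≤ K := by omega
  have children : ∀ es : List Expr, (∀ e ∈ es, e.WF I.rank I.mtt.arity n' k' → e.size ≤ K →
      (inferT I.out (List.range I.out.states) qs e).time + 1 ≤ e.size * inferBound K) →
      (∀ e ∈ es, e.WF I.rank I.mtt.arity n' k') → 1 + Expr.sizeAll es ≤ K →
      (inferAllT I.out (List.range I.out.states) qs es).time ≤
        1 + Expr.sizeAll es * inferBound K := by
    intro es ih hes hsize
    rw [inferAllT_time, Expr.sizeAll_eq, ← List.sum_map_mul_right]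
    gcongr
    refine List.sum_le_sum fun e h' => ih e h' (hes e h') ?_
    have h3 := Expr.le_sum_of_mem Expr.size h'
    rw [Expr.sizeAll_eq] at hsize
    omega
  induction e using Expr.induct with
  | var j =>
    have h1 := mapT_time_le (fun q => do tick; pure (some q)) qs 1 (by simp)
    have h2 := getT_time_le none (qs.map some) j
    rw [List.length_map] at h2
    simp only [inferT, Timed.time_bind, Timed.time_tick, Timed.time_pure, mapT_val, getT_val,
      Timed.val_bind, Timed.val_pure, Expr.size, one_mul, inferBound]
    have h4 : I.out.states * (1 + 1) ≤ K * (1 + 1) := by gcongr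
    have h5 : qs.length * (1 + 1) ≤ K * (1 + 1) := by gcongr
    refine le_trans (b := 1 + (1 + qs.length * (1 + 1) + (1 + qs.length +
      (1 + I.out.states * (1 + 1) + 0))) + 1) ?_ ?_
    · gcongr
      refine (mapT_time_le _ _ 1 fun q _ => ?_).trans (by rw [List.length_range])
      split <;> simp
    · have h6 : K * 10 ≤ K * (10 + 8 * K) := by gcongr; omega
      omega
  | cons a es ih =>
    simp only [Expr.WF, Expr.allWF_iff] at he
    rw [Expr.size] at hsize
    have h1 := children es ih he.2 hsize
    have h2 : (mapT (fun q => do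
        let rs ← filterT (fun r : BtaRule => do
          let t ← natEqT r.target q
          let s ← natEqT r.symbol a
          pure (t && s)) I.out.rules
        mapT (fun r : BtaRule => do tick; pure (([] : List (ℕ × State)), r.args)) rs)
        (List.range I.out.states)).time ≤ 1 + K * (1 + (2 + 5 * K)) := by
      refine (mapT_time_le _ _ (2 + 5 * K) ?_).trans (by simp only [List.length_range]; gcongr)
      intro q _
      have h3 := filterT_time_le (fun r : BtaRule => do
          let t ← natEqT r.target q
          let s ← natEqT r.symbol a
          pure (t && s)) I.out.rules 2 (by simp)
      have h4 := mapT_time_le (fun r : BtaRule => do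
        tick; pure (([] : List (ℕ × State)), r.args)) (filterT (fun r : BtaRule => do
          let t ← natEqT r.target q
          let s ← natEqT r.symbol a
          pure (t && s)) I.out.rules).val 1 (by simp)
      have h5 : (filterT (fun r : BtaRule => do
          let t ← natEqT r.target q
          let s ← natEqT r.symbol a
          pure (t && s)) I.out.rules).val.length ≤ I.out.rules.length := by
        rw [filterT_val]; exact List.length_filter_le _ _
      rw [Timed.time_bind]
      omega
    simp only [inferT, Timed.time_bind, Timed.time_tick, Timed.time_pure, Expr.size]
    rw [add_mul, one_mul]
    have h3 : 1 + K * (1 + (2 + 5 * K)) + 3 ≤ inferBound K := by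
      unfold inferBound; nlinarith
    omega
  | call p x es ih =>
    simp only [Expr.WF, Expr.allWF_iff] at he
    rw [Expr.size] at hsize
    have h1 := children es ih he.2.2 hsize
    -- A call tabulates all `states ^ l` argument tuples; only the bound on the number of parameters
    -- makes this polynomial.
    have hl : es.length ≤ k := h.arity_le _ (List.mem_of_getElem? he.2.1)
    have h2 : (mapT (fun q => mapT (fun t => do tick; pure ([(x, State.call p q t)], t))
        (tuples I.out.states es.length)) (List.range I.out.states)).time ≤
        1 + K * (1 + (1 + K * (1 + 1))) := by
      refine (mapT_time_le _ _ (1 + K * (1 + 1)) ?_).trans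
        (by simp only [List.length_range]; gcongr)
      intro q _
      refine (mapT_time_le _ _ 1 (by simp)).trans ?_
      rw [length_tuples]
      have := h.pow_le _ hl
      gcongr
    have h3 := tuplesT_time_le hs fun j (hj : j ≤ es.length) => h.pow_le j (by omega)
    have h4 : es.length ≤ K := by have := h.width_le; omega
    simp only [inferT, Timed.time_bind, Timed.time_tick, Timed.time_pure, Expr.size, lengthT_time,
      lengthT_val, tuplesT_val]
    rw [add_mul, one_mul]
    have h5 : es.length * (2 + K * (3 + 3 * K)) ≤ K * (2 + K * (3 + 3 * K)) := by gcongr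
    have h6 : 1 + K * (1 + (1 + K * (1 + 1))) + (1 + K * (2 + K * (3 + 3 * K))) + (K + 1) + 3 ≤
        inferBound K := by
      unfold inferBound; nlinarith
    omega

end

/-! ### The table of the automaton of the intersection -/

/-- The disjunction computed for a state other than the initial one, and a symbol. -/
def Instance.disj (I : Instance) (X : State) (a : ℕ) : Disj :=
  match X with
  | .start => []
  | .inp q => [(.node [(I.inp.rules.filter fun r => r.target = q ∧ r.symbol = a).map fun r =>
      ((atomsT 0 r.args).val, [])] [], 0)]
  | .call p q qs => (I.mtt.rules.filter fun r => r.proc = p ∧ r.symbol = a).map fun r =>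
      ((inferT I.out (List.range I.out.states) qs r.body).val, q)

/-- The initial states of the automaton of the preimage. -/
def Instance.startCalls (I : Instance) : List State :=
  I.mtt.initial.flatMap fun p => I.coFinal.map fun q => .call p q []

/-- The conjunction computed for a state and a symbol. -/
def Instance.conj (I : Instance) (X : State) (a : ℕ) : Conj :=
  match X with
  | .start => [I.startCalls.flatMap fun X => I.disj X a,
      (I.inp.final.map State.inp).flatMap fun X => I.disj X a]
  | X => [I.disj X a]

/-- The entry of a table for the state `X`. -/
def Instance.entry (I : Instance) (X : State) : State × List Disj :=
  (X, (List.range I.rank.length).map fun a => I.disj X a)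

theorem backwardT_val (I : Instance) :
    (backwardT I (List.range I.rank.length) (List.range I.out.states)).val =
      ((List.range I.mtt.arity.length).flatMap fun p =>
        (tuples I.out.states (I.mtt.arity.getD p 0)).flatMap fun qs =>
          (List.range I.out.states).map fun q => State.call p q qs).map I.entry := by
  simp only [backwardT, Timed.val_bind, lengthT_val, rangeT_val, flatMapT_val, getT_val,
    tuplesT_val, mapT_val, filterT_val, Timed.val_pure, natEqT_val, List.map_map, Function.comp_def,
    List.map_flatMap, Instance.entry, Instance.disj, ← List.range_eq_range', Bool.decide_and]

theorem inputT_val (I : Instance) :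
    (inputT I (List.range I.rank.length)).val =
      ((List.range I.inp.states).map State.inp).map I.entry := by
  simp only [inputT, Timed.val_bind, rangeT_val, mapT_val, filterT_val, Timed.val_pure, natEqT_val,
    List.map_map, Function.comp_def, Instance.entry, Instance.disj, ← List.range_eq_range',
    Bool.decide_and]

/-- Repeated keys are harmless, since the row is a function of the key. -/
theorem lookupT_val_of_mem {α : Type} (f : State → List α) {l : List State} {X : State}
    (hX : X ∈ l) : (lookupT X (l.map fun Y => (Y, f Y))).val = f X := by
  induction l with
  | nil => simp at hX
  | cons Y l ih =>
    simp only [List.map_cons, lookupT, Timed.val_bind, stateEqT_val, Timed.val_ite,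
      Timed.val_pure, decide_eq_true_eq]
    split
    · next h => rw [h]
    · next h => exact ih ((List.mem_cons.1 hX).resolve_left h)

theorem lookupT_time_le {α : Type} {X : State} (table : List (State × List α)) {c : ℕ}
    (hX : 4 + 2 * X.width ≤ c) : (lookupT X table).time ≤ 1 + table.length * (1 + c) := by
  induction table with
  | nil => simp [lookupT]
  | cons x table ih =>
    have h1 := (stateEqT_time_le X x.1).trans hX
    simp only [lookupT, Timed.time_bind, Timed.time_tick, Timed.time_ite, Timed.time_pure,
      List.length_cons]
    rw [add_mul]
    split <;> omega

theorem Instance.mem_coFinal {I : Instance} {q : ℕ} :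
    q ∈ I.coFinal ↔ q < I.out.states ∧ q ∉ I.out.final := by
  simp [Instance.coFinal]

theorem Instance.startCalls_mem {I : Instance} (hI : I.WF) {X : State} (hX : X ∈ I.startCalls) :
    ∃ p ∈ I.mtt.initial, ∃ q, X = .call p q [] ∧ X ∈ I.states := by
  simp only [Instance.startCalls, List.mem_flatMap, List.mem_map, Instance.mem_coFinal] at hX
  obtain ⟨p, hp, q, ⟨hq, -⟩, rfl⟩ := hX
  exact ⟨p, hp, q, rfl, Instance.call_mem_states.2 ⟨by simpa using hI.1.1 p hp, hq, by simp⟩⟩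

theorem coFinal_eq (I : Instance) :
    (List.range I.out.states).filter (fun q => !(I.out.final.any fun y => decide (q = y))) =
      I.coFinal := by
  unfold Instance.coFinal
  refine List.filter_congr fun q _ => ?_
  rw [Bool.eq_iff_iff]
  simp only [Bool.not_eq_true', List.any_eq_false, decide_eq_true_eq]
  constructor
  · intro h hq; exact h q hq rfl
  · rintro h y hy rfl; exact h hy

/-- The point is the row of `start`: by well-formedness the states looked up for it are keys of the
two tables, so that no lookup falls back on its default. -/
theorem ataT_val {I : Instance} (hI : I.WF) :
    (ataT I).val = I.states.map fun X => (X, (List.range I.rank.length).map (I.conj X)) := by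
  have hco := coFinal_eq I
  simp only [ataT, Timed.val_bind, lengthT_val, rangeT_val, filterT_val, memT_val, natEqT_val,
    Timed.val_pure, flatMapT_val, mapT_val, appendT_val, getT_val, ← List.range_eq_range', hco,
    backwardT_val, inputT_val]
  rw [Instance.states, List.map_cons]
  congr 1
  · congr 1
    refine List.map_congr_left fun a ha => ?_
    simp only [List.mem_range] at ha
    have h1 : ∀ l : List State, ∀ X ∈ l,
        (lookupT X (l.map I.entry)).val.getD a [] = I.disj X a := by
      intro l X hX
      rw [show I.entry = fun Y => (Y, (List.range I.rank.length).map fun a => I.disj Y a) from rfl,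
        lookupT_val_of_mem _ hX]
      simp [ha]
    rw [Instance.conj]
    congr 1
    · refine List.flatMap_congr fun X hX => h1 _ X ?_
      obtain ⟨p, -, q, rfl, h⟩ := Instance.startCalls_mem hI hX
      simpa [Instance.states] using h
    · congr 1
      refine List.flatMap_congr fun X hX => h1 _ X ?_
      obtain ⟨q, hq, rfl⟩ := List.mem_map.1 hX
      exact List.mem_map_of_mem (List.mem_range.2 (hI.2.1.1 q hq))
  · rw [← List.map_append, List.map_map]
    refine List.map_congr_left fun X hX => ?_
    simp only [Function.comp, Instance.entry, List.map_map]
    congr 1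
    refine List.map_congr_left fun a _ => ?_
    cases X with
    | start => simp at hX
    | inp q => rfl
    | call p q qs => rfl

theorem lookup_ataT {I : Instance} (hI : I.WF) {X : State} (hX : X ∈ I.states) {a : ℕ}
    (ha : a < I.rank.length) : (lookupT X (ataT I).val).val.getD a [] = I.conj X a := by
  rw [ataT_val hI, lookupT_val_of_mem _ hX]
  simp [ha]

/-! ### The table represents the automaton -/

theorem Expr.copies_mono {c c' : ℕ → ℕ∞} (h : ∀ p, c p ≤ c' p) (i : ℕ) (e : Expr) :
    e.copies c i ≤ e.copies c' i := by
  induction e using Expr.induct with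
  | var j => simp [Expr.copies]
  | cons b es ih =>
    simp only [Expr.copies, Expr.copiesAll_eq]
    exact List.sum_le_sum ih
  | call p x es ih =>
    simp only [Expr.copies, Expr.copiesAll_eq]
    refine add_le_add ?_ (List.sum_le_sum ih)
    split
    · exact h p
    · rfl

/-- `copies` is monotone in the copy numbers, so solutions are closed under pointwise infima and the
infimum of all of them is the least one. -/
theorem Mtt.copyNumber_solution (rank : List ℕ) (T : Mtt) :
    T.CopySolution rank (T.copyNumber rank) := by
  refine ⟨fun p => le_iInf fun c => c.2.1 p, fun r hr n hn i hi => le_iInf fun c => ?_⟩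
  exact (Expr.copies_mono (fun p => iInf_le _ c) i r.body).trans (c.2.2 r hr n hn i hi)

theorem atomsT_val (i : ℕ) (qs : List ℕ) :
    (atomsT i qs).val = (qs.zipIdx i).map fun x => (x.2, State.inp x.1) := by
  induction qs generalizing i with
  | nil => simp [atomsT]
  | cons q qs ih => simp [atomsT, ih]

theorem atomsT_time (i : ℕ) (qs : List ℕ) : (atomsT i qs).time = qs.length + 1 := by
  induction qs generalizing i with
  | nil => simp [atomsT]
  | cons q qs ih => simp [atomsT, ih]; omega

/-- The atoms of an input transition sit at the consecutive positions `j`, `j + 1`, …, so each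
position receives at most one state of weight 1, and none below `j`. -/
theorem atomsWeight_atomsT (I : Instance) (b j i : ℕ) (qs : List ℕ) :
    atomsWeight (I.weight b) (atomsT j qs).val i ≤ if j ≤ i then 1 else 0 := by
  induction qs generalizing j with
  | nil => simp [atomsT, atomsWeight]
  | cons q qs ih =>
    have := ih (j + 1)
    simp only [atomsWeight, atomsT, Timed.val_bind, Timed.val_pure, List.map_cons, List.sum_cons,
      Instance.weight] at this ⊢
    refine (add_le_add_right this _).trans ?_
    by_cases h1 : j = i
    · simp [h1]
    · by_cases h2 : j ≤ i
      · simp only [h1, h2, if_true, if_false, zero_add]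
        split <;> simp
      · have : ¬ (j + 1 ≤ i) := by omega
        simp [h1, h2, this]

/-- For a call state this is the constraint `b[p] ≥ b_i[e]` over the rules of `p`; for an input
state, each position receives one input state. -/
theorem disj_represents {I : Instance} (hI : I.WF) (b : ℕ) {n a : ℕ} (ha : I.rank[a]? = some n)
    {X : State} (hX : X ∈ I.states) (hs : X ≠ .start) :
    Represents I.states (I.weight b) n (fun _ => I.weight b X) (disjDnf n (I.disj X a))
      (I.ata.Φ X a) := by
  match X with
  | .start => exact absurd rfl hs
  | .inp q =>
    simp only [Instance.disj, disjDnf, List.flatMap_cons, List.flatMap_nil, List.append_nil,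
      Instance.ata, Instance.phiInp]
    have h1 : memberDnf n (.node [(I.inp.rules.filter fun r => r.target = q ∧ r.symbol = a).map
        fun r => ((atomsT 0 r.args).val, [])] []) 0 =
        (I.inp.rules.filter fun r => r.target = q ∧ r.symbol = a).flatMap fun r =>
          [(atomsTupleT n (atomsT 0 r.args).val).val] := by
      simp [memberDnf, dnfT_node_val, pairDnf, List.flatMap_map, selectT]
    rw [h1]
    refine .bigOr _ _ _ fun r hr => ?_
    simp only [List.mem_filter, decide_eq_true_eq] at hr
    have h2 := Represents.atoms (n := n) (w := I.weight b) (univ := I.states)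
      (atomsT 0 r.args).val (by
        intro x hx
        rw [atomsT_val, List.mem_map] at hx
        obtain ⟨y, hy, rfl⟩ := hx
        exact Instance.inp_mem_states.2 ((hI.2.1.2 r hr.1).2.2 _ (List.fst_mem_of_mem_zipIdx hy)))
    rw [atomsT_val, List.map_map] at h2
    rw [atomsT_val]
    refine h2.mono fun i _ => ?_
    have := atomsWeight_atomsT I b 0 i r.args
    rw [atomsT_val] at this
    simpa [Instance.weight] using this
  | .call p q qs =>
    simp only [Instance.disj, disjDnf, List.flatMap_map, Instance.ata, Instance.phiCall]
    refine .bigOr _ _ _ fun r hr => ?_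
    simp only [List.mem_filter, decide_eq_true_eq] at hr
    obtain ⟨n', k', h1, h2, h3⟩ := hI.1.2 r hr.1
    refine (inferT_represents hI b n n' k' qs r.body h3
      (Instance.call_mem_states.1 hX).2.1).mono fun i hi => ?_
    have := (Mtt.copyNumber_solution I.rank I.mtt).2 r hr.1 n (by rw [hr.2.2, ha]) i hi
    rwa [hr.2.1] at this

theorem disjDnf_flatMap {α : Type} (n : ℕ) (l : List α) (F : α → Disj) :
    disjDnf n (l.flatMap F) = l.flatMap fun x => disjDnf n (F x) := by
  simp [disjDnf, List.flatMap_assoc]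

/-- The weight `b + 1` of `start` splits into `b` for an initial procedure, by bounded copying, and
1 for a final state of the input type. -/
theorem conj_represents {I : Instance} (hI : I.WF) {b : ℕ} (hb : I.mtt.BoundedCopying I.rank b)
    {n a : ℕ} (ha : I.rank[a]? = some n) {X : State} (hX : X ∈ I.states) :
    ConjRepresents I.states (I.weight b) n (I.weight b X) (I.conj X a) (I.ata.Φ X a) := by
  match X with
  | .inp q => exact .single (disj_represents hI b ha hX (by simp))
  | .call p q qs => exact .single (disj_represents hI b ha hX (by simp))
  | .start =>
    have h1 : ConjRepresents I.states (I.weight b) n b [I.startCalls.flatMap fun X => I.disj X a]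
        (.bigOr (I.startCalls.map fun X => I.ata.Φ X a)) := by
      refine .single ?_
      rw [disjDnf_flatMap]
      refine .bigOr _ _ _ fun X hX => ?_
      obtain ⟨p, hp, q, rfl, h⟩ := Instance.startCalls_mem hI hX
      exact (disj_represents hI b ha h (by simp)).mono fun _ _ => hb p hp
    have h2 : ConjRepresents I.states (I.weight b) n 1
        [(I.inp.final.map State.inp).flatMap fun X => I.disj X a]
        (.bigOr ((I.inp.final.map State.inp).map fun X => I.ata.Φ X a)) := by
      refine .single ?_
      rw [disjDnf_flatMap]
      refine .bigOr _ _ _ fun X hX => ?_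
      obtain ⟨q, hq, rfl⟩ := List.mem_map.1 hX
      exact disj_represents hI b ha (Instance.inp_mem_states.2 (hI.2.1.1 q hq)) (by simp)
    have h3 := h1.append h2
    simpa [Instance.conj, Instance.weight, Instance.ata, Instance.startCalls, List.map_flatMap,
      Function.comp_def] using h3

/-! ### Running time of the construction of the table -/

section

variable {I : Instance} {b k K : ℕ}

theorem Bounds.params (h : Bounds I b k K) : I.out.states ≤ K ∧ I.out.final.length ≤ K ∧
    I.inp.states ≤ K ∧ I.inp.final.length ≤ K ∧ I.inp.rules.length ≤ K ∧
    I.mtt.arity.length ≤ K ∧ I.mtt.initial.length ≤ K ∧ I.mtt.rules.length ≤ K ∧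
    I.rank.length ≤ K ∧ k ≤ K := by
  have h1 := I.out.bounds
  have h2 := I.inp.bounds
  have h3 := I.mtt.bounds
  have h4 := h.out_size_le
  have h5 := h.inp_size_le
  have h6 := h.mtt_size_le
  have h7 := h.rank_length_le
  have h8 := h.width_le
  omega

/-- Bound for the time of the tabulation of tuples. -/
def tuplesBound (K : ℕ) : ℕ := 1 + K * (2 + K * (3 + 3 * K))

/-- Bound for the rows of one pair of a procedure and a tuple of states. -/
def rowsBound (K : ℕ) : ℕ :=
  (1 + K * (1 + ((1 + K * (1 + 2)) + (1 + K * (1 + K * inferBound K))))) +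
    (1 + K * (1 + (1 + K * (1 + (1 + K * (1 + 1))))))

/-- Bound for the table of the preimage. -/
def backwardBound (K : ℕ) : ℕ :=
  1 + ((K + 1) + ((K + 1) + (1 + K * (2 + ((1 + K) + (tuplesBound K +
    (1 + K * (2 + rowsBound K + K)))) + K * K))))

/-- The families depend on the procedure, the tuple of states and the symbol, but not on `q`: they
are inferred once and the rows for all `q` refer to them. -/
theorem backwardT_time_le (h : Bounds I b k K) :
    (backwardT I (List.range I.rank.length) (List.range I.out.states)).time ≤
      backwardBound K := by
  obtain ⟨h1, h2, h3, h4, h5, h6, h7, h8, h9, h10⟩ := h.params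
  simp only [backwardT, Timed.time_bind, Timed.time_tick, lengthT_time, lengthT_val, rangeT_time,
    rangeT_val, backwardBound, ← List.range_eq_range']
  gcongr
  have harity : ∀ p ∈ List.range I.mtt.arity.length, I.mtt.arity.getD p 0 ≤ k := by
    intro p hp
    rw [List.mem_range] at hp
    simpa [hp] using h.arity_le _ (List.getElem_mem hp)
  have htuples : ∀ p ∈ List.range I.mtt.arity.length,
      (tuples I.out.states (I.mtt.arity.getD p 0)).length ≤ K := by
    intro p hp
    rw [length_tuples]; exact h.pow_le _ (harity p hp)
  refine (flatMapT_time_le _ _ ((1 + K) + (tuplesBound K + (1 + K * (2 + rowsBound K + K))))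
    (K * K) (fun p hp => ?_) fun p hp => ?_).trans (by rw [List.length_range]; gcongr)
  · simp only [Timed.time_bind, getT_val, tuplesT_val]
    gcongr
    · exact (getT_time_le _ _ _).trans (by omega)
    · refine (tuplesT_time_le (K := K) h1 fun j hj => h.pow_le j (hj.trans (harity p hp))).trans ?_
      have := harity p hp
      unfold tuplesBound
      gcongr
      omega
    · refine (flatMapT_time_le _ _ (rowsBound K) K (fun qs hqs => ?_) fun qs hqs => ?_).trans
        (by have := htuples p hp; gcongr)
      · have hqs' : qs.length ≤ K := by
          rw [(mem_tuples.1 hqs).1]; exact (harity p hp).trans h10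
        simp only [Timed.time_bind, mapT_val, filterT_val, Timed.val_bind, Timed.val_pure,
          natEqT_val, rowsBound]
        gcongr
        · refine (mapT_time_le _ _ ((1 + K * (1 + 2)) + (1 + K * (1 + K * inferBound K)))
            fun a _ => ?_).trans (by rw [List.length_range]; gcongr)
          simp only [Timed.time_bind]
          gcongr
          · exact (filterT_time_le _ _ 2 (by simp)).trans (by gcongr)
          · refine (mapT_time_le _ _ (K * inferBound K) fun r hr => ?_).trans ?_
            · simp only [filterT_val, List.mem_filter] at hr
              obtain ⟨n', k', -, -, h11⟩ := h.wf.1.2 r hr.1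
              have h12 := I.mtt.bounds.2.2.2 r hr.1
              have h13 := h.mtt_size_le
              have h14 := inferT_time_le h qs hqs' r.body h11 (by omega)
              have h15 : r.body.size * inferBound K ≤ K * inferBound K := by gcongr; omega
              omega
            · rw [filterT_val]
              gcongr
              exact (List.length_filter_le _ _).trans h8
        · refine (mapT_time_le _ _ (1 + K * (1 + (1 + K * (1 + 1)))) fun q _ => ?_).trans
            (by rw [List.length_range]; gcongr)
          refine le_trans (b := (1 + K * (1 + (1 + K * (1 + 1)))) + 0) ?_ le_rfl
          simp only [Timed.time_bind, Timed.time_pure]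
          gcongr
          refine (mapT_time_le _ _ (1 + K * (1 + 1)) fun fs hfs => ?_).trans
            (by rw [List.length_map, List.length_range]; gcongr)
          refine (mapT_time_le _ _ 1 (by simp)).trans ?_
          gcongr
          obtain ⟨a, -, rfl⟩ := List.mem_map.1 hfs
          rw [List.length_map]
          exact (List.length_filter_le _ _).trans h8
      · simpa using h1
  · simp only [Timed.val_bind, flatMapT_val, getT_val, tuplesT_val]
    refine (length_flatMap_le _ _ K fun qs _ => by simpa using h1).trans ?_
    exact Nat.mul_le_mul_right _ (htuples p hp)

/-- Bound for the table of the input type. -/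
def inputBound (K : ℕ) : ℕ :=
  1 + ((K + 1) + (1 + K * (1 + (1 + K * (1 + ((1 + K * (1 + 2)) + (1 + K * (1 + (K + 1)))))))))

theorem inputT_time_le (h : Bounds I b k K) :
    (inputT I (List.range I.rank.length)).time ≤ inputBound K := by
  obtain ⟨h1, h2, h3, h4, h5, h6, h7, h8, h9, h10⟩ := h.params
  have hargs := I.inp.bounds.2.2.2
  have hK := h.inp_size_le
  simp only [inputT, Timed.time_bind, Timed.time_tick, rangeT_time, rangeT_val, inputBound,
    ← List.range_eq_range']
  gcongr
  refine (mapT_time_le _ _ (1 + K * (1 + ((1 + K * (1 + 2)) + (1 + K * (1 + (K + 1))))))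
    fun q _ => ?_).trans (by rw [List.length_range]; gcongr)
  refine le_trans (b := (1 + K * (1 + ((1 + K * (1 + 2)) + (1 + K * (1 + (K + 1)))))) + 0)
    ?_ le_rfl
  simp only [Timed.time_bind, Timed.time_pure]
  gcongr
  refine (mapT_time_le _ _ ((1 + K * (1 + 2)) + (1 + K * (1 + (K + 1)))) fun a _ => ?_).trans
    (by rw [List.length_range]; gcongr)
  simp only [Timed.time_bind, Timed.time_pure, add_zero]
  gcongr
  · exact (filterT_time_le _ _ 2 (by simp)).trans (by gcongr)
  · refine (mapT_time_le _ _ (K + 1) fun r hr => ?_).trans ?_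
    · simp only [filterT_val, List.mem_filter] at hr
      simp only [Timed.time_bind, Timed.time_pure, atomsT_time]
      have := hargs r hr.1
      omega
    · rw [filterT_val]
      gcongr
      exact (List.length_filter_le _ _).trans h5

/-- Bound for looking up an entry in a table. -/
def lookupBound (K : ℕ) : ℕ := (1 + K * (1 + K)) + (1 + K)

theorem length_entries (I : Instance) :
    (backwardT I (List.range I.rank.length) (List.range I.out.states)).val.length +
      (inputT I (List.range I.rank.length)).val.length + 1 = I.states.length := by
  rw [backwardT_val, inputT_val, Instance.states]
  simp only [List.length_map, List.length_cons, List.length_append]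

theorem length_disj_le (h : Bounds I b k K) (X : State) (a : ℕ) : (I.disj X a).length ≤ K := by
  have h1 := h.params
  have h2 := h.width_le
  match X with
  | .start => simp [Instance.disj]
  | .inp q => simp [Instance.disj]; omega
  | .call p q qs =>
    rw [Instance.disj, List.length_map]
    exact (List.length_filter_le _ _).trans (by omega)

theorem length_lookupT_le {α : Type} (X : State) (table : List (State × List α)) {L : ℕ}
    (h : ∀ x ∈ table, x.2.length ≤ L) : (lookupT X table).val.length ≤ L := by
  induction table with
  | nil => simp [lookupT]
  | cons x table ih =>
    simp only [lookupT, Timed.val_bind, Timed.val_ite, Timed.val_pure]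
    split
    · exact h x (by simp)
    · exact ih fun y hy => h y (by simp [hy])

/-- Bound for the construction of the table. -/
def ataBound (K : ℕ) : ℕ :=
  1 + ((K + 1) + ((K + 1) + ((K + 1) + ((1 + K * (1 + (1 + K * (1 + 1)))) + (backwardBound K +
    (inputBound K + ((1 + K * (2 + (1 + K * (1 + 1)) + K)) + ((1 + K * (1 + 1)) +
    ((1 + K * (1 + ((1 + K * K * (2 + lookupBound K + K)) + (1 + K * (2 + lookupBound K + K))))) +
    ((K + 1) + (1 + K * (1 + (1 + K * (1 + 1))))))))))))))

theorem length_startCalls_le (h : Bounds I b k K) : I.startCalls.length ≤ K * K := by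
  obtain ⟨h1, h2, h3, h4, h5, h6, h7, h8, h9, h10⟩ := h.params
  unfold Instance.startCalls
  refine (length_flatMap_le _ _ K fun p _ => ?_).trans (Nat.mul_le_mul_right _ h7)
  rw [List.length_map]
  exact (List.length_filter_le _ _).trans (by simpa using h1)

theorem ataT_time_le (h : Bounds I b k K) : (ataT I).time ≤ ataBound K := by
  obtain ⟨h1, h2, h3, h4, h5, h6, h7, h8, h9, h10⟩ := h.params
  have hlen := length_entries I
  have hstates := h.states_le
  have hlook : ∀ X ∈ I.states, ∀ l : List State, l.length ≤ K → ∀ a,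
      ((lookupT X (l.map I.entry)).time +
        (getT [] (lookupT X (l.map I.entry)).val a).time ≤ lookupBound K) ∧
      (X ∈ l → a < I.rank.length →
        (getT [] (lookupT X (l.map I.entry)).val a).val.length ≤ K) := by
    intro X hX l hl a
    have h11 : 4 + 2 * X.width ≤ K := by
      have := Instance.width_le h.arity_le X hX
      have := h.width_le
      omega
    refine ⟨add_le_add ?_ ?_, fun hXl ha => ?_⟩
    · refine (lookupT_time_le _ h11).trans ?_
      rw [List.length_map]; gcongr
    · refine (getT_time_le _ _ _).trans ?_
      gcongr
      refine length_lookupT_le _ _ fun x hx => ?_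
      obtain ⟨Y, -, rfl⟩ := List.mem_map.1 hx
      simpa [Instance.entry] using h9
    · rw [getT_val, show I.entry = fun Y => (Y, (List.range I.rank.length).map fun a => I.disj Y a) from rfl,
        lookupT_val_of_mem _ hXl]
      simpa [ha] using length_disj_le h X a
  have hco : ((List.range I.out.states).filter fun q =>
      !(I.out.final.any fun y => decide (q = y))).length ≤ K :=
    (List.length_filter_le _ _).trans (by simpa using h1)
  have hco' : ((List.range I.out.states).filter fun q =>
      !(I.out.final.any fun y => decide (q = y))) = I.coFinal := coFinal_eq I
  simp only [ataT, Timed.time_bind, Timed.time_tick, Timed.time_pure, Timed.val_bind,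
    Timed.val_pure, lengthT_time, lengthT_val, rangeT_time, rangeT_val, filterT_val, memT_val,
    natEqT_val, flatMapT_val, mapT_val, appendT_val, appendT_time, ← List.range_eq_range',
    add_zero, hco', ataBound]
  rw [hco'] at hco
  have hrow : ∀ x ∈ (backwardT I (List.range I.rank.length) (List.range I.out.states)).val ++
      (inputT I (List.range I.rank.length)).val, x.2.length ≤ K := by
    intro x hx
    rw [backwardT_val, inputT_val, ← List.map_append] at hx
    obtain ⟨X, -, rfl⟩ := List.mem_map.1 hx
    simpa [Instance.entry] using h9
  -- The summands of `ataBound` match the instructions of `ataT` in order of execution.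
  gcongr ?_ + (?_ + (?_ + (?_ + (?_ + (?_ + (?_ + (?_ + (?_ + (?_ + (?_ + ?_))))))))))
  · rfl
  · omega
  · omega
  · omega
  · refine (filterT_time_le _ _ (1 + K * (1 + 1)) fun q _ => ?_).trans
      (by rw [List.length_range]; gcongr)
    simp only [Timed.time_bind, Timed.time_pure, add_zero]
    exact (memT_time_le _ _ _ 1 (by simp)).trans (by gcongr)
  · exact backwardT_time_le h
  · exact inputT_time_le h
  · refine (flatMapT_time_le _ _ (1 + K * (1 + 1)) K (fun p _ => ?_) fun p _ => ?_).trans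
      (by gcongr)
    · exact (mapT_time_le _ _ 1 (by simp)).trans (by gcongr)
    · simpa using hco
  · exact (mapT_time_le _ _ 1 (by simp)).trans (by gcongr)
  · refine (mapT_time_le _ _ ((1 + K * K * (2 + lookupBound K + K)) +
      (1 + K * (2 + lookupBound K + K))) fun a ha => ?_).trans
      (by rw [List.length_range]; gcongr)
    rw [List.mem_range] at ha
    simp only [Timed.time_bind, Timed.time_pure, add_zero]
    rw [backwardT_val, inputT_val] at hlen ⊢
    simp only [List.length_map] at hlen
    gcongr
    · have key : ∀ X ∈ I.startCalls, X ∈ I.states ∧ X ∈ (List.range I.mtt.arity.length).flatMap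
          fun p => (tuples I.out.states (I.mtt.arity.getD p 0)).flatMap fun qs =>
            (List.range I.out.states).map fun q => State.call p q qs := fun X hX => by
        obtain ⟨p, -, q, rfl, hmem⟩ := Instance.startCalls_mem h.wf hX
        exact ⟨hmem, by simpa [Instance.states] using hmem⟩
      refine (flatMapT_time_le _ _ (lookupBound K) K
        (fun X hX => ?_) fun X hX => ?_).trans ?_
      · exact (hlook X (key X hX).1 _ (by omega) a).1
      · exact (hlook X (key X hX).1 _ (by omega) a).2 (key X hX).2 ha
      have := length_startCalls_le h
      rw [Instance.startCalls] at this
      gcongr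
    · have key : ∀ X ∈ I.inp.final.map State.inp, X ∈ I.states ∧
          X ∈ (List.range I.inp.states).map State.inp := fun X hX => by
        obtain ⟨q, hq, rfl⟩ := List.mem_map.1 hX
        have hq' := h.wf.2.1.1 q hq
        exact ⟨Instance.inp_mem_states.2 hq', List.mem_map_of_mem (List.mem_range.2 hq')⟩
      refine (flatMapT_time_le _ _ (lookupBound K) K
        (fun X hX => ?_) fun X hX => ?_).trans ?_
      · exact (hlook X (key X hX).1 _ (by simpa using h3) a).1
      · exact (hlook X (key X hX).1 _ (by simpa using h3) a).2 (key X hX).2 ha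
      rw [List.length_map]
      gcongr
  · omega
  · refine (mapT_time_le _ _ (1 + K * (1 + 1)) fun x hx => ?_).trans
      (by rw [List.length_append]; gcongr; omega)
    simp only [Timed.time_bind, Timed.time_pure, add_zero]
    refine (mapT_time_le _ _ 1 (by simp)).trans ?_
    have := hrow x hx
    gcongr

end

/-! ### The implications with a given head -/

section

variable {I : Instance} {b k K : ℕ}

/-- The normal form of `f` is computed fast and has at most `K` elements, which are `n`-tuples of
sets of states. -/
structure MemberOK (I : Instance) (n K : ℕ) (f : Shared × ℕ) : Prop where
  time_le : (dnfT n f.1).time ≤ K * nodeBound K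
  table_le : (dnfT n f.1).val.length ≤ K
  length_le : (memberDnf n f.1 f.2).length ≤ K
  plain : ∀ U ∈ memberDnf n f.1 f.2, PlainTuple I.states n U

/-- For a rule of `p`, the number of calls is at most the sum of the `b_i[e]` over `n` positions,
hence at most `n * (b + 1)`. The bound on the weight is essential: states of heavier procedures may
have exponentially large normal forms. -/
theorem disj_memberOK (h : Bounds I b k K) {n a : ℕ} (ha : I.rank[a]? = some n)
    {X : State} (hX : X ∈ I.states) (hw : I.weight b X ≤ b + 1) :
    ∀ f ∈ I.disj X a, MemberOK I n K f := by
  have hparams := h.params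
  have hn := List.mem_of_getElem? ha
  have hK : 4 ≤ K := by have := h.width_le; omega
  have hu := h.smallUniv hn
  match X with
  | .start => simp [Instance.disj]
  | .inp q =>
    simp only [Instance.disj, List.mem_singleton, forall_eq]
    set rs := I.inp.rules.filter fun r => r.target = q ∧ r.symbol = a with hrs
    have hlen : rs.length ≤ K := (List.length_filter_le _ _).trans hparams.2.2.2.2.1
    have hpair : ∀ r, pairDnf n [] ((atomsT 0 (BtaRule.args r)).val, []) =
        [(atomsTupleT n (atomsT 0 r.args).val).val] := by
      intro r; simp [pairDnf, selectT]
    have hmem : memberDnf n (.node [rs.map fun r => ((atomsT 0 r.args).val, [])] []) 0 =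
        rs.flatMap fun r => [(atomsTupleT n (atomsT 0 r.args).val).val] := by
      simp [memberDnf, dnfT_node_val, List.flatMap_map, hpair]
    have hats : ∀ r ∈ rs, ∀ x ∈ (atomsT 0 r.args).val, x.2 ∈ I.states := by
      intro r hr x hx
      rw [atomsT_val, List.mem_map] at hx
      obtain ⟨y, hy, rfl⟩ := hx
      exact Instance.inp_mem_states.2
        ((h.wf.2.1.2 r (List.mem_of_mem_filter hr)).2.2 _ (List.fst_mem_of_mem_zipIdx hy))
    refine ⟨?_, ?_, ?_, ?_⟩
    · have h1 := hu.dnfT_time_le (es := []) (fun _ => .node [] []) (fun _ => 1)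
        (rows := [rs.map fun r => ((atomsT 0 r.args).val, [])]) (by simp) (by simp) (by simp)
        (by simp; omega) (by simp; omega) (by simpa using hlen) (by
          simp only [List.mem_singleton, forall_eq, List.mem_map]
          rintro _ ⟨r, hr, rfl⟩
          refine ⟨?_, hats r hr, ?_⟩
          · rw [atomsT_val, List.length_map, List.length_zipIdx]
            have := I.inp.bounds.2.2.2 r (List.mem_of_mem_filter hr)
            have := h.inp_size_le
            omega
          · rw [List.map_nil, hpair]; simp; omega)
      have h2 : 1 * nodeBound K ≤ K * nodeBound K := by gcongr; omega
      simp only [List.map_nil, List.sum_nil] at h1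
      dsimp only
      omega
    · simp [dnfT_node_val]; omega
    · rw [hmem]
      simpa using hlen
    · rw [hmem]
      intro U hU
      simp only [List.mem_flatMap, List.mem_singleton] at hU
      obtain ⟨r, hr, rfl⟩ := hU
      exact (Represents.atoms (w := fun _ => 0) _ (hats r hr)).plain _ (by simp)
  | .call p q qs =>
    intro f hf
    simp only [Instance.disj, List.mem_map, List.mem_filter, decide_eq_true_eq] at hf
    obtain ⟨r, ⟨hr, hp, hs⟩, rfl⟩ := hf
    obtain ⟨n', k', h1, h2, h3⟩ := h.wf.1.2 r hr
    have hsol := Mtt.copyNumber_solution I.rank I.mtt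
    have hn' : n' = n := by
      rw [hs, ha, Option.some.injEq] at h1; exact h1.symm
    subst hn'
    have hcalls : r.body.calls ≤ n' * (b + 1) := by
      have h4 := Expr.calls_le_sum_copies hsol.1 r.body h3
      have h5 : ∑ i ∈ Finset.range n', r.body.copies (I.mtt.copyNumber I.rank) i ≤
          ∑ i ∈ Finset.range n', ((b + 1 : ℕ) : ℕ∞) := by
        refine Finset.sum_le_sum fun i hi => ?_
        refine (hsol.2 r hr n' h1 i (Finset.mem_range.1 hi)).trans ?_
        rw [hp]
        simpa [Instance.weight] using hw
      have h6 := h4.trans h5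
      simp only [Finset.sum_const, Finset.card_range, nsmul_eq_mul] at h6
      exact_mod_cast h6
    have hpow : max I.out.states 1 ^ r.body.calls ≤ K :=
      (Nat.pow_le_pow_right (Nat.lt_of_lt_of_le Nat.one_pos (le_max_right _ _)) hcalls).trans (h.calls_le n' hn)
    have hsize : r.body.size ≤ K := (I.mtt.bounds.2.2.2 r hr).trans h.mtt_size_le
    refine ⟨?_, ?_, ?_, ?_⟩
    · have h4 := dnfT_inferT_time_le h hn qs r.body h3 hsize hpow
      have h5 : r.body.size * nodeBound K ≤ K * nodeBound K := by gcongr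
      dsimp only
      omega
    · rw [length_dnfT_inferT]; exact hparams.1
    · exact (length_memberDnf_inferT_le h n' n' k' qs r.body h3 q).trans hpow
    · exact memberDnf_inferT_plain h n' n' k' qs r.body h3 q

theorem one_le_weight (b : ℕ) (X : State) : 1 ≤ I.weight b X := by
  match X with
  | .start => simp [Instance.weight]
  | .inp q => simp [Instance.weight]
  | .call p q qs => exact (Mtt.copyNumber_solution I.rank I.mtt).1 p

/-- The state `start` is responsible for the constants: it has two conjuncts, the first of which
collects up to `K * K` initial states with up to `K` rules each. -/
theorem conj_memberOK (h : Bounds I b k K) (hb : I.mtt.BoundedCopying I.rank b) {n a : ℕ}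
    (ha : I.rank[a]? = some n) {X : State} (hX : X ∈ I.states) (hw : I.weight b X ≤ b + 1) :
    (I.conj X a).length ≤ 2 ∧ ∀ d ∈ I.conj X a, d.length ≤ K * K * K ∧
      ∀ f ∈ d, MemberOK I n K f := by
  have hK : 4 ≤ K := by have := h.width_le; omega
  have hlen : ∀ X, (I.disj X a).length ≤ K * K * K := by
    intro X
    refine (length_disj_le h X a).trans ?_
    rw [mul_assoc]
    exact Nat.le_mul_of_pos_right _ (Nat.mul_pos (by omega) (by omega))
  match X with
  | .inp q =>
    simp only [Instance.conj, List.length_singleton, List.mem_singleton, forall_eq]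
    exact ⟨by omega, hlen _, disj_memberOK h ha hX hw⟩
  | .call p q qs =>
    simp only [Instance.conj, List.length_singleton, List.mem_singleton, forall_eq]
    exact ⟨by omega, hlen _, disj_memberOK h ha hX hw⟩
  | .start =>
    simp only [Instance.conj, List.length_cons, List.length_nil, List.mem_cons, List.not_mem_nil,
      or_false, forall_eq_or_imp, forall_eq]
    refine ⟨by omega, ⟨?_, ?_⟩, ?_, ?_⟩
    · exact (length_flatMap_le _ _ K fun X _ => length_disj_le h X a).trans
        (Nat.mul_le_mul_right _ (length_startCalls_le h))
    · intro f hf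
      obtain ⟨X, hX, hf⟩ := List.mem_flatMap.1 hf
      obtain ⟨p, hp, q, rfl, hmem⟩ := Instance.startCalls_mem h.wf hX
      exact disj_memberOK h ha hmem ((hb p hp).trans le_self_add) f hf
    · refine (length_flatMap_le _ _ K fun X _ => length_disj_le h X a).trans ?_
      rw [List.length_map]
      refine Nat.mul_le_mul_right _ (h.params.2.2.2.1.trans ?_)
      exact Nat.le_mul_of_pos_right _ (by omega)
    · intro f hf
      obtain ⟨X, hX, hf⟩ := List.mem_flatMap.1 hf
      obtain ⟨q, hq, rfl⟩ := List.mem_map.1 hX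
      exact disj_memberOK h ha (Instance.inp_mem_states.2 (h.wf.2.1.1 q hq))
        (by simp [Instance.weight]) f hf

/-- Bound for the number of elements of the normal form of a disjunction. -/
def disjLength (K : ℕ) : ℕ := K * K * K * K + 1

/-- Bound for the number of elements of the normal form of a conjunction. -/
def conjLength (b K : ℕ) : ℕ := disjLength K ^ (2 * (b + 1))

/-- Bound for one step of the computation of the normal form of a conjunction. -/
def conjStep (b K : ℕ) : ℕ :=
  2 + K * K * K * (3 + K * nodeBound K + 2 * K) +
    prodBound K (disjLength K + conjLength b K)

/-- Bound for the computation of the normal form of a conjunction. -/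
def conjBound (b K : ℕ) : ℕ := 2 + K + 2 * (b + 1) * conjStep b K

/-- Lengths multiply over the conjuncts. As their number is bounded in terms of `b`, the resulting
power has a fixed exponent. -/
theorem conjDnfT_le {n : ℕ} (hu : SmallUniv I.states n K) (c : Conj)
    (hc : ∀ d ∈ c, d.length ≤ K * K * K ∧ ∀ f ∈ d, MemberOK I n K f)
    (hlen : c.length ≤ 2 * (b + 1)) :
    (conjDnfT n c).val.length ≤ disjLength K ^ c.length ∧
      (∀ U ∈ (conjDnfT n c).val, PlainTuple I.states n U) ∧
      (conjDnfT n c).time ≤ 2 + K + c.length * conjStep b K := by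
  have hn := hu.arity_le
  induction c with
  | nil =>
    refine ⟨by simp [conjDnfT], ?_, by simp [conjDnfT]; omega⟩
    rw [conjDnfT_nil_val]
    exact (Represents.top (w := fun _ => 0) (ω := fun _ => 0)).plain
  | cons d c ih =>
    simp only [List.length_cons] at hlen
    obtain ⟨h1, h2, h3⟩ := ih (fun d hd => hc d (by simp [hd])) (by omega)
    obtain ⟨hd, hf⟩ := hc d (by simp)
    have h4 : (disjDnf n d).length ≤ disjLength K := by
      refine (length_flatMap_le _ _ K fun f hf' => (hf f hf').length_le).trans ?_
      exact (Nat.mul_le_mul_right _ hd).trans (Nat.le_succ _)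
    have h5 : ∀ U ∈ disjDnf n d, PlainTuple I.states n U := by
      intro U hU
      obtain ⟨f, hf', hU⟩ := List.mem_flatMap.1 hU
      exact (hf f hf').plain U hU
    -- The summand 1 in `disjLength` makes its powers monotone in the exponent.
    have h6 : 1 ≤ disjLength K := by unfold disjLength; omega
    have h7 : (conjDnfT n c).val.length ≤ conjLength b K :=
      h1.trans (Nat.pow_le_pow_right h6 (by omega))
    rw [conjDnfT_cons_val]
    refine ⟨?_, plain_prodT h5 h2, ?_⟩
    · rw [length_prodT, List.length_cons, pow_succ, mul_comm]
      exact Nat.mul_le_mul h1 h4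
    · have h8 := hu.prodT_time_le h5 h2 (h4.trans (Nat.le_add_right _ (conjLength b K)))
        (h7.trans (Nat.le_add_left _ _))
      have h9 : (flatMapT (fun f : Shared × ℕ => do
          let tab ← dnfT n f.1
          getT [] tab f.2) d).time ≤ 1 + K * K * K * (3 + K * nodeBound K + 2 * K) := by
        refine (flatMapT_time_le _ _ (K * nodeBound K + (1 + K)) K ?_ ?_).trans ?_
        · intro f hf'
          simp only [Timed.time_bind]
          have h10 := (hf f hf').time_le
          have h11 := getT_time_le [] (dnfT n f.1).val f.2
          have h12 := (hf f hf').table_le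
          omega
        · intro f hf'
          have := (hf f hf').length_le
          simpa [memberDnf] using this
        · have : 2 + (K * nodeBound K + (1 + K)) + K = 3 + K * nodeBound K + 2 * K := by ring
          rw [this]
          gcongr
      simp only [conjDnfT, Timed.time_bind, Timed.time_tick, List.length_cons]
      have h10 : (flatMapT (fun f : Shared × ℕ => do
          let tab ← dnfT n f.1
          getT [] tab f.2) d).val = disjDnf n d := by
        simp [disjDnf, memberDnf]
      rw [h10, add_mul]
      unfold conjStep at h3 ⊢
      omega

/-- The sets of states that the exploration meets. -/
structure GoodSet (I : Instance) (b : ℕ) (X : List State) : Prop where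
  nodup : X.Nodup
  mem : ∀ Y ∈ X, Y ∈ I.states
  weight_le : weight (I.weight b) X ≤ b + 1

theorem le_weight_of_mem (w : State → ℕ∞) {X : List State} {Y : State} (hY : Y ∈ X) :
    w Y ≤ weight w X :=
  List.single_le_sum (by simp) _ (List.mem_map_of_mem hY)

/-- Every state weighs at least 1. This turns the invariant weight into a bound on cardinality. -/
theorem GoodSet.length_le {X : List State} (h : GoodSet I b X) : X.length ≤ b + 1 := by
  have h1 : ∀ X : List State, (X.length : ℕ∞) ≤ weight (I.weight b) X := by
    intro X
    induction X with
    | nil => simp [weight]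
    | cons Y X ih =>
      simp only [weight, List.map_cons, List.sum_cons, List.length_cons, Nat.cast_add,
        Nat.cast_one] at ih ⊢
      rw [add_comm]
      exact add_le_add (one_le_weight b Y) ih
  have := (h1 X).trans h.weight_le
  exact_mod_cast this

theorem GoodSet.start : GoodSet I b [.start] :=
  ⟨by simp, by simpa using I.start_mem_states, by simp [weight, Instance.weight]⟩

/-- The implication `c` belongs to the system of all implications of `I.ata`. -/
def IsImplication (I : Instance) (c : Clause) : Prop :=
  ∃ a, I.rank[a]? = some c.body.length ∧
    ∃ Z ∈ (Formula.bigAnd (c.head.toFinset.toList.map fun Y => I.ata.Φ Y a)).dnf,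
      ∀ i < c.body.length, (c.body.getD i []).toFinset = Z i

/-- `X` has no duplicates, so it is a permutation of the list of its underlying set, over which
`Ata.Derives` forms the conjunction. -/
theorem conjDnfT_represents (h : Bounds I b k K) (hb : I.mtt.BoundedCopying I.rank b) {n a : ℕ}
    (ha : I.rank[a]? = some n) {X : List State} (hX : GoodSet I b X) :
    Represents I.states (I.weight b) n (fun _ => weight (I.weight b) X)
      (conjDnfT n (X.flatMap fun Y => I.conj Y a)).val
      (Formula.bigAnd (X.toFinset.toList.map fun Y => I.ata.Φ Y a)) := by
  refine (ConjRepresents.flatMap X (fun Y => I.conj Y a) (fun Y => I.ata.Φ Y a) fun Y hY =>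
    conj_represents h.wf hb ha (hX.mem Y hY)).congr ?_
  exact dnf_bigAnd_perm ((List.toFinset_toList hX.nodup).symm.map _)

theorem clausesT_val (h : Bounds I b k K) {X : List State} (hX : GoodSet I b X) :
    (clausesT I.rank (ataT I).val X).val = (List.range I.rank.length).flatMap fun a =>
      (conjDnfT (I.rank.getD a 0) (X.flatMap fun Y => I.conj Y a)).val.map (Clause.mk X) := by
  simp only [clausesT, Timed.val_bind, lengthT_val, rangeT_val, flatMapT_val, getT_val, mapT_val,
    Timed.val_pure, ← List.range_eq_range']
  refine List.flatMap_congr fun a ha => ?_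
  rw [List.mem_range] at ha
  congr 3
  exact List.flatMap_congr fun Y hY => lookup_ataT h.wf (hX.mem Y hY) ha

theorem mem_clausesT (h : Bounds I b k K) {X : List State} (hX : GoodSet I b X) {c : Clause} :
    c ∈ (clausesT I.rank (ataT I).val X).val ↔ ∃ a n, I.rank[a]? = some n ∧
      ∃ U ∈ (conjDnfT n (X.flatMap fun Y => I.conj Y a)).val, c = ⟨X, U⟩ := by
  simp only [clausesT_val h hX, List.mem_flatMap, List.mem_range, List.mem_map]
  constructor
  · rintro ⟨a, ha, U, hU, rfl⟩
    refine ⟨a, I.rank[a], by simp [ha], U, ?_, rfl⟩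
    simpa [ha] using hU
  · rintro ⟨a, n, ha, U, hU, rfl⟩
    obtain ⟨ha', rfl⟩ := List.getElem?_eq_some_iff.1 ha
    exact ⟨a, ha', U, by simpa [ha'] using hU, rfl⟩

/-- Bodies consist of good sets again because their weight is at most that of the head. -/
theorem clausesT_sound (h : Bounds I b k K) (hb : I.mtt.BoundedCopying I.rank b)
    {X : List State} (hX : GoodSet I b X) {c : Clause}
    (hc : c ∈ (clausesT I.rank (ataT I).val X).val) :
    c.head = X ∧ IsImplication I c ∧ c.body.length ≤ K ∧ ∀ Y ∈ c.body, GoodSet I b Y := by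
  obtain ⟨a, n, ha, U, hU, rfl⟩ := (mem_clausesT h hX).1 hc
  have h1 := conjDnfT_represents h hb ha hX
  obtain ⟨h2, h3⟩ := h1.valid U hU
  obtain ⟨Z, hZ, h4⟩ := h1.sound U hU
  refine ⟨rfl, ⟨a, by rw [h2, ha], Z, hZ, by rw [h2]; exact h4⟩, ?_, ?_⟩
  · dsimp only
    rw [h2]; exact (h.smallUniv (List.mem_of_getElem? ha)).arity_le
  · intro Y hY
    obtain ⟨i, hi, rfl⟩ := List.mem_iff_getElem.1 hY
    have h5 := h3 i (by rw [← h2]; exact hi)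
    simp only [List.getD_eq_getElem?_getD, List.getElem?_eq_getElem hi, Option.getD_some] at h5
    exact ⟨h5.1, h5.2.1, h5.2.2.trans hX.weight_le⟩

theorem clausesT_complete (h : Bounds I b k K) (hb : I.mtt.BoundedCopying I.rank b)
    {X : List State} (hX : GoodSet I b X) {a n : ℕ} (ha : I.rank[a]? = some n)
    {Z : ℕ → Finset State}
    (hZ : Z ∈ (Formula.bigAnd (X.toFinset.toList.map fun Y => I.ata.Φ Y a)).dnf) :
    ∃ c ∈ (clausesT I.rank (ataT I).val X).val, c.head = X ∧ c.body.length = n ∧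
      ∀ i < n, (c.body.getD i []).toFinset = Z i := by
  have h1 := conjDnfT_represents h hb ha hX
  obtain ⟨U, hU, h2⟩ := h1.complete Z hZ
  exact ⟨⟨X, U⟩, (mem_clausesT h hX).2 ⟨a, n, ha, U, hU, rfl⟩, rfl, (h1.valid U hU).1, h2⟩

/-- Bound for the number of implications with a given head. -/
def clauseCount (b K : ℕ) : ℕ := K * conjLength b K

/-- Bound for the computation of the implications with a given head. -/
def clausesBound (b K : ℕ) : ℕ :=
  1 + ((K + 1) + ((K + 1) + (1 + K * (2 + ((1 + K) + ((1 + (b + 1) * (2 + lookupBound K + 2)) +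
    (conjBound b K + (1 + conjLength b K * (1 + 1))))) + conjLength b K))))

theorem clausesT_le (h : Bounds I b k K) (hb : I.mtt.BoundedCopying I.rank b)
    {X : List State} (hX : GoodSet I b X) :
    (clausesT I.rank (ataT I).val X).val.length ≤ clauseCount b K ∧
      (clausesT I.rank (ataT I).val X).time ≤ clausesBound b K := by
  have hr := h.rank_length_le
  have hXlen := hX.length_le
  have hconj : ∀ a n, I.rank[a]? = some n →
      (conjDnfT n (X.flatMap fun Y => I.conj Y a)).val.length ≤ conjLength b K ∧
      (conjDnfT n (X.flatMap fun Y => I.conj Y a)).time ≤ conjBound b K := by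
    intro a n ha
    have hY : ∀ Y ∈ X, I.weight b Y ≤ b + 1 := fun Y hY =>
      (le_weight_of_mem _ hY).trans hX.weight_le
    -- At most `b + 1` states, each contributing at most two conjuncts.
    have hc : (X.flatMap fun Y => I.conj Y a).length ≤ 2 * (b + 1) := by
      refine (length_flatMap_le _ _ 2 fun Y hY' =>
        (conj_memberOK h hb ha (hX.mem Y hY') (hY Y hY')).1).trans ?_
      omega
    have h1 := conjDnfT_le (h.smallUniv (List.mem_of_getElem? ha))
      (X.flatMap fun Y => I.conj Y a) (fun d hd => by
        obtain ⟨Y, hY', hd⟩ := List.mem_flatMap.1 hd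
        exact (conj_memberOK h hb ha (hX.mem Y hY') (hY Y hY')).2 d hd) hc
    refine ⟨h1.1.trans (Nat.pow_le_pow_right (by unfold disjLength; omega) hc), h1.2.2.trans ?_⟩
    unfold conjBound
    gcongr
  have hrank : ∀ a, a < I.rank.length → I.rank[a]? = some (I.rank.getD a 0) := by
    intro a ha; simp [ha]
  constructor
  · rw [clausesT_val h hX]
    refine (length_flatMap_le _ _ (conjLength b K) fun a ha => ?_).trans
      (by rw [List.length_range]; exact Nat.mul_le_mul_right _ hr)
    rw [List.length_map]
    exact (hconj a _ (hrank a (List.mem_range.1 ha))).1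
  · simp only [clausesT, Timed.time_bind, Timed.time_tick, lengthT_time, lengthT_val, rangeT_time,
      rangeT_val, ← List.range_eq_range', clausesBound]
    have hc : ∀ a, a < I.rank.length → (X.flatMap fun Y =>
        ((do let row ← lookupT Y (ataT I).val
             getT [] row a : Timed Conj)).val) = X.flatMap fun Y => I.conj Y a := by
      intro a ha
      refine List.flatMap_congr fun Y hY => ?_
      simpa using lookup_ataT h.wf (hX.mem Y hY) ha
    gcongr
    refine (flatMapT_time_le _ _ ((1 + K) + ((1 + (b + 1) * (2 + lookupBound K + 2)) +
      (conjBound b K + (1 + conjLength b K * (1 + 1))))) (conjLength b K) (fun a ha => ?_)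
      fun a ha => ?_).trans (by rw [List.length_range]; gcongr)
    · rw [List.mem_range] at ha
      simp only [Timed.time_bind, flatMapT_val, getT_val] at hc ⊢
      rw [hc a ha]
      obtain ⟨h1, h2⟩ := hconj a _ (hrank a ha)
      gcongr
      · exact (getT_time_le _ _ _).trans (by omega)
      · refine (flatMapT_time_le _ _ (lookupBound K) 2 (fun Y hY => ?_) fun Y hY => ?_).trans
          (by gcongr)
        · simp only [Timed.time_bind]
          refine add_le_add ?_ ?_
          · refine (lookupT_time_le (c := K) _ ?_).trans ?_
            · have := Instance.width_le h.arity_le Y (hX.mem Y hY)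
              have := h.width_le
              omega
            · rw [ataT_val h.wf, List.length_map]
              have := h.states_le
              gcongr
          · refine (getT_time_le _ _ _).trans ?_
            gcongr
            refine length_lookupT_le _ _ fun x hx => ?_
            rw [ataT_val h.wf] at hx
            obtain ⟨Y, -, rfl⟩ := List.mem_map.1 hx
            simpa using hr
        · rw [Timed.val_bind, getT_val, lookup_ataT h.wf (hX.mem Y hY) ha]
          exact (conj_memberOK h hb (hrank a ha) (hX.mem Y hY)
            ((le_weight_of_mem _ hY).trans hX.weight_le)).1
      · exact (mapT_time_le _ _ 1 (by simp)).trans (by gcongr)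
    · rw [List.mem_range] at ha
      simp only [Timed.val_bind, flatMapT_val, getT_val, mapT_val, List.length_map] at hc ⊢
      rw [hc a ha]
      exact (hconj a _ (hrank a ha)).1

end

/-! ### The exploration -/

/-- Membership of a set of states, represented by a list, in a list of such sets. -/
def SetMem (X : List State) (l : List (List State)) : Prop := X.toFinset ∈ l.map List.toFinset

theorem memT_setEqT_val (X : List State) (l : List (List State)) :
    (memT setEqT X l).val = true ↔ SetMem X l := by
  simp only [SetMem, memT_val, setEqT_val, List.any_eq_true, decide_eq_true_eq, List.mem_map]
  exact exists_congr fun Y => and_congr_right fun _ => eq_comm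

theorem SetMem.of_mem {X : List State} {l : List (List State)} (h : X ∈ l) : SetMem X l :=
  List.mem_map_of_mem h

theorem SetMem.mono {X : List State} {l l' : List (List State)} (h : SetMem X l) (hl : l ⊆ l') :
    SetMem X l' := List.map_subset _ hl h

/-- Bounds for the exploration of the sets of states that satisfy `G`. -/
structure ExploreBounds (rank : List ℕ) (table : List (State × List Conj))
    (G : List State → Prop) (S C n T E : ℕ) : Prop where
  head : ∀ X, G X → ∀ c ∈ (clausesT rank table X).val, c.head = X
  good : ∀ X, G X → ∀ c ∈ (clausesT rank table X).val, ∀ Y ∈ c.body, G Y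
  body_le : ∀ X, G X → ∀ c ∈ (clausesT rank table X).val, c.body.length ≤ n
  count_le : ∀ X, G X → (clausesT rank table X).val.length ≤ C
  time_le : ∀ X, G X → (clausesT rank table X).time ≤ T
  eq_le : ∀ X Y, G X → G Y → (setEqT X Y).time ≤ E
  card_le : ∀ l : List (List State), (∀ X ∈ l, G X) → (l.map List.toFinset).Nodup → l.length ≤ S

/-- The clauses `cls` have been collected by visiting the sets `seen`, and `todo` remain to be
visited. -/
structure ExploreInv (rank : List ℕ) (table : List (State × List Conj)) (G : List State → Prop)
    (C : ℕ) (X₀ : List State) (todo seen : List (List State)) (cls : List Clause) : Prop where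
  good_todo : ∀ X ∈ todo, G X
  good_seen : ∀ X ∈ seen, G X
  nodup : (seen.map List.toFinset).Nodup
  sound : ∀ c ∈ cls, c.head ∈ seen ∧ c ∈ (clausesT rank table c.head).val
  complete : ∀ X ∈ seen, (clausesT rank table X).val ⊆ cls
  bodies : ∀ c ∈ cls, ∀ Y ∈ c.body, Y ∈ todo ∨ SetMem Y seen
  start : X₀ ∈ todo ∨ SetMem X₀ seen
  length_le : cls.length ≤ C * seen.length

/-- Bound for one round of the exploration. -/
def visitBound (S C n T E : ℕ) : ℕ :=
  1 + ((1 + S * (1 + E)) + (T + ((1 + C * (2 + 1 + n)) + ((C * n + 1) + (C + 1)))))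

section

variable {rank : List ℕ} {table : List (State × List Conj)} {G : List State → Prop}
  {S C n T E : ℕ} {X₀ : List State}

theorem visitT_val (X : List State) (todo seen : List (List State)) (cls : List Clause) :
    (visitT rank table X ⟨todo, seen, cls⟩).val =
      if (memT setEqT X seen).val then ⟨todo, seen, cls⟩ else
        ⟨(clausesT rank table X).val.flatMap Clause.body ++ todo, X :: seen,
          (clausesT rank table X).val ++ cls⟩ := by
  simp only [visitT, Timed.val_bind, Timed.val_ite, Timed.val_pure, flatMapT_val, appendT_val]

theorem visitT_time_le (h : ExploreBounds rank table G S C n T E) {X : List State}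
    {todo seen : List (List State)} {cls : List Clause} (hX : G X) (hseen : ∀ Y ∈ seen, G Y)
    (hS : seen.length ≤ S) :
    (visitT rank table X ⟨todo, seen, cls⟩).time ≤ visitBound S C n T E := by
  have h1 := memT_time_le setEqT X seen E fun Y hY => h.eq_le X Y hX (hseen Y hY)
  have h2 : seen.length * (1 + E) ≤ S * (1 + E) := by gcongr
  have h3 := h.time_le X hX
  have h4 := h.count_le X hX
  have h5 : (flatMapT (fun d : Clause => do tick; pure d.body)
      (clausesT rank table X).val).time ≤ 1 + C * (2 + 1 + n) :=
    (flatMapT_time_le _ _ 1 n (by simp) (by simpa using h.body_le X hX)).trans (by gcongr)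
  have h6 : ((clausesT rank table X).val.flatMap fun d => d.body).length ≤ C * n :=
    (length_flatMap_le _ _ n (h.body_le X hX)).trans (by gcongr)
  simp only [visitT, Timed.time_bind, Timed.time_tick, Timed.time_ite, Timed.time_pure,
    appendT_time, flatMapT_val, Timed.val_bind, Timed.val_pure, visitBound]
  split <;> omega

/-- The potential `|todo| + (S - |seen|) * (C * n)` drops in each round: either a set is discarded
from `todo`, or `seen` grows and frees enough potential for the new sets. -/
theorem ExploreInv.visit (h : ExploreBounds rank table G S C n T E) {X : List State}
    {todo seen : List (List State)} {cls : List Clause}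
    (hI : ExploreInv rank table G C X₀ (X :: todo) seen cls) :
    let c := (visitT rank table X ⟨todo, seen, cls⟩).val
    ExploreInv rank table G C X₀ c.todo c.seen c.clauses ∧
      c.todo.length + (S - c.seen.length) * (C * n) + 1 ≤
        (X :: todo).length + (S - seen.length) * (C * n) := by
  have hX : G X := hI.good_todo X (by simp)
  rw [visitT_val]
  split
  · next hmem =>
    rw [memT_setEqT_val] at hmem
    refine ⟨⟨fun Y hY => hI.good_todo Y (by simp [hY]), hI.good_seen, hI.nodup, hI.sound,
      hI.complete, fun c hc Y hY => ?_, ?_, hI.length_le⟩, ?_⟩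
    · rcases hI.bodies c hc Y hY with h1 | h1
      · rcases List.mem_cons.1 h1 with rfl | h1
        · exact Or.inr hmem
        · exact Or.inl h1
      · exact Or.inr h1
    · rcases hI.start with h1 | h1
      · rcases List.mem_cons.1 h1 with rfl | h1
        · exact Or.inr hmem
        · exact Or.inl h1
      · exact Or.inr h1
    · simp only [List.length_cons]; omega
  · next hmem =>
    rw [memT_setEqT_val] at hmem
    have hsub : seen ⊆ X :: seen := List.subset_cons_self _ _
    have hgood : ∀ Y ∈ X :: seen, G Y := by
      intro Y hY
      rcases List.mem_cons.1 hY with rfl | hY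
      · exact hX
      · exact hI.good_seen Y hY
    have hnodup : ((X :: seen).map List.toFinset).Nodup := by
      rw [List.map_cons, List.nodup_cons]
      exact ⟨hmem, hI.nodup⟩
    have hcard := h.card_le _ hgood hnodup
    rw [List.length_cons] at hcard
    refine ⟨⟨?_, hgood, hnodup, ?_, ?_, ?_, ?_, ?_⟩, ?_⟩
    · intro Y hY
      rcases List.mem_append.1 hY with h1 | h1
      · obtain ⟨c, hc, hY⟩ := List.mem_flatMap.1 h1
        exact h.good X hX c hc Y hY
      · exact hI.good_todo Y (by simp [h1])
    · intro c hc
      rcases List.mem_append.1 hc with h1 | h1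
      · rw [h.head X hX c h1]
        exact ⟨by simp, h1⟩
      · exact ⟨hsub (hI.sound c h1).1, (hI.sound c h1).2⟩
    · intro Y hY
      rcases List.mem_cons.1 hY with rfl | hY
      · exact List.subset_append_left _ _
      · exact List.Subset.trans (hI.complete Y hY) (List.subset_append_right _ _)
    · intro c hc Y hY
      rcases List.mem_append.1 hc with h1 | h1
      · exact Or.inl (List.mem_append_left _ (List.mem_flatMap.2 ⟨c, h1, hY⟩))
      · rcases hI.bodies c h1 Y hY with h2 | h2
        · rcases List.mem_cons.1 h2 with rfl | h2
          · exact Or.inr (SetMem.of_mem (by simp))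
          · exact Or.inl (List.mem_append_right _ h2)
        · exact Or.inr (h2.mono hsub)
    · rcases hI.start with h2 | h2
      · rcases List.mem_cons.1 h2 with rfl | h2
        · exact Or.inr (SetMem.of_mem (by simp))
        · exact Or.inl (List.mem_append_right _ h2)
      · exact Or.inr (h2.mono hsub)
    · have h1 := h.count_le X hX
      have h2 := hI.length_le
      simp only [List.length_append, List.length_cons, mul_add]
      omega
    · have h1 : ((clausesT rank table X).val.flatMap Clause.body).length ≤ C * n :=
        (length_flatMap_le _ _ n (h.body_le X hX)).trans
          (Nat.mul_le_mul_right _ (h.count_le X hX))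
      have h2 : S - seen.length = (S - (seen.length + 1)) + 1 := by omega
      simp only [List.length_append, List.length_cons]
      rw [h2, add_mul]
      omega

/-- Induction on a bound `m` for the potential, which also bounds the number of rounds. -/
theorem exists_explore (h : ExploreBounds rank table G S C n T E) (m : ℕ)
    {todo seen : List (List State)} {cls : List Clause}
    (hI : ExploreInv rank table G C X₀ todo seen cls)
    (hm : todo.length + (S - seen.length) * (C * n) ≤ m) :
    ∃ out t seen', Explore rank table ⟨todo, seen, cls⟩ out t ∧
      t ≤ 1 + m * visitBound S C n T E ∧ ExploreInv rank table G C X₀ [] seen' out := by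
  induction m generalizing todo seen cls with
  | zero =>
    obtain rfl : todo = [] := List.length_eq_zero_iff.1 (by omega)
    exact ⟨cls, 1, seen, .done _ _, by omega, hI⟩
  | succ m ih =>
    cases todo with
    | nil => exact ⟨cls, 1, seen, .done _ _, by omega, hI⟩
    | cons X todo =>
      obtain ⟨h1, h2⟩ := hI.visit h
      obtain ⟨out, t, seen', h3, h4, h5⟩ := ih h1 (by omega)
      refine ⟨out, _, seen', .visit _ _ _ _ _ _ h3, ?_, h5⟩
      have h6 := visitT_time_le h (todo := todo) (cls := cls) (hI.good_todo X (by simp))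
        hI.good_seen (h.card_le _ hI.good_seen hI.nodup)
      rw [add_mul]
      omega

end

/-! ### Solving the system of implications -/

/-- All heads that follow from `l` by one implication are in `l`. -/
def ClosedUnder (cls : List Clause) (l : List (List State)) : Prop :=
  ∀ c ∈ cls, (∀ Y ∈ c.body, SetMem Y l) → SetMem c.head l

/-- `l` is a list of different heads of implications. -/
def DistinctHeads (cls : List Clause) (l : List (List State)) : Prop :=
  (l.map List.toFinset).Nodup ∧ ∀ X ∈ l, ∃ c ∈ cls, c.head = X

theorem DistinctHeads.subperm {cls : List Clause} {l : List (List State)}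
    (h : DistinctHeads cls l) :
    (l.map List.toFinset).Subperm (cls.map fun c => c.head.toFinset) := by
  refine h.1.subperm fun F hF => ?_
  obtain ⟨X, hX, rfl⟩ := List.mem_map.1 hF
  obtain ⟨c, hc, rfl⟩ := h.2 X hX
  exact List.mem_map_of_mem hc

theorem DistinctHeads.length_le {cls : List Clause} {l : List (List State)}
    (h : DistinctHeads cls l) : l.length ≤ cls.length := by
  simpa using h.subperm.length_le

/-- Distinct heads that are as numerous as the implications exhaust all heads, so nothing is left to
derive. -/
theorem DistinctHeads.closed {cls : List Clause} {l : List (List State)}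
    (h : DistinctHeads cls l) (hl : cls.length ≤ l.length) : ClosedUnder cls l := by
  intro c hc _
  have h1 := h.subperm.perm_of_length_le (by simpa using hl)
  exact h1.mem_iff.2 (List.mem_map_of_mem hc)

open Classical in
theorem passT_cons_val (c : Clause) (cs : List Clause) (l : List (List State)) :
    (passT (c :: cs) l).val = (passT cs
      (if (∀ Y ∈ c.body, SetMem Y l) ∧ ¬ SetMem c.head l then c.head :: l else l)).val := by
  simp only [passT, Timed.val_bind, allT_val]
  congr 2
  refine if_congr ?_ rfl rfl
  rw [Bool.and_eq_true, Bool.not_eq_true', List.all_eq_true, ← Bool.not_eq_true,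
    memT_setEqT_val]
  simp only [memT_setEqT_val]

/-- Used with derivability for `P`; any property preserved by the implications works. -/
theorem passT_sound (P : Finset State → Prop) (cs : List Clause) (l : List (List State))
    (hP : ∀ c ∈ cs, (∀ Y ∈ c.body, P Y.toFinset) → P c.head.toFinset)
    (hl : ∀ X ∈ l, P X.toFinset) : ∀ X ∈ (passT cs l).val, P X.toFinset := by
  induction cs generalizing l with
  | nil => simpa [passT] using hl
  | cons c cs ih =>
    rw [passT_cons_val]
    refine ih _ (fun c hc => hP c (by simp [hc])) ?_
    split
    · next h =>
      intro X hX
      rcases List.mem_cons.1 hX with rfl | hX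
      · refine hP c (by simp) fun Y hY => ?_
        obtain ⟨Z, hZ, h1⟩ := List.mem_map.1 (h.1 Y hY)
        rw [← h1]; exact hl Z hZ
      · exact hl X hX
    · exact hl

theorem passT_distinct {cls : List Clause} (cs : List Clause) (l : List (List State))
    (hcs : cs ⊆ cls) (hl : DistinctHeads cls l) : DistinctHeads cls (passT cs l).val := by
  induction cs generalizing l with
  | nil => simpa [passT] using hl
  | cons c cs ih =>
    rw [passT_cons_val]
    refine ih _ (fun c hc => hcs (by simp [hc])) ?_
    split
    · next h =>
      refine ⟨?_, fun X hX => ?_⟩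
      · rw [List.map_cons, List.nodup_cons]
        exact ⟨h.2, hl.1⟩
      · rcases List.mem_cons.1 hX with rfl | hX
        · exact ⟨c, hcs (by simp), rfl⟩
        · exact hl.2 X hX
    · exact hl

theorem length_le_passT (cs : List Clause) (l : List (List State)) :
    l.length ≤ (passT cs l).val.length := by
  induction cs generalizing l with
  | nil => simp [passT]
  | cons c cs ih =>
    rw [passT_cons_val]
    refine le_trans ?_ (ih _)
    split <;> simp

theorem passT_eq_of_closed (cs : List Clause) (l : List (List State)) (h : ClosedUnder cs l) :
    (passT cs l).val = l := by
  induction cs with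
  | nil => simp [passT]
  | cons c cs ih =>
    rw [passT_cons_val, if_neg fun h' => h'.2 (h c (by simp) h'.1)]
    exact ih fun c hc => h c (by simp [hc])

/-- If nothing was added during the pass, each implication was tested against the same list `l`, and
none had a new head to contribute. -/
theorem closed_of_length_passT (cs : List Clause) (l : List (List State))
    (h : (passT cs l).val.length = l.length) : ClosedUnder cs l := by
  induction cs with
  | nil => intro c hc; simp at hc
  | cons c cs ih =>
    rw [passT_cons_val] at h
    split at h
    · have := length_le_passT cs (c.head :: l)
      rw [List.length_cons] at this
      omega
    · next h' =>
      intro c' hc'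
      rcases List.mem_cons.1 hc' with rfl | hc'
      · intro h1
        by_contra h2
        exact h' ⟨h1, h2⟩
      · exact ih h c' hc'

theorem passesT_eq_of_closed (cls rest : List Clause) (l : List (List State))
    (h : ClosedUnder cls l) : (passesT cls rest l).val = l := by
  induction rest with
  | nil => simp [passesT]
  | cons c rest ih => simp [passesT, passT_eq_of_closed cls l h, ih]

theorem passesT_distinct {cls : List Clause} (rest : List Clause) (l : List (List State))
    (hl : DistinctHeads cls l) : DistinctHeads cls (passesT cls rest l).val := by
  induction rest generalizing l with
  | nil => simpa [passesT] using hl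
  | cons c rest ih =>
    simp only [passesT, Timed.val_bind]
    exact ih _ (passT_distinct cls l (List.Subset.refl _) hl)

theorem passesT_sound (P : Finset State → Prop) (cls rest : List Clause) (l : List (List State))
    (hP : ∀ c ∈ cls, (∀ Y ∈ c.body, P Y.toFinset) → P c.head.toFinset)
    (hl : ∀ X ∈ l, P X.toFinset) : ∀ X ∈ (passesT cls rest l).val, P X.toFinset := by
  induction rest generalizing l with
  | nil => simpa [passesT] using hl
  | cons c rest ih =>
    simp only [passesT, Timed.val_bind]
    exact ih _ (passT_sound P cls l hP hl)

/-- A pass over a list that is not closed adds at least one head, and closed lists are fixed by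
further passes. -/
theorem passesT_closed_or (cls rest : List Clause) (l : List (List State)) :
    ClosedUnder cls (passesT cls rest l).val ∨
      l.length + rest.length ≤ (passesT cls rest l).val.length := by
  induction rest generalizing l with
  | nil => right; simp [passesT]
  | cons c rest ih =>
    by_cases h : ClosedUnder cls l
    · left
      rwa [passesT_eq_of_closed cls _ l h]
    · simp only [passesT, Timed.val_bind]
      refine (ih (passT cls l).val).imp id fun h1 => ?_
      have h2 := length_le_passT cls l
      have h3 : (passT cls l).val.length ≠ l.length := fun h' => h (closed_of_length_passT cls l h')
      rw [List.length_cons]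
      omega

/-- As many passes as implications suffice: if no closed list was reached earlier, every implication
has its head derived. -/
theorem passesT_closed (cls : List Clause) : ClosedUnder cls (passesT cls cls []).val := by
  rcases passesT_closed_or cls cls [] with h | h
  · exact h
  · exact (passesT_distinct cls [] ⟨by simp, by simp⟩).closed (by simpa using h)

/-- Bound for one pass over at most `L` implications. -/
def passBound (L n E : ℕ) : ℕ :=
  1 + L * (1 + ((1 + n * (1 + (1 + L * (1 + E)))) + (1 + L * (1 + E))))

section

variable {cls : List Clause} {G : List State → Prop} {L n E : ℕ}

theorem passT_time_le (hG : ∀ c ∈ cls, G c.head ∧ c.body.length ≤ n ∧ ∀ Y ∈ c.body, G Y)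
    (hE : ∀ X Y, G X → G Y → (setEqT X Y).time ≤ E) (hL : cls.length ≤ L)
    (l : List (List State)) (hl : DistinctHeads cls l) :
    (passT cls l).time ≤ passBound L n E := by
  suffices h : ∀ cs : List Clause, cs ⊆ cls → ∀ l, DistinctHeads cls l → (passT cs l).time ≤
      1 + cs.length * (1 + ((1 + n * (1 + (1 + L * (1 + E)))) + (1 + L * (1 + E)))) from
    (h cls (List.Subset.refl _) l hl).trans (by unfold passBound; gcongr)
  clear hl l
  intro cs
  induction cs with
  | nil => simp [passT]
  | cons c cs ih =>
    intro hcs l hl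
    obtain ⟨h1, h2, h3⟩ := hG c (hcs (by simp))
    have hmem : ∀ Y, G Y → (memT setEqT Y l).time ≤ 1 + L * (1 + E) := by
      intro Y hY
      refine (memT_time_le setEqT Y l E fun Z hZ => ?_).trans
        (by have := hl.length_le.trans hL; gcongr)
      obtain ⟨c', hc', rfl⟩ := hl.2 Z hZ
      exact hE _ _ hY (hG c' hc').1
    have h4 : (allT (fun Y => memT setEqT Y l) c.body).time ≤ 1 + n * (1 + (1 + L * (1 + E))) :=
      (allT_time_le _ _ _ fun Y hY => hmem Y (h3 Y hY)).trans (by gcongr)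
    have h5 := hmem c.head h1
    -- The list updated by `c` alone is the result of a pass over `[c]`.
    have h6 := passT_distinct (cls := cls) [c] l (by simpa using hcs (by simp : c ∈ c :: cs)) hl
    simp only [passT, Timed.val_bind, Timed.val_pure] at h6
    have h7 := ih (fun c hc => hcs (by simp [hc])) _ h6
    simp only [passT, Timed.time_bind, Timed.time_tick, List.length_cons]
    rw [add_mul]
    omega

/-- Bound for the solution of a system of at most `L` implications. -/
def solveBound (L n E : ℕ) : ℕ := 1 + ((1 + L * (1 + passBound L n E)) + (1 + L * (1 + E)))

theorem solveT_time_le (hG : ∀ c ∈ cls, G c.head ∧ c.body.length ≤ n ∧ ∀ Y ∈ c.body, G Y)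
    (hE : ∀ X Y, G X → G Y → (setEqT X Y).time ≤ E) (hL : cls.length ≤ L)
    (hstart : G [.start]) : (solveT cls).time ≤ solveBound L n E := by
  have h1 : ∀ rest : List Clause, ∀ l, DistinctHeads cls l →
      (passesT cls rest l).time ≤ 1 + rest.length * (1 + passBound L n E) := by
    intro rest
    induction rest with
    | nil => simp [passesT]
    | cons c rest ih =>
      intro l hl
      have h1 := ih _ (passT_distinct cls l (List.Subset.refl _) hl)
      have h2 := passT_time_le hG hE hL l hl
      simp only [passesT, Timed.time_bind, Timed.time_tick, List.length_cons]
      rw [add_mul]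
      omega
  have h0 : DistinctHeads cls [] := ⟨by simp, by simp⟩
  have h2 := passesT_distinct cls [] h0
  simp only [solveT, Timed.time_bind, Timed.time_tick, solveBound]
  gcongr
  · exact (h1 cls [] h0).trans (by gcongr)
  · refine (memT_time_le setEqT _ _ E fun Z hZ => ?_).trans
      (by have := h2.length_le.trans hL; gcongr)
    obtain ⟨c', hc', rfl⟩ := h2.2 Z hZ
    exact hE _ _ hstart (hG c' hc').1

end

/-! ### Bounds for the parameters of an instance -/

/-- Bound for the number of sets of states that the exploration meets. -/
def setCount (b K : ℕ) : ℕ := (b + 2) * (K + 1) ^ (b + 1)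

/-- Bound for the comparison of two sets of states. -/
def setEqBound (K : ℕ) : ℕ := 5 + 2 * (K * (2 + K * (1 + K)))

/-- Good sets have at most `b + 1` of at most `K` states, so their number is a sum of `b + 2`
binomial coefficients with fixed lower indices. -/
theorem exploreBounds {I : Instance} {b k K : ℕ} (h : Bounds I b k K)
    (hb : I.mtt.BoundedCopying I.rank b) :
    ExploreBounds I.rank (ataT I).val (GoodSet I b) (setCount b K) (clauseCount b K) K
      (clausesBound b K) (setEqBound K) := by
  have hw : ∀ X, GoodSet I b X → X.length ≤ K ∧ ∀ x ∈ X, 4 + 2 * x.width ≤ K := by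
    refine fun X hX => ⟨(hX.nodup.subperm hX.mem).length_le.trans h.states_le, fun x hx => ?_⟩
    have := Instance.width_le h.arity_le x (hX.mem x hx)
    have := h.width_le
    omega
  refine ⟨fun X hX c hc => (clausesT_sound h hb hX hc).1,
    fun X hX c hc => (clausesT_sound h hb hX hc).2.2.2,
    fun X hX c hc => (clausesT_sound h hb hX hc).2.2.1,
    fun X hX => (clausesT_le h hb hX).1, fun X hX => (clausesT_le h hb hX).2,
    fun X Y hX hY => ?_, fun l hl hnd => ?_⟩
  · exact setEqT_time_le (hw X hX).1 (hw Y hY).1 (hw X hX).2 (hw Y hY).2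
  · have h1 : (l.map List.toFinset).toFinset ⊆ (Finset.range (b + 2)).biUnion fun j =>
        Finset.powersetCard j I.states.toFinset := by
      intro F hF
      rw [List.mem_toFinset, List.mem_map] at hF
      obtain ⟨X, hX, rfl⟩ := hF
      refine Finset.mem_biUnion.2 ⟨X.toFinset.card, ?_, Finset.mem_powersetCard.2 ⟨?_, rfl⟩⟩
      · have h2 := List.toFinset_card_le X
        have h3 := (hl X hX).length_le
        rw [Finset.mem_range]; omega
      · intro Y hY
        rw [List.mem_toFinset] at hY ⊢
        exact (hl X hX).mem Y hY
    have h2 := Finset.card_le_card h1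
    rw [List.toFinset_card_of_nodup hnd, List.length_map] at h2
    refine h2.trans (Finset.card_biUnion_le.trans ?_)
    refine (Finset.sum_le_card_nsmul _ _ ((K + 1) ^ (b + 1)) fun j hj => ?_).trans
      (by simp [setCount])
    rw [Finset.mem_range] at hj
    rw [Finset.card_powersetCard]
    refine (Nat.choose_le_pow _ _).trans ?_
    -- The base `K + 1` is positive, so every exponent can be raised to `b + 1`.
    have h3 : I.states.toFinset.card ≤ K + 1 :=
      ((List.toFinset_card_le _).trans h.states_le).trans (Nat.le_succ K)
    exact (Nat.pow_le_pow_left h3 j).trans (Nat.pow_le_pow_right (by omega) (by omega))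

/-- Bound for the parameters of an instance of size `N`. -/
def paramBound (b k N : ℕ) : ℕ :=
  N + (N + 1) ^ k + (1 + N * ((N + 1) ^ k * N) + N) + (4 + 2 * k) + (N + 1) ^ (b + 1)

/-- `paramBound` adds up one summand for each numerical field of `Bounds`. All are immediate counts
except the last. -/
theorem bounds_paramBound {I : Instance} (hI : I.WF) (b : ℕ) {k : ℕ}
    (hk : ∀ m ∈ I.mtt.arity, m ≤ k) : Bounds I b k (paramBound b k I.size) := by
  have hout : I.out.size ≤ I.size := by unfold Instance.size; omega
  have hinp : I.inp.size ≤ I.size := by unfold Instance.size; omega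
  have hmtt : I.mtt.size ≤ I.size := by unfold Instance.size; omega
  have hs : I.out.states ≤ I.size := I.out.bounds.1.trans hout
  have hpow : ∀ l ≤ k, I.out.states ^ l ≤ (I.size + 1) ^ k := fun l hl =>
    (Nat.pow_le_pow_left (by omega) l).trans (Nat.pow_le_pow_right (by omega) hl)
  refine ⟨hI, hk, by unfold paramBound; omega, fun l hl => ?_, ?_, by unfold paramBound; omega,
    fun n hn => ?_⟩
  · have := hpow l hl
    unfold paramBound; omega
  · have h1 : ((List.range I.mtt.arity.length).flatMap fun p =>
        (tuples I.out.states (I.mtt.arity.getD p 0)).flatMap fun qs =>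
          (List.range I.out.states).map fun q => State.call p q qs).length ≤
        I.size * ((I.size + 1) ^ k * I.size) := by
      refine (length_flatMap_le _ _ ((I.size + 1) ^ k * I.size) fun p hp => ?_).trans ?_
      · refine (length_flatMap_le _ _ I.size fun qs _ => by simpa using hs).trans ?_
        rw [List.mem_range] at hp
        rw [length_tuples]
        refine Nat.mul_le_mul_right _ (hpow _ ?_)
        simpa [hp] using hk _ (List.getElem_mem hp)
      · rw [List.length_range]
        exact Nat.mul_le_mul_right _ (I.mtt.bounds.1.trans hmtt)
    have h2 := I.inp.bounds.1
    unfold paramBound Instance.states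
    simp only [List.length_cons, List.length_append, List.length_map, List.length_range]
    omega
  -- The arity `n` must not survive in an exponent: completeness of the output type absorbs `states
  -- ^ n` into the size, and only the exponent `b + 1` remains.
  · have h1 : max I.out.states 1 ^ n ≤ I.size + 1 := by
      rcases Nat.eq_zero_or_pos I.out.states with h0 | h0
      · simp [h0]
      · obtain ⟨a, ha⟩ := List.mem_iff_getElem?.1 hn
        rw [max_eq_left h0]
        have h2 := pow_le_length_rules hI.2.2.2 ha
        have h3 := I.out.bounds.2.2.1
        omega
    rw [pow_mul]
    have := Nat.pow_le_pow_left h1 (b + 1)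
    unfold paramBound; omega

/-! ### Correctness -/

theorem derives_of_isImplication {I : Instance} {c : Clause} (hc : IsImplication I c)
    (h : ∀ Y ∈ c.body, I.ata.Derives I.rank Y.toFinset) :
    I.ata.Derives I.rank c.head.toFinset := by
  obtain ⟨a, ha, Z, hZ, h1⟩ := hc
  refine .intro _ a _ ha Z hZ fun i hi => ?_
  rw [← h1 i hi]
  simp only [List.getD_eq_getElem?_getD, List.getElem?_eq_getElem hi, Option.getD_some]
  exact h _ (List.getElem_mem hi)

/-- The collected implications are those with heads in `seen`, and `seen` contains `{start}` and is
closed under passing to bodies, so leaving out all other implications loses no derivation. -/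
theorem solveT_val_iff {I : Instance} {b k K : ℕ} (h : Bounds I b k K)
    (hb : I.mtt.BoundedCopying I.rank b) {C : ℕ} {seen : List (List State)} {cls : List Clause}
    (hinv : ExploreInv I.rank (ataT I).val (GoodSet I b) C [.start] [] seen cls) :
    (solveT cls).val = true ↔ I.ata.Derives I.rank {State.start} := by
  have himp : ∀ c ∈ cls, IsImplication I c := fun c hc =>
    (clausesT_sound h hb (hinv.good_seen _ (hinv.sound c hc).1) (hinv.sound c hc).2).2.1
  simp only [solveT, Timed.val_bind, memT_setEqT_val]
  constructor
  · intro hmem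
    obtain ⟨X, hX, h1⟩ := List.mem_map.1 hmem
    have := passesT_sound (I.ata.Derives I.rank) cls cls []
      (fun c hc => derives_of_isImplication (himp c hc)) (by simp) X hX
    rw [h1] at this
    simpa using this
  · intro hder
    have key : ∀ F, I.ata.Derives I.rank F → F ∈ seen.map List.toFinset →
        F ∈ (passesT cls cls []).val.map List.toFinset := by
      intro F hF
      induction hF with
      | intro F a n ha Z hZ _ ih =>
        intro hmem
        obtain ⟨X, hX, rfl⟩ := List.mem_map.1 hmem
        obtain ⟨c, hc, hhead, hlen, hbody⟩ :=
          clausesT_complete h hb (hinv.good_seen X hX) ha hZ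
        have hc' := hinv.complete X hX hc
        have h1 := passesT_closed cls c hc' fun Y hY => by
          obtain ⟨i, hi, rfl⟩ := List.mem_iff_getElem.1 hY
          have h2 := hbody i (by omega)
          simp only [List.getD_eq_getElem?_getD, List.getElem?_eq_getElem hi,
            Option.getD_some] at h2
          have h3 := ih i (by omega)
          rw [← h2] at h3
          refine h3 ?_
          rcases hinv.bodies c hc' _ hY with h4 | h4
          · simp at h4
          · exact h4
        rwa [hhead] at h1
    have h1 : ([State.start] : List State).toFinset = {State.start} := by simp
    rw [SetMem, h1]
    refine key _ hder ?_
    rcases hinv.start with h2 | h2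
    · simp at h2
    · rwa [SetMem, h1] at h2

/-- Bound for the running time of the algorithm. -/
def runBound (b K : ℕ) : ℕ :=
  ataBound K + (1 + (1 + setCount b K * (clauseCount b K * K)) *
    visitBound (setCount b K) (clauseCount b K) K (clausesBound b K) (setEqBound K)) +
  solveBound (clauseCount b K * setCount b K) K (setEqBound K)

theorem exists_run {I : Instance} {b k K : ℕ} (h : Bounds I b k K)
    (hb : I.mtt.BoundedCopying I.rank b) :
    ∃ ans t, I.Run ans t ∧ t ≤ runBound b K ∧
      (ans = true ↔ ¬ I.ata.Derives I.rank {State.start}) := by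
  have hE := exploreBounds h hb
  have h0 : ExploreInv I.rank (ataT I).val (GoodSet I b) (clauseCount b K) [.start]
      [[.start]] [] [] :=
    ⟨by simpa using GoodSet.start, by simp, by simp, by simp, by simp, by simp, by simp, by simp⟩
  -- The fuel is the potential of the initial configuration: one set to visit and none seen.
  obtain ⟨cls, t, seen, h1, h2, h3⟩ := exists_explore hE
    (1 + setCount b K * (clauseCount b K * K)) h0 (by simp)
  refine ⟨_, _, ⟨cls, t, h1, rfl, rfl⟩, ?_, ?_⟩
  · have hseen := hE.card_le _ h3.good_seen h3.nodup
    have h4 := ataT_time_le h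
    have h5 := solveT_time_le (n := K) (E := setEqBound K) (cls := cls) (G := GoodSet I b)
      (L := clauseCount b K * setCount b K)
      (fun c hc => by
        obtain ⟨h6, h7⟩ := h3.sound c hc
        have h8 := h3.good_seen _ h6
        exact ⟨h8, hE.body_le _ h8 c h7, hE.good _ h8 c h7⟩)
      hE.eq_le (h3.length_le.trans (Nat.mul_le_mul_left _ hseen)) .start
    unfold runBound
    omega
  · rw [← solveT_val_iff h hb h3]
    simp

/-! ### The bound is a polynomial -/

/-- `f` is given by a polynomial. -/
def IsPoly (f : ℕ → ℕ) : Prop := ∃ P : Polynomial ℕ, ∀ n, f n = P.eval n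

theorem IsPoly.const (c : ℕ) : IsPoly fun _ => c := ⟨.C c, by simp⟩

theorem IsPoly.id : IsPoly fun n => n := ⟨.X, by simp⟩

theorem IsPoly.add {f g : ℕ → ℕ} (hf : IsPoly f) (hg : IsPoly g) : IsPoly fun n => f n + g n := by
  obtain ⟨P, hP⟩ := hf
  obtain ⟨Q, hQ⟩ := hg
  exact ⟨P + Q, by simp [hP, hQ]⟩

theorem IsPoly.mul {f g : ℕ → ℕ} (hf : IsPoly f) (hg : IsPoly g) : IsPoly fun n => f n * g n := by
  obtain ⟨P, hP⟩ := hf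
  obtain ⟨Q, hQ⟩ := hg
  exact ⟨P * Q, by simp [hP, hQ]⟩

theorem IsPoly.pow {f : ℕ → ℕ} (hf : IsPoly f) (c : ℕ) : IsPoly fun n => f n ^ c := by
  obtain ⟨P, hP⟩ := hf
  exact ⟨P ^ c, by simp [hP]⟩

/-- The time bounds are built from sums, products and powers whose exponents depend on `b` and `k`
only, so closure of polynomials under these operations is applied bound by bound. -/
theorem IsPoly.unionBound {f g : ℕ → ℕ} (hf : IsPoly f) (hg : IsPoly g) :
    IsPoly fun n => MttTypecheck.unionBound (f n) (g n) := by
  unfold MttTypecheck.unionBound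
  repeat' first
    | assumption
    | with_reducible exact IsPoly.const _
    | with_reducible apply IsPoly.add
    | with_reducible apply IsPoly.mul

theorem IsPoly.tupleUnionBound {f : ℕ → ℕ} (hf : IsPoly f) :
    IsPoly fun n => MttTypecheck.tupleUnionBound (f n) := by
  unfold MttTypecheck.tupleUnionBound
  -- Reducible transparency keeps nested bounds folded, so that each is treated by its own closure
  -- lemma.
  repeat' first
    | assumption
    | with_reducible exact IsPoly.const _
    | with_reducible apply IsPoly.add
    | with_reducible apply IsPoly.mul
    | with_reducible apply IsPoly.unionBound

theorem IsPoly.prodBound {f g : ℕ → ℕ} (hf : IsPoly f) (hg : IsPoly g) :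
    IsPoly fun n => MttTypecheck.prodBound (f n) (g n) := by
  unfold MttTypecheck.prodBound
  repeat' first
    | assumption
    | with_reducible exact IsPoly.const _
    | with_reducible apply IsPoly.add
    | with_reducible apply IsPoly.mul
    | with_reducible apply IsPoly.tupleUnionBound

theorem IsPoly.selectBound {f : ℕ → ℕ} (hf : IsPoly f) :
    IsPoly fun n => MttTypecheck.selectBound (f n) := by
  unfold MttTypecheck.selectBound
  repeat' first
    | assumption
    | with_reducible exact IsPoly.const _
    | with_reducible apply IsPoly.add
    | with_reducible apply IsPoly.mul
    | with_reducible apply IsPoly.prodBound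

theorem IsPoly.atomsBound {f : ℕ → ℕ} (hf : IsPoly f) :
    IsPoly fun n => MttTypecheck.atomsBound (f n) := by
  unfold MttTypecheck.atomsBound
  repeat' first
    | assumption
    | with_reducible exact IsPoly.const _
    | with_reducible apply IsPoly.add
    | with_reducible apply IsPoly.mul
    | with_reducible apply IsPoly.tupleUnionBound

theorem IsPoly.nodeBound {f : ℕ → ℕ} (hf : IsPoly f) :
    IsPoly fun n => MttTypecheck.nodeBound (f n) := by
  unfold MttTypecheck.nodeBound
  repeat' first
    | assumption
    | with_reducible exact IsPoly.const _
    | with_reducible apply IsPoly.add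
    | with_reducible apply IsPoly.mul
    | with_reducible apply IsPoly.selectBound
    | with_reducible apply IsPoly.atomsBound

theorem IsPoly.disjLength {f : ℕ → ℕ} (hf : IsPoly f) :
    IsPoly fun n => MttTypecheck.disjLength (f n) := by
  unfold MttTypecheck.disjLength
  repeat' first
    | assumption
    | with_reducible exact IsPoly.const _
    | with_reducible apply IsPoly.add
    | with_reducible apply IsPoly.mul

theorem IsPoly.conjLength (b : ℕ) {f : ℕ → ℕ} (hf : IsPoly f) :
    IsPoly fun n => MttTypecheck.conjLength b (f n) := by
  unfold MttTypecheck.conjLength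
  repeat' first
    | assumption
    | with_reducible exact IsPoly.const _
    | with_reducible apply IsPoly.add
    | with_reducible apply IsPoly.mul
    | with_reducible apply IsPoly.pow
    | with_reducible apply IsPoly.disjLength

theorem IsPoly.conjStep (b : ℕ) {f : ℕ → ℕ} (hf : IsPoly f) :
    IsPoly fun n => MttTypecheck.conjStep b (f n) := by
  unfold MttTypecheck.conjStep
  repeat' first
    | assumption
    | with_reducible exact IsPoly.const _
    | with_reducible apply IsPoly.add
    | with_reducible apply IsPoly.mul
    | with_reducible apply IsPoly.prodBound
    | with_reducible apply IsPoly.nodeBound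
    | with_reducible apply IsPoly.disjLength
    | with_reducible apply IsPoly.conjLength

theorem IsPoly.conjBound (b : ℕ) {f : ℕ → ℕ} (hf : IsPoly f) :
    IsPoly fun n => MttTypecheck.conjBound b (f n) := by
  unfold MttTypecheck.conjBound
  repeat' first
    | assumption
    | with_reducible exact IsPoly.const _
    | with_reducible apply IsPoly.add
    | with_reducible apply IsPoly.mul
    | with_reducible apply IsPoly.conjStep

theorem IsPoly.lookupBound {f : ℕ → ℕ} (hf : IsPoly f) :
    IsPoly fun n => MttTypecheck.lookupBound (f n) := by
  unfold MttTypecheck.lookupBound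
  repeat' first
    | assumption
    | with_reducible exact IsPoly.const _
    | with_reducible apply IsPoly.add
    | with_reducible apply IsPoly.mul

theorem IsPoly.clauseCount (b : ℕ) {f : ℕ → ℕ} (hf : IsPoly f) :
    IsPoly fun n => MttTypecheck.clauseCount b (f n) := by
  unfold MttTypecheck.clauseCount
  repeat' first
    | assumption
    | with_reducible exact IsPoly.const _
    | with_reducible apply IsPoly.add
    | with_reducible apply IsPoly.mul
    | with_reducible apply IsPoly.conjLength

theorem IsPoly.clausesBound (b : ℕ) {f : ℕ → ℕ} (hf : IsPoly f) :
    IsPoly fun n => MttTypecheck.clausesBound b (f n) := by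
  unfold MttTypecheck.clausesBound
  repeat' first
    | assumption
    | with_reducible exact IsPoly.const _
    | with_reducible apply IsPoly.add
    | with_reducible apply IsPoly.mul
    | with_reducible apply IsPoly.conjLength
    | with_reducible apply IsPoly.conjBound
    | with_reducible apply IsPoly.lookupBound

theorem IsPoly.inferBound {f : ℕ → ℕ} (hf : IsPoly f) :
    IsPoly fun n => MttTypecheck.inferBound (f n) := by
  unfold MttTypecheck.inferBound
  repeat' first
    | assumption
    | with_reducible exact IsPoly.const _
    | with_reducible apply IsPoly.add
    | with_reducible apply IsPoly.mul

theorem IsPoly.tuplesBound {f : ℕ → ℕ} (hf : IsPoly f) :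
    IsPoly fun n => MttTypecheck.tuplesBound (f n) := by
  unfold MttTypecheck.tuplesBound
  repeat' first
    | assumption
    | with_reducible exact IsPoly.const _
    | with_reducible apply IsPoly.add
    | with_reducible apply IsPoly.mul

theorem IsPoly.rowsBound {f : ℕ → ℕ} (hf : IsPoly f) :
    IsPoly fun n => MttTypecheck.rowsBound (f n) := by
  unfold MttTypecheck.rowsBound
  repeat' first
    | assumption
    | with_reducible exact IsPoly.const _
    | with_reducible apply IsPoly.add
    | with_reducible apply IsPoly.mul
    | with_reducible apply IsPoly.inferBound

theorem IsPoly.backwardBound {f : ℕ → ℕ} (hf : IsPoly f) :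
    IsPoly fun n => MttTypecheck.backwardBound (f n) := by
  unfold MttTypecheck.backwardBound
  repeat' first
    | assumption
    | with_reducible exact IsPoly.const _
    | with_reducible apply IsPoly.add
    | with_reducible apply IsPoly.mul
    | with_reducible apply IsPoly.tuplesBound
    | with_reducible apply IsPoly.rowsBound

theorem IsPoly.inputBound {f : ℕ → ℕ} (hf : IsPoly f) :
    IsPoly fun n => MttTypecheck.inputBound (f n) := by
  unfold MttTypecheck.inputBound
  repeat' first
    | assumption
    | with_reducible exact IsPoly.const _
    | with_reducible apply IsPoly.add
    | with_reducible apply IsPoly.mul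

theorem IsPoly.ataBound {f : ℕ → ℕ} (hf : IsPoly f) :
    IsPoly fun n => MttTypecheck.ataBound (f n) := by
  unfold MttTypecheck.ataBound
  repeat' first
    | assumption
    | with_reducible exact IsPoly.const _
    | with_reducible apply IsPoly.add
    | with_reducible apply IsPoly.mul
    | with_reducible apply IsPoly.lookupBound
    | with_reducible apply IsPoly.backwardBound
    | with_reducible apply IsPoly.inputBound

theorem IsPoly.setCount (b : ℕ) {f : ℕ → ℕ} (hf : IsPoly f) :
    IsPoly fun n => MttTypecheck.setCount b (f n) := by
  unfold MttTypecheck.setCount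
  repeat' first
    | assumption
    | with_reducible exact IsPoly.const _
    | with_reducible apply IsPoly.add
    | with_reducible apply IsPoly.mul
    | with_reducible apply IsPoly.pow

theorem IsPoly.setEqBound {f : ℕ → ℕ} (hf : IsPoly f) :
    IsPoly fun n => MttTypecheck.setEqBound (f n) := by
  unfold MttTypecheck.setEqBound
  repeat' first
    | assumption
    | with_reducible exact IsPoly.const _
    | with_reducible apply IsPoly.add
    | with_reducible apply IsPoly.mul

theorem IsPoly.visitBound {f g h i j : ℕ → ℕ} (hf : IsPoly f) (hg : IsPoly g) (hh : IsPoly h)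
    (hi : IsPoly i) (hj : IsPoly j) :
    IsPoly fun n => MttTypecheck.visitBound (f n) (g n) (h n) (i n) (j n) := by
  unfold MttTypecheck.visitBound
  repeat' first
    | assumption
    | with_reducible exact IsPoly.const _
    | with_reducible apply IsPoly.add
    | with_reducible apply IsPoly.mul

theorem IsPoly.passBound {f g h : ℕ → ℕ} (hf : IsPoly f) (hg : IsPoly g) (hh : IsPoly h) :
    IsPoly fun n => MttTypecheck.passBound (f n) (g n) (h n) := by
  unfold MttTypecheck.passBound
  repeat' first
    | assumption
    | with_reducible exact IsPoly.const _
    | with_reducible apply IsPoly.add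
    | with_reducible apply IsPoly.mul

theorem IsPoly.solveBound {f g h : ℕ → ℕ} (hf : IsPoly f) (hg : IsPoly g) (hh : IsPoly h) :
    IsPoly fun n => MttTypecheck.solveBound (f n) (g n) (h n) := by
  unfold MttTypecheck.solveBound
  repeat' first
    | assumption
    | with_reducible exact IsPoly.const _
    | with_reducible apply IsPoly.add
    | with_reducible apply IsPoly.mul
    | with_reducible apply IsPoly.passBound

theorem IsPoly.runBound (b : ℕ) {f : ℕ → ℕ} (hf : IsPoly f) :
    IsPoly fun n => MttTypecheck.runBound b (f n) := by
  unfold MttTypecheck.runBound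
  repeat' first
    | assumption
    | with_reducible exact IsPoly.const _
    | with_reducible apply IsPoly.add
    | with_reducible apply IsPoly.mul
    | with_reducible apply IsPoly.clauseCount
    | with_reducible apply IsPoly.clausesBound
    | with_reducible apply IsPoly.ataBound
    | with_reducible apply IsPoly.setCount
    | with_reducible apply IsPoly.setEqBound
    | with_reducible apply IsPoly.visitBound
    | with_reducible apply IsPoly.solveBound

theorem isPoly_paramBound (b k : ℕ) : IsPoly fun n => paramBound b k n := by
  unfold paramBound
  repeat' first
    | exact IsPoly.const _
    | exact IsPoly.id
    | apply IsPoly.add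
    | apply IsPoly.mul
    | apply IsPoly.pow

end MttTypecheck

-- The main theorem

theorem mainTheorem6 (b k : ℕ) :
    ∃ P : Polynomial ℕ, ∀ I : MttTypecheck.Instance,
      I.WF → (∀ m ∈ I.mtt.arity, m ≤ k) → I.mtt.BoundedCopying I.rank b →
      ∃ (ans : Bool) (t : ℕ), I.Run ans t ∧ t ≤ P.eval I.size ∧
        (ans = true ↔ ¬ ∃ X ∈ I.ata.initial, I.ata.Derives I.rank {X}) := by
  obtain ⟨P, hP⟩ := (MttTypecheck.isPoly_paramBound b k).runBound b
  refine ⟨P, fun I hI hk hb => ?_⟩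
  obtain ⟨ans, t, h1, h2, h3⟩ :=
    MttTypecheck.exists_run (MttTypecheck.bounds_paramBound hI b hk) hb
  refine ⟨ans, t, h1, h2.trans (hP I.size).le, h3.trans (not_congr ?_)⟩
  simp [MttTypecheck.Instance.ata]
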